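/- Let $\mathbb H$ be the upper half-plane, $z=x+iy\in\mathbb H$, $q=e^{2\pi i z}$, and for $\kappa\in\mathbb Z$ put $$\Delta_\kappa=y^2\left(\frac{\partial^2}{\partial x^2}+\frac{\partial^2}{\partial y^2}\right)-i\kappa y\left(\frac{\partial}{\partial x}+i\frac{\partial}{\partial y}\right),\qquad \xi_\kappa F=2iy^\kappa\,\overline{\partial_{\bar z}F}.$$ For a Dirichlet character $\chi$ mod $N$, let $H_\kappa(N,\chi)$ be the set of real-analytic $F:\mathbb H\to\mathbb C$ with $F(\gamma z)=\chi(d)(cz+d)^\kappa F(z)$ for all $\gamma=\begin{pmatrix}a&b\\c&d\end{pmatrix}\in\Gamma_0(N)$, $\Delta_\kappa F=0$, at most linear exponential growth at the cusps, and $\xi_\kappa F$ holomorphic at every cusp. For $n\ge 1$ put $\beta_{2-k}(n,y)=\int_y^\infty e^{-4\pi nu}u^{k-2}\,du$, and put $\beta_{2-k}(0,y)=(1-k)^{-1}y^{k-1}$ if $k\ne1$, $\beta_{1}(0,y)=-\log y$. A function $G$ on $\mathbb H$ is a mock modular form of weight $2-k$, level $N$ and character $\chi$ with shadow $g$ if there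 is $F\in H_{2-k}(N,\chi)$ with $\xi_{2-k}F=g$ and with Fourier expansion $$F(z)=\sum_{n\ge n_0}c^+(n)q^n-\sum_{n\ge0}\overline{c(n)}\,\beta_{2-k}(n,y)q^{-n}\qquad(n_0\in\mathbb Z)$$ whose holomorphic part $\sum_{n\ge n_0}c^+(n)q^n$ equals $G(z)$. Let $L,M,t\ge1$ be integers, let $\psi,\varrho$ be Dirichlet characters mod $L$ and mod $M$, and let $k$ be an integer with $\psi(-1)\varrho(-1)=(-1)^k$. Write $\mathbf 1_N$ for the trivial character mod $N$. Let $\varrho^0$ be the primitive character inducing $\varrho$, $m_\varrho$ its conductor, $\ell_\varrho=M/m_\varrho$, and $W(\varrho^0)=\sum_{n=1}^{m_\varrho}\varrho^0(n)e^{2\pi i n/m_\varrho}$. Let $L(s,\cdot)$ denote the (analytically continued) Dirichlet $L$-function. For integers $n\ge1$ put $$\sigma_{k-1}^{\psi,\varrho}(n)=\sum_{0<c\mid n}\psi\!\left(\frac nc\right)c^{k-1}\sum_{0<d\mid\gcd(\ell_\varrho,c)}d\,\mu\!\left(\frac{\ell_\varrho}d\right)\overline{\varrho^0}\!\left(\frac{\ell_\varrho}d\right)\varrho^0\!\left(\frac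 cd\right),$$ and put $\sigma_{k-1}^{\psi,\varrho}(x)=0$ if $x$ is not a positive integer. Assume $k>2$, or $k=2$ and $(\psi,\varrho)\ne(\mathbf 1_L,\mathbf 1_M)$. Let $C_k(\psi,\varrho)=L(k,\overline\varrho)$ if $\psi=\mathbf 1_1$ (that is, $L=1$) and $C_k(\psi,\varrho)=0$ otherwise, and let $$E_k^{\psi,\varrho,t}(z)=C_k(\psi,\varrho)+\left(-\frac{2\pi i}M\right)^k\frac{W(\overline{\varrho^0})}{(k-1)!}\sum_{n=1}^\infty\sigma_{k-1}^{\psi,\varrho}(n)q^{tn}.$$ Put $$c_{2-k}^+(0,t,\psi,\varrho)=\begin{cases}\dfrac{2^{2-k}\pi i^{k-2}}{(tM)^{k-1}(k-1)}L(k-1,\overline\psi)\prod_{p\mid M}(1-p^{-1}),&\varrho=\mathbf 1_M,\\[2mm]0,&\varrho\ne\mathbf 1_M,\end{cases}$$ and for $n>0$ $$c_{2-k}^+(n,t,\psi,\varrho)=\frac{2^{2-k}\pi i^{k-2}}{M^k(k-1)}W(\varrho^0)\,n^{1-k}\,\sigma_{k-1}^{\overline\psi,\overline\varrho}\!\left(\frac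 nt\right).$$ Then the series $G_{2-k}^{\psi,\varrho,t}(z)=\sum_{n=0}^\infty c_{2-k}^+(n,t,\psi,\varrho)q^n$ converges on $\mathbb H$ and is a mock modular form of weight $2-k$, level $tLM$ and character $\overline{\psi\varrho}$ with shadow $E_k^{\psi,\varrho,t}(z)$. -/

import Mathlib

open UpperHalfPlane
open scoped MatrixGroups ModularForm

noncomputable section

namespace MockEis

/-! ### Differential operators on functions on the upper half-plane -/

/-- A function on `ℍ` read as a function on `ℂ` (only its values at points of positive imaginary
part, where it agrees with `F`, are used). -/
def toC (F : ℍ → ℂ) : ℂ → ℂ := fun w => F (ofComplex w)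

/-- `∂f/∂x`. -/
def dx (f : ℂ → ℂ) : ℂ → ℂ := fun w => fderiv ℝ f w 1

/-- `∂f/∂y`. -/
def dy (f : ℂ → ℂ) : ℂ → ℂ := fun w => fderiv ℝ f w Complex.I

/-- The Wirtinger derivative `∂f/∂z̄ = (∂f/∂x + i ∂f/∂y) / 2`. -/
def dzbar (f : ℂ → ℂ) : ℂ → ℂ := fun w => (dx f w + Complex.I * dy f w) / 2

/-- The weight `κ` hyperbolic Laplacian
`Δ_κ = y² (∂²/∂x² + ∂²/∂y²) - i κ y (∂/∂x + i ∂/∂y)`. -/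
def hypLaplacian (κ : ℤ) (F : ℍ → ℂ) (z : ℍ) : ℂ :=
  (z.im : ℂ) ^ 2 * (dx (dx (toC F)) z + dy (dy (toC F)) z)
    - Complex.I * κ * z.im * (dx (toC F) z + Complex.I * dy (toC F) z)

/-- The operator `ξ_κ F = 2 i y^κ conj (∂F/∂z̄)`. -/
def xi (κ : ℤ) (F : ℍ → ℂ) (z : ℍ) : ℂ :=
  2 * Complex.I * (z.im : ℂ) ^ κ * star (dzbar (toC F) z)

/-! ### Harmonic Maass forms and mock modular forms -/

/-- `f (γ z) = χ(d) (c z + d)^κ f(z)` for all `γ = (a b; c d)` in `Γ₀(N)`. -/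
def IsModular (κ : ℤ) (N : ℕ) (χ : DirichletCharacter ℂ N) (f : ℍ → ℂ) : Prop :=
  ∀ γ : SL(2, ℤ), γ ∈ CongruenceSubgroup.Gamma0 N → ∀ z : ℍ,
    f (γ • z) = χ ((γ 1 1 : ℤ) : ZMod N) * ((γ 1 0 : ℂ) * z + (γ 1 1 : ℂ)) ^ κ * f z

/-- At most linear exponential growth at all cusps: for each `γ ∈ SL₂(ℤ)` there is a constant `C`
with `(f|γ)(z) = O(e^{C y})` as `y → ∞`, uniformly in `x`. -/
def LinearExpGrowthAtCusps (κ : ℤ) (f : ℍ → ℂ) : Prop :=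
  ∀ γ : SL(2, ℤ), ∃ C : ℝ, (f ∣[κ] γ) =O[atImInfty] (fun z : ℍ => Real.exp (C * z.im))

/-- Holomorphy at all cusps (for a function that is holomorphic on `ℍ` and modular). -/
def HolomorphicAtCusps (κ : ℤ) (f : ℍ → ℂ) : Prop :=
  ∀ γ : SL(2, ℤ), IsBoundedAtImInfty (f ∣[κ] γ)

/-- The space `H_κ(N, χ)` of weakly harmonic Maass forms of weight `κ`, level `N` and character `χ`
whose image under `ξ_κ` (which has weight `2 - κ`) is holomorphic at every cusp. -/
structure IsHarmonicMaass (κ : ℤ) (N : ℕ) (χ : DirichletCharacter ℂ N) (F : ℍ → ℂ) : Prop where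
  analytic : AnalyticOnNhd ℝ (toC F) {w : ℂ | 0 < w.im}
  modular : IsModular κ N χ F
  harmonic : ∀ z : ℍ, hypLaplacian κ F z = 0
  growth : LinearExpGrowthAtCusps κ F
  xi_cusps : HolomorphicAtCusps (2 - κ) (xi κ F)

/-- `qpow n z = q^n = e^{2 π i n z}`. -/
def qpow (n : ℤ) (z : ℍ) : ℂ := Complex.exp (2 * Real.pi * Complex.I * n * z)

/-- The function `β_{2-k}(n, y)`. -/
def beta (k : ℤ) (n : ℕ) (y : ℝ) : ℝ :=
  if n = 0 then
    if k = 1 then -Real.log y else (1 - (k : ℝ))⁻¹ * y ^ (k - 1)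
  else ∫ u in Set.Ioi y, Real.exp (-4 * Real.pi * n * u) * u ^ (k - 2)

/-- `G` is a mock modular form of weight `2 - k`, level `N` and character `χ` with shadow `g`:
there is `F ∈ H_{2-k}(N, χ)` with `ξ_{2-k} F = g` whose Fourier expansion at `∞`,
`F = ∑_{n ≥ n₀} c⁺(n) q^n - ∑_{n ≥ 0} conj (c(n)) β_{2-k}(n, y) q^{-n}`,
has holomorphic part `∑_{n ≥ n₀} c⁺(n) q^n = G`. -/
def IsMockModularForm (k : ℤ) (N : ℕ) (χ : DirichletCharacter ℂ N) (G g : ℍ → ℂ) : Prop :=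
  ∃ F : ℍ → ℂ, IsHarmonicMaass (2 - k) N χ F ∧ xi (2 - k) F = g ∧
    ∃ (n₀ : ℤ) (cplus : ℤ → ℂ) (c : ℕ → ℂ),
      (∀ n < n₀, cplus n = 0) ∧
      (∀ z : ℍ, HasSum (fun n : ℤ => cplus n * qpow n z) (G z)) ∧
      (∀ z : ℍ, HasSum (fun n : ℕ => star (c n) * beta k n z.im * qpow (-n) z) (G z - F z))

/-! ### Dirichlet characters -/

variable {L M N : ℕ}

/-- The integer `ℓ_χ = N / m_χ`, with `m_χ` the conductor of `χ`. -/
def ell (χ : DirichletCharacter ℂ N) : ℕ := N / χ.conductor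

/-- The Gauss sum `W(χ⁰)` of the primitive character `χ⁰` inducing `χ`. -/
def gaussW (χ : DirichletCharacter ℂ N) : ℂ :=
  ∑ n ∈ Finset.Icc 1 χ.conductor,
    χ.primitiveCharacter (n : ZMod χ.conductor) *
      Complex.exp (2 * Real.pi * Complex.I * n / χ.conductor)

/-- The twisted divisor sum `σ_{k-1}^{ψ,ϱ}(n)`, for `n ≥ 1`. -/
def sigma (k : ℕ) (ψ : DirichletCharacter ℂ L) (ϱ : DirichletCharacter ℂ M) (n : ℕ) : ℂ :=
  ∑ c ∈ n.divisors, ψ ((n / c : ℕ) : ZMod L) * (c : ℂ) ^ (k - 1) *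
    ∑ d ∈ (Nat.gcd (ell ϱ) c).divisors,
      (d : ℂ) * (ArithmeticFunction.moebius (ell ϱ / d) : ℂ) *
        star (ϱ.primitiveCharacter ((ell ϱ / d : ℕ) : ZMod ϱ.conductor)) *
        ϱ.primitiveCharacter ((c / d : ℕ) : ZMod ϱ.conductor)

/-- The product character `ψϱ` modulo `t L M`. -/
def prodChar (t : ℕ) (ψ : DirichletCharacter ℂ L) (ϱ : DirichletCharacter ℂ M) :
    DirichletCharacter ℂ (t * L * M) :=
  DirichletCharacter.changeLevel ((Dvd.intro_left t rfl).mul_right M) ψ *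
    DirichletCharacter.changeLevel (Dvd.intro_left (t * L) rfl) ϱ

/-- `∏_{p ∣ M} (1 - p⁻¹)`. -/
def eulerProd (M : ℕ) : ℂ := ∏ p ∈ M.primeFactors, (1 - (p : ℂ)⁻¹)

/-! ### Eisenstein series and the mock modular form -/

/-- The constant term `C_k(ψ, ϱ)`: it is `L(k, conj ϱ)` if `ψ` is the character modulo `1`, and `0`
otherwise. -/
def eisConst (k : ℕ) [NeZero M] (_ψ : DirichletCharacter ℂ L) (ϱ : DirichletCharacter ℂ M) : ℂ :=
  if L = 1 then DirichletCharacter.LFunction (star ϱ) k else 0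

/-- The Eisenstein series `E_k^{ψ,ϱ}`, for `k > 2`, or `k = 2` and `ψ`, `ϱ` not both trivial, as a
function of a complex variable `w` with positive imaginary part. -/
def eisSeries (k : ℕ) [NeZero M] (ψ : DirichletCharacter ℂ L) (ϱ : DirichletCharacter ℂ M)
    (w : ℂ) : ℂ :=
  eisConst k ψ ϱ + (-(2 * Real.pi * Complex.I) / M) ^ k * (gaussW (star ϱ) / (k - 1).factorial) *
    ∑' n : ℕ, if n = 0 then 0 else
      sigma k ψ ϱ n * Complex.exp (2 * Real.pi * Complex.I * n * w)

/-- The Eisenstein series `E_k^{ψ,ϱ,t}(z) = E_k^{ψ,ϱ}(t z)`, in the same range of `k`, `ψ`, `ϱ`. -/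
def eisSeriesT (k t : ℕ) [NeZero M] (ψ : DirichletCharacter ℂ L) (ϱ : DirichletCharacter ℂ M)
    (z : ℍ) : ℂ :=
  eisSeries k ψ ϱ (t * z)

open Classical in
/-- The coefficients `c⁺_{2-k}(n, t, ψ, ϱ)`. -/
def mockCoeff (k t : ℕ) [NeZero L] (ψ : DirichletCharacter ℂ L) (ϱ : DirichletCharacter ℂ M)
    (n : ℕ) : ℂ :=
  if n = 0 then
    if ϱ = 1 then
      2 ^ (2 - k : ℤ) * Real.pi * Complex.I ^ (k - 2 : ℤ) / ((t * M : ℂ) ^ (k - 1) * (k - 1 : ℂ)) *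
        DirichletCharacter.LFunction (star ψ) (k - 1) * eulerProd M
    else 0
  else
    2 ^ (2 - k : ℤ) * Real.pi * Complex.I ^ (k - 2 : ℤ) / ((M : ℂ) ^ k * (k - 1 : ℂ)) *
      gaussW ϱ * (n : ℂ) ^ (1 - k : ℤ) *
      (if t ∣ n then sigma k (star ψ) (star ϱ) (n / t) else 0)

/-- The `q`-series `G_{2-k}^{ψ,ϱ,t}(z) = ∑_{n ≥ 0} c⁺_{2-k}(n, t, ψ, ϱ) q^n`. -/
def mockG (k t : ℕ) [NeZero L] (ψ : DirichletCharacter ℂ L) (ϱ : DirichletCharacter ℂ M)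
    (z : ℍ) : ℂ :=
  ∑' n : ℕ, mockCoeff k t ψ ϱ n * qpow n z

end MockEis

end

noncomputable section

namespace MockEis

/-! ### `q`-series with coefficients of polynomial growth -/

/-! Write k = j + 2 and `phi j w` = w⁻¹ w̄^{-(j+1)}. The harmonic Maass form is the non-holomorphic
Eisenstein series F(z) = y^{j+1} / (2(j+1)) · ∑_{(m,n)} ψ̄(m) ϱ(n) φ_j(m t M z + n), where y^{j+1}
φ_j has exactly the automorphy of weight -j = 2 - k. Everything follows from computing this sum in
two ways.

Modularity. For γ in Γ₀(tLM) a unimodular substitution of (m, n) carries the sum at γz to the sum at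
z, and the characters produce the nebentypus (`hasSum_latTermS_smul`). The terms have size
|w|^{-(j+2)}, so for j ≥ 1 the sum converges absolutely. For j = 0 it does not: the terms are
grouped into L × M blocks of residues, on which the characters sum to zero, so that each block gains
one power of decay (`norm_block_le`). Inserting |w|^{-2s} and letting s → 0⁺ by dominated
convergence transfers the transformation law to the block sum (`tendsto_latTermS`, `exists_latSum`).

Fourier expansion. The sum ∑_n φ_j(τ + n) is found by induction on j from the cotangent series and
the Lipschitz formula, by means of the partial fraction given by w - w̄ = 2iy
(`hasSum_im_pow_mul_phi`). Twisting by ϱ puts Gauss sums into the coefficients, and for imprimitive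
ϱ these equal W(ϱ⁰) times the inner sum of the twisted divisor function (`gaussC_eq`). Collecting
the rows m ≠ 0 along n = tmc gives the divisor sums (`hasSum_divSum`); the constant terms of these
rows add up to L(k - 1, ψ̄), and the row m = 0 contributes L(k, ϱ) times y^{k-1}. The outcome is
`latValue_eq`, and `maass_eq_latValue` matches it with the Fourier series that defines `maass`.

Shadow. The non-holomorphic part is built from powers of y and conjugates of holomorphic q-series,
and telescoping gives ∂F/∂z̄ = (i/2) y^j Ē, where E is the q-series of the Eisenstein series
(`dzbar_nonhol`, `dzbar_maass`). This single equation yields ξF = E, the vanishing of the Laplacian,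
and the modularity of E, obtained by differentiating the transformation law of F
(`isModular_of_dzbar`).

Cusps. Coefficients of polynomial growth make F and E bounded by powers of y + y⁻¹. Together with
modularity this bounds every slash by a power of y as y → ∞ (`IsModular.norm_slash_le`). That is
more than the growth condition on F requires; for the holomorphic E it gives boundedness at each
cusp, by removal of the singularity in the variable q (`isBoundedAtImInfty_of_periodic`). -/

theorem hasSum_of_eq {α ι : Type*} [AddCommMonoid α] [TopologicalSpace α] {f g : ι → α} {a b : α}
    (h : HasSum f a) (hfg : ∀ i, g i = f i) (hab : b = a) : HasSum g b := by
  rwa [hab, funext hfg]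

/-- The sequence `a` grows at most polynomially. -/
def PolyGrowth (a : ℕ → ℂ) : Prop := ∃ (C : ℝ) (B : ℕ), ∀ n, ‖a n‖ ≤ C * (n + 1 : ℝ) ^ B

/-- The `q`-series `∑ a(n) e^{2 π i n w}`. -/
def qser (a : ℕ → ℂ) (w : ℂ) : ℂ := ∑' n : ℕ, a n * Complex.exp (2 * Real.pi * Complex.I * n * w)

theorem norm_qexp (n : ℝ) (w : ℂ) :
    ‖Complex.exp (2 * Real.pi * Complex.I * n * w)‖ = Real.exp (-(2 * Real.pi * n * w.im)) := by
  rw [Complex.norm_exp]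
  congr 1
  simp [Complex.mul_re, Complex.mul_im]

theorem norm_qexp_nat (n : ℕ) (w : ℂ) :
    ‖Complex.exp (2 * Real.pi * Complex.I * n * w)‖ = Real.exp (-(2 * Real.pi * n * w.im)) := by
  simpa using norm_qexp n w

/-- The exponential series gives exp x ≥ x^{B+2} / (B+2)!. Two powers beyond B are taken so that
n^{-2} is left over for summability, at the price of y^{-(B+2)}. -/
theorem pow_mul_exp_neg_le (B : ℕ) {n : ℕ} (hn : n ≠ 0) {y : ℝ} (hy : 0 < y) :
    (n + 1 : ℝ) ^ B * Real.exp (-(2 * Real.pi * n * y)) ≤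
      (2 ^ B * (B + 2).factorial) * ((n : ℝ) ^ 2)⁻¹ * (y ^ (B + 2))⁻¹ := by
  have hn1 : (1 : ℝ) ≤ n := by exact_mod_cast Nat.one_le_iff_ne_zero.mpr hn
  have hpos : 0 < (n : ℝ) * y := by positivity
  have h1 := Real.pow_div_factorial_le_exp ((n : ℝ) * y) hpos.le (B + 2)
  have h2 : (n : ℝ) * y ≤ 2 * Real.pi * n * y := by
    have := Real.pi_gt_three
    nlinarith
  have h3 : Real.exp (-(2 * Real.pi * n * y)) ≤ (B + 2).factorial / ((n : ℝ) * y) ^ (B + 2) := by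
    calc Real.exp (-(2 * Real.pi * n * y)) ≤ Real.exp (-(n * y)) := by gcongr
      _ = (Real.exp (n * y))⁻¹ := Real.exp_neg _
      _ ≤ (((n : ℝ) * y) ^ (B + 2) / (B + 2).factorial)⁻¹ := by gcongr
      _ = _ := by rw [inv_div]
  calc (n + 1 : ℝ) ^ B * Real.exp (-(2 * Real.pi * n * y))
      ≤ (2 * n) ^ B * ((B + 2).factorial / ((n : ℝ) * y) ^ (B + 2)) := by
        gcongr
        linarith
    _ = _ := by
        rw [mul_pow, mul_pow, pow_add (n : ℝ)]
        field_simp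

theorem norm_qser_term_le {a : ℕ → ℂ} {C : ℝ} {B : ℕ} (h : ∀ n, ‖a n‖ ≤ C * (n + 1 : ℝ) ^ B)
    (n : ℕ) {y : ℝ} {w : ℂ} (hw : y ≤ w.im) :
    ‖a n * Complex.exp (2 * Real.pi * Complex.I * n * w)‖ ≤
      C * (((n + 1 : ℝ) ^ B) * Real.exp (-(2 * Real.pi * n * y))) := by
  have := h n
  have h0 := (norm_nonneg _).trans this
  rw [norm_mul, norm_qexp_nat, ← mul_assoc]
  gcongr

theorem summable_pow_mul_exp_neg (B : ℕ) {y : ℝ} (hy : 0 < y) :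
    Summable fun n : ℕ => (n + 1 : ℝ) ^ B * Real.exp (-(2 * Real.pi * n * y)) := by
  have hs : Summable fun n : ℕ =>
      (2 ^ B * (B + 2).factorial) * ((n : ℝ) ^ 2)⁻¹ * (y ^ (B + 2))⁻¹ :=
    ((Real.summable_nat_pow_inv.mpr one_lt_two).mul_left _).mul_right _
  refine Summable.of_norm_bounded_eventually_nat hs ?_
  filter_upwards [Filter.eventually_ge_atTop 1] with n hn
  rw [Real.norm_of_nonneg (by positivity)]
  exact pow_mul_exp_neg_le B (by omega) hy

theorem PolyGrowth.summable_norm {a : ℕ → ℂ} (ha : PolyGrowth a) {w : ℂ} (hw : 0 < w.im) :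
    Summable fun n : ℕ => ‖a n * Complex.exp (2 * Real.pi * Complex.I * n * w)‖ := by
  obtain ⟨C, B, h⟩ := ha
  exact Summable.of_nonneg_of_le (fun _ => norm_nonneg _)
    (fun n => norm_qser_term_le h n le_rfl) ((summable_pow_mul_exp_neg B hw).mul_left C)

theorem PolyGrowth.hasSum {a : ℕ → ℂ} (ha : PolyGrowth a) {w : ℂ} (hw : 0 < w.im) :
    HasSum (fun n : ℕ => a n * Complex.exp (2 * Real.pi * Complex.I * n * w)) (qser a w) :=
  (ha.summable_norm hw).of_norm.hasSum

theorem PolyGrowth.of_norm_le {a b : ℕ → ℂ} (hb : PolyGrowth b) (h : ∀ n, ‖a n‖ ≤ ‖b n‖) :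
    PolyGrowth a := by
  obtain ⟨C, B, hC⟩ := hb
  exact ⟨C, B, fun n => (h n).trans (hC n)⟩

theorem PolyGrowth.mul {a b : ℕ → ℂ} (ha : PolyGrowth a) (hb : PolyGrowth b) :
    PolyGrowth fun n => a n * b n := by
  obtain ⟨C, B, hC⟩ := ha
  obtain ⟨C', B', hC'⟩ := hb
  refine ⟨C * C', B + B', fun n => ?_⟩
  have h1 := hC n
  have h2 := hC' n
  rw [norm_mul, pow_add]
  calc ‖a n‖ * ‖b n‖ ≤ (C * (n + 1 : ℝ) ^ B) * (C' * (n + 1 : ℝ) ^ B') :=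
        mul_le_mul h1 h2 (norm_nonneg _) ((norm_nonneg _).trans h1)
    _ = _ := by ring

theorem polyGrowth_const (c : ℂ) : PolyGrowth fun _ => c := ⟨‖c‖, 0, fun n => by simp⟩

theorem polyGrowth_natCast : PolyGrowth fun n => (n : ℂ) :=
  ⟨1, 1, fun n => by simp⟩

theorem PolyGrowth.hasDerivAt {a : ℕ → ℂ} (ha : PolyGrowth a) {w : ℂ} (hw : 0 < w.im) :
    HasDerivAt (qser a) (qser (fun n => 2 * Real.pi * Complex.I * n * a n) w) w := by
  have hb : PolyGrowth fun n => 2 * Real.pi * Complex.I * n * a n :=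
    ((polyGrowth_const _).mul polyGrowth_natCast).mul ha
  obtain ⟨C, B, h⟩ := hb
  -- Termwise differentiation needs a bound uniform near w; the half-plane above height Im w / 2 is
  -- connected and provides one.
  have hopen : IsOpen {v : ℂ | w.im / 2 < v.im} := isOpen_lt continuous_const Complex.continuous_im
  have hconv : Convex ℝ {v : ℂ | w.im / 2 < v.im} := convex_halfSpace_im_gt _
  have hmem : w ∈ {v : ℂ | w.im / 2 < v.im} := by
    simpa using half_lt_self hw
  refine hasDerivAt_tsum_of_isPreconnected
    (g' := fun n v => 2 * Real.pi * Complex.I * n * a n *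
      Complex.exp (2 * Real.pi * Complex.I * n * v))
    ((summable_pow_mul_exp_neg B (half_pos hw)).mul_left C) hopen
    hconv.isPreconnected (fun n v _ => ?_)
    (fun n v hv => norm_qser_term_le h n (le_of_lt hv)) hmem
    (ha.summable_norm hw).of_norm hmem
  have : HasDerivAt (fun v : ℂ => 2 * Real.pi * Complex.I * n * v) (2 * Real.pi * Complex.I * n) v := by
    simpa using (hasDerivAt_id v).const_mul (2 * Real.pi * Complex.I * n : ℂ)
  refine (this.cexp.const_mul (a n)).congr_deriv ?_
  ring

theorem PolyGrowth.differentiableOn {a : ℕ → ℂ} (ha : PolyGrowth a) :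
    DifferentiableOn ℂ (qser a) {w : ℂ | 0 < w.im} :=
  fun _ hw => (ha.hasDerivAt hw).differentiableAt.differentiableWithinAt

theorem PolyGrowth.norm_qser_le {a : ℕ → ℂ} (ha : PolyGrowth a) :
    ∃ (C : ℝ) (A : ℕ), ∀ w : ℂ, 0 < w.im → ‖qser a w‖ ≤ C * (1 + (w.im ^ A)⁻¹) := by
  obtain ⟨C, B, h⟩ := ha
  have hC : 0 ≤ C := by simpa using (norm_nonneg _).trans (h 0)
  set D : ℝ := ∑' n : ℕ, (2 ^ B * (B + 2).factorial) * ((n : ℝ) ^ 2)⁻¹ with hD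
  have hs : Summable fun n : ℕ => (2 ^ B * ((B + 2).factorial : ℝ)) * ((n : ℝ) ^ 2)⁻¹ :=
    (Real.summable_nat_pow_inv.mpr one_lt_two).mul_left _
  have hD0 : 0 ≤ D := tsum_nonneg fun n => by positivity
  refine ⟨C * (1 + D), B + 2, fun w hw => ?_⟩
  have hsn : Summable fun n : ℕ => ‖a n * Complex.exp (2 * Real.pi * Complex.I * n * w)‖ :=
    PolyGrowth.summable_norm ⟨C, B, h⟩ hw
  -- The constant term does not decay and is kept apart; it accounts for the 1 in the final bound.
  have hb : ∀ n : ℕ, ‖a n * Complex.exp (2 * Real.pi * Complex.I * n * w)‖ ≤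
      (if n = 0 then C else 0) +
        C * ((2 ^ B * (B + 2).factorial) * ((n : ℝ) ^ 2)⁻¹ * (w.im ^ (B + 2))⁻¹) := by
    intro n
    refine (norm_qser_term_le h n le_rfl).trans ?_
    rcases eq_or_ne n 0 with rfl | hn
    · simp
    · rw [if_neg hn, zero_add]
      exact mul_le_mul_of_nonneg_left (pow_mul_exp_neg_le B hn hw) hC
  have hs1 : HasSum (fun n : ℕ => (if n = 0 then C else 0) +
        C * ((2 ^ B * (B + 2).factorial) * ((n : ℝ) ^ 2)⁻¹ * (w.im ^ (B + 2))⁻¹))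
      (C + C * (D * (w.im ^ (B + 2))⁻¹)) :=
    (hasSum_ite_eq 0 C).add (((hs.hasSum.mul_right _)).mul_left C)
  have h1 : ‖qser a w‖ ≤ C + C * (D * (w.im ^ (B + 2))⁻¹) :=
    (norm_tsum_le_tsum_norm hsn).trans (hasSum_le hb hsn.hasSum hs1)
  have h2 : 0 ≤ (w.im ^ (B + 2))⁻¹ := by positivity
  refine h1.trans ?_
  have : 0 ≤ C * D := by positivity
  have : 0 ≤ C * (w.im ^ (B + 2))⁻¹ := by positivity
  nlinarith

/-! ### The Wirtinger derivative -/

theorem dzbar_congr {f g : ℂ → ℂ} {w : ℂ} (h : f =ᶠ[nhds w] g) : dzbar f w = dzbar g w := by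
  simp only [dzbar, dx, dy, h.fderiv_eq]

theorem dzbar_add {f g : ℂ → ℂ} {w : ℂ} (hf : DifferentiableAt ℝ f w)
    (hg : DifferentiableAt ℝ g w) :
    dzbar (fun v => f v + g v) w = dzbar f w + dzbar g w := by
  simp only [dzbar, dx, dy, fderiv_fun_add hf hg, add_apply]
  ring

theorem dzbar_mul {f g : ℂ → ℂ} {w : ℂ} (hf : DifferentiableAt ℝ f w)
    (hg : DifferentiableAt ℝ g w) :
    dzbar (fun v => f v * g v) w = dzbar f w * g w + f w * dzbar g w := by
  simp only [dzbar, dx, dy, fderiv_fun_mul hf hg, add_apply, smul_apply, smul_eq_mul]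
  ring

theorem dzbar_of_hasDerivAt {f : ℂ → ℂ} {f' w : ℂ} (hf : HasDerivAt f f' w) : dzbar f w = 0 := by
  have h : HasFDerivAt f (_ : ℂ →L[ℝ] ℂ) w := hf.hasFDerivAt.restrictScalars ℝ
  simp only [dzbar, dx, dy, h.fderiv]
  simp only [ContinuousLinearMap.coe_restrictScalars', ContinuousLinearMap.toSpanSingleton_apply,
    smul_eq_mul]
  linear_combination f' / 2 * Complex.I_mul_I

theorem dzbar_const (c w : ℂ) : dzbar (fun _ => c) w = 0 :=
  dzbar_of_hasDerivAt (hasDerivAt_const w c)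

theorem hasFDerivAt_conj_comp {f : ℂ → ℂ} {f' w : ℂ} (hf : HasDerivAt f f' w) :
    HasFDerivAt (fun v => (starRingEnd ℂ) (f v))
      ((Complex.conjCLE : ℂ →L[ℝ] ℂ).comp
        ((ContinuousLinearMap.toSpanSingleton ℂ f').restrictScalars ℝ)) w :=
  (Complex.conjCLE : ℂ →L[ℝ] ℂ).hasFDerivAt.comp w (hf.hasFDerivAt.restrictScalars ℝ)

/-- Conjugation exchanges ∂/∂z and ∂/∂z̄, so only the holomorphic derivative of f survives. -/
theorem dzbar_conj {f : ℂ → ℂ} {f' w : ℂ} (hf : HasDerivAt f f' w) :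
    dzbar (fun v => (starRingEnd ℂ) (f v)) w = (starRingEnd ℂ) f' := by
  simp only [dzbar, dx, dy, (hasFDerivAt_conj_comp hf).fderiv]
  simp
  linear_combination -(starRingEnd ℂ) f' / 2 * Complex.I_mul_I

theorem hasFDerivAt_im_pow (j : ℕ) (w : ℂ) :
    HasFDerivAt (fun v : ℂ => ((v.im : ℂ)) ^ j)
      ((j * (w.im : ℂ) ^ (j - 1)) • (Complex.ofRealCLM.comp Complex.imCLM)) w := by
  have h : HasFDerivAt (fun v : ℂ => (v.im : ℂ)) (Complex.ofRealCLM.comp Complex.imCLM) w :=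
    (Complex.ofRealCLM.comp Complex.imCLM).hasFDerivAt
  refine (h.pow j).congr_fderiv ?_
  ext
  simp

theorem dzbar_im_pow (j : ℕ) (w : ℂ) :
    dzbar (fun v => ((v.im : ℂ)) ^ j) w = Complex.I / 2 * (j * (w.im : ℂ) ^ (j - 1)) := by
  simp only [dzbar, dx, dy, (hasFDerivAt_im_pow j w).fderiv]
  simp
  ring

/-! ### Real analyticity of powers of y, q-series and conjugate q-series -/

theorem analyticOnNhd_im_pow (j : ℕ) (s : Set ℂ) :
    AnalyticOnNhd ℝ (fun v : ℂ => ((v.im : ℂ)) ^ j) s :=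
  ((Complex.ofRealCLM.comp Complex.imCLM).analyticOnNhd s).pow j

theorem isOpen_im_pos : IsOpen {w : ℂ | 0 < w.im} := isOpen_lt continuous_const Complex.continuous_im

theorem PolyGrowth.analyticOnNhd {a : ℕ → ℂ} (ha : PolyGrowth a) :
    AnalyticOnNhd ℝ (qser a) {w : ℂ | 0 < w.im} :=
  (ha.differentiableOn.analyticOnNhd isOpen_im_pos).restrictScalars

theorem PolyGrowth.analyticOnNhd_conj {a : ℕ → ℂ} (ha : PolyGrowth a) :
    AnalyticOnNhd ℝ (fun w => (starRingEnd ℂ) (qser a w)) {w : ℂ | 0 < w.im} :=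
  fun w hw => ((Complex.conjCLE : ℂ →L[ℝ] ℂ).analyticAt _).comp (ha.analyticOnNhd w hw)

/-! ### Functions of moderate growth on the upper half-plane -/

/-- `f` is bounded by a power of `y + y⁻¹` on the upper half-plane. -/
def ModGrowth (f : ℂ → ℂ) : Prop :=
  ∃ (C : ℝ) (A : ℕ), ∀ w : ℂ, 0 < w.im → ‖f w‖ ≤ C * (w.im + w.im⁻¹) ^ A

theorem one_le_add_inv {y : ℝ} (hy : 0 < y) : 1 ≤ y + y⁻¹ := by
  rcases le_total 1 y with h | h
  · have := inv_pos.mpr hy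
    linarith
  · have := (one_le_inv₀ hy).mpr h
    linarith

theorem ModGrowth.add {f g : ℂ → ℂ} (hf : ModGrowth f) (hg : ModGrowth g) :
    ModGrowth fun w => f w + g w := by
  obtain ⟨C, A, h⟩ := hf
  obtain ⟨C', A', h'⟩ := hg
  refine ⟨|C| + |C'|, A + A', fun w hw => (norm_add_le _ _).trans ?_⟩
  have h1 := one_le_add_inv hw
  have h2 := h w hw
  have h3 := h' w hw
  have h4 : C * (w.im + w.im⁻¹) ^ A ≤ |C| * (w.im + w.im⁻¹) ^ (A + A') := by
    gcongr
    · exact le_abs_self C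
    · omega
  have h5 : C' * (w.im + w.im⁻¹) ^ A' ≤ |C'| * (w.im + w.im⁻¹) ^ (A + A') := by
    gcongr
    · exact le_abs_self C'
    · omega
  linarith

theorem ModGrowth.mul {f g : ℂ → ℂ} (hf : ModGrowth f) (hg : ModGrowth g) :
    ModGrowth fun w => f w * g w := by
  obtain ⟨C, A, h⟩ := hf
  obtain ⟨C', A', h'⟩ := hg
  refine ⟨C * C', A + A', fun w hw => ?_⟩
  rw [norm_mul, pow_add]
  have h1 := h w hw
  have h2 := h' w hw
  calc ‖f w‖ * ‖g w‖ ≤ (C * (w.im + w.im⁻¹) ^ A) * (C' * (w.im + w.im⁻¹) ^ A') :=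
        mul_le_mul h1 h2 (norm_nonneg _) ((norm_nonneg _).trans h1)
    _ = _ := by ring

theorem ModGrowth.conj {f : ℂ → ℂ} (hf : ModGrowth f) :
    ModGrowth fun w => (starRingEnd ℂ) (f w) := by
  obtain ⟨C, A, h⟩ := hf
  exact ⟨C, A, fun w hw => by simpa using h w hw⟩

theorem modGrowth_const (c : ℂ) : ModGrowth fun _ => c := ⟨‖c‖, 0, fun w _ => by simp⟩

theorem modGrowth_im_pow (j : ℕ) : ModGrowth fun w => (w.im : ℂ) ^ j := by
  refine ⟨1, j, fun w hw => ?_⟩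
  rw [norm_pow, Complex.norm_real, Real.norm_of_nonneg hw.le, one_mul]
  have := inv_pos.mpr hw
  gcongr
  linarith

theorem PolyGrowth.modGrowth {a : ℕ → ℂ} (ha : PolyGrowth a) : ModGrowth (qser a) := by
  obtain ⟨C, A, h⟩ := ha.norm_qser_le
  refine ⟨|C| * 2, A, fun w hw => (h w hw).trans ?_⟩
  have h1 : 1 ≤ (w.im + w.im⁻¹) ^ A := one_le_pow₀ (one_le_add_inv hw)
  have h2 : (w.im ^ A)⁻¹ ≤ (w.im + w.im⁻¹) ^ A := by
    rw [← inv_pow]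
    gcongr
    linarith
  calc C * (1 + (w.im ^ A)⁻¹) ≤ |C| * ((w.im + w.im⁻¹) ^ A + (w.im + w.im⁻¹) ^ A) := by
        gcongr
        exact le_abs_self C
    _ = _ := by ring

/-! ### The non-holomorphic part -/

/-- The integral `∫_y^∞ e^{-a u} u^j du`, in closed form. -/
def bexp (a : ℝ) : ℕ → ℝ → ℝ
  | 0, y => Real.exp (-(a * y)) / a
  | j + 1, y => (Real.exp (-(a * y)) * y ^ (j + 1) + (j + 1) * bexp a j y) / a

/-- The recursion defining `bexp` is integration by parts, so the boundary term cancels in the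
derivative and only the integrand remains. -/
theorem hasDerivAt_bexp {a : ℝ} (ha : a ≠ 0) (j : ℕ) (y : ℝ) :
    HasDerivAt (bexp a j) (-(Real.exp (-(a * y)) * y ^ j)) y := by
  have he : HasDerivAt (fun y : ℝ => Real.exp (-(a * y))) (-(a * Real.exp (-(a * y)))) y := by
    have : HasDerivAt (fun y : ℝ => -(a * y)) (-a) y := by
      simpa using ((hasDerivAt_id y).const_mul a).fun_neg
    refine this.exp.congr_deriv ?_
    ring
  induction j with
  | zero =>
    refine (he.div_const a).congr_deriv ?_
    field_simp
  | succ j ih =>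
    refine (((he.mul (hasDerivAt_pow (j + 1) y)).add (ih.const_mul ((j : ℝ) + 1))).div_const
      a).congr_deriv ?_
    simp only [Nat.add_sub_cancel]
    push_cast
    field_simp
    ring

theorem tendsto_bexp {a : ℝ} (ha : 0 < a) (j : ℕ) :
    Filter.Tendsto (bexp a j) Filter.atTop (nhds 0) := by
  have key : ∀ i : ℕ, Filter.Tendsto (fun y : ℝ => Real.exp (-(a * y)) * y ^ i) Filter.atTop
      (nhds 0) := fun i => by
    have := (Real.tendsto_pow_mul_exp_neg_atTop_nhds_zero i).comp
      (Filter.tendsto_id.const_mul_atTop ha)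
    have h2 := this.const_mul (a ^ i)⁻¹
    rw [mul_zero] at h2
    refine h2.congr fun y => ?_
    simp only [Function.comp, id]
    rw [mul_pow]
    field_simp
  induction j with
  | zero =>
    have := (key 0).div_const a
    simpa [bexp] using this
  | succ j ih =>
    have := (((key (j + 1)).add (ih.const_mul ((j : ℝ) + 1)))).div_const a
    simpa [bexp] using this

theorem integral_exp_mul_pow {a : ℝ} (ha : 0 < a) (j : ℕ) {y : ℝ} (hy : 0 < y) :
    ∫ u in Set.Ioi y, Real.exp (-(a * u)) * u ^ j = bexp a j y := by
  have h := MeasureTheory.integral_Ioi_of_hasDerivAt_of_nonpos' (a := y) (l := 0)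
    (g := bexp a j) (g' := fun u => -(Real.exp (-(a * u)) * u ^ j))
    (fun u _ => hasDerivAt_bexp ha.ne' j u)
    (fun u hu => by
      have : 0 < u := hy.trans hu
      simp only [Left.neg_nonpos_iff]
      positivity)
    (tendsto_bexp ha j)
  rw [MeasureTheory.integral_neg, zero_sub, neg_inj] at h
  exact h

theorem beta_eq_bexp (j : ℕ) {n : ℕ} (hn : n ≠ 0) {y : ℝ} (hy : 0 < y) :
    beta ((j + 2 : ℕ) : ℤ) n y = bexp (4 * Real.pi * n) j y := by
  have : 0 < (n : ℝ) := by positivity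
  rw [beta, if_neg hn, ← integral_exp_mul_pow (by positivity) j hy]
  congr 1
  ext u
  rw [show ((j + 2 : ℕ) : ℤ) - 2 = (j : ℤ) by push_cast; ring, zpow_natCast]
  congr 2
  ring

/-- Division by zero is zero, so the index n = 0 drops out of every series with these coefficients.
The y^{k-1} term has to be added by hand. -/
theorem bexp_zero_left (j : ℕ) (y : ℝ) : bexp 0 j y = 0 := by
  cases j <;> simp [bexp]

/-- Coefficientwise division by `4 π n`; the constant term is dropped. -/
def antider (c : ℕ → ℂ) (n : ℕ) : ℂ := c n / (4 * Real.pi * n)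

theorem PolyGrowth.antider {c : ℕ → ℂ} (hc : PolyGrowth c) : PolyGrowth (antider c) := by
  refine hc.of_norm_le fun n => ?_
  rw [MockEis.antider, norm_div]
  rcases eq_or_ne n 0 with rfl | hn
  · simp
  · have h1 : (1 : ℝ) ≤ n := by exact_mod_cast Nat.one_le_iff_ne_zero.mpr hn
    have h2 : ‖(4 * Real.pi * n : ℂ)‖ = 4 * Real.pi * n := by
      simp [abs_of_pos Real.pi_pos]
    rw [h2]
    refine div_le_self (norm_nonneg _) ?_
    have := Real.pi_gt_three
    nlinarith

/-- The sum `∑_{n ≥ 1} conj (c n) (∫_y^∞ e^{-4 π n u} u^j du) q^{-n}`, as a combination of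
complex conjugates of holomorphic functions. -/
def nonhol : ℕ → (ℕ → ℂ) → ℂ → ℂ
  | 0, c, w => (starRingEnd ℂ) (qser (antider c) w)
  | j + 1, c, w => (w.im : ℂ) ^ (j + 1) * (starRingEnd ℂ) (qser (antider c) w) +
      (j + 1 : ℂ) * nonhol j (antider c) w

theorem conj_qexp (n : ℕ) (w : ℂ) :
    (starRingEnd ℂ) (Complex.exp (2 * Real.pi * Complex.I * n * w)) =
      Real.exp (-(4 * Real.pi * n * w.im)) *
        Complex.exp (2 * Real.pi * Complex.I * (-n : ℤ) * w) := by
  rw [← Complex.exp_conj, Complex.ofReal_exp, ← Complex.exp_add]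
  congr 1
  apply Complex.ext <;> simp [Complex.mul_re, Complex.mul_im]
  ring

theorem hasSum_conj_qser {a : ℕ → ℂ} (ha : PolyGrowth a) {w : ℂ} (hw : 0 < w.im) :
    HasSum (fun n : ℕ => star (a n) * Real.exp (-(4 * Real.pi * n * w.im)) *
      Complex.exp (2 * Real.pi * Complex.I * (-n : ℤ) * w)) ((starRingEnd ℂ) (qser a w)) := by
  have h := ((Complex.conjCLE : ℂ →L[ℝ] ℂ).hasSum (ha.hasSum hw))
  refine hasSum_of_eq h (fun n => ?_) rfl
  change _ = (starRingEnd ℂ) _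
  rw [map_mul, conj_qexp, ← mul_assoc]
  rfl

/-- The recursions of `nonhol` and `bexp` run in parallel: each division by 4πn in `bexp` is one
application of `antider` to the coefficients. -/
theorem hasSum_nonhol (j : ℕ) {c : ℕ → ℂ} (hc : PolyGrowth c) {w : ℂ} (hw : 0 < w.im) :
    HasSum (fun n : ℕ => star (c n) * bexp (4 * Real.pi * n) j w.im *
      Complex.exp (2 * Real.pi * Complex.I * (-n : ℤ) * w)) (nonhol j c w) := by
  induction j generalizing c with
  | zero =>
    refine hasSum_of_eq (hasSum_conj_qser hc.antider hw) (fun n => ?_) rfl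
    simp [antider, bexp]
    ring_nf
  | succ j ih =>
    refine hasSum_of_eq (((hasSum_conj_qser hc.antider hw).mul_left ((w.im : ℂ) ^ (j + 1))).add
      ((ih hc.antider).mul_left (j + 1 : ℂ))) (fun n => ?_) rfl
    simp [antider, bexp]
    ring_nf

theorem analyticOnNhd_nonhol (j : ℕ) {c : ℕ → ℂ} (hc : PolyGrowth c) :
    AnalyticOnNhd ℝ (nonhol j c) {w : ℂ | 0 < w.im} := by
  induction j generalizing c with
  | zero => exact hc.antider.analyticOnNhd_conj
  | succ j ih =>
    exact ((analyticOnNhd_im_pow (j + 1) _).mul hc.antider.analyticOnNhd_conj).add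
      (analyticOnNhd_const.mul (ih hc.antider))

theorem modGrowth_nonhol (j : ℕ) {c : ℕ → ℂ} (hc : PolyGrowth c) : ModGrowth (nonhol j c) := by
  induction j generalizing c with
  | zero => exact hc.antider.modGrowth.conj
  | succ j ih =>
    exact ((modGrowth_im_pow (j + 1)).mul hc.antider.modGrowth.conj).add
      ((modGrowth_const _).mul (ih hc.antider))

/-- Multiplication by 2πin undoes the division by 4πn up to the factor i/2, except at n = 0, where
the coefficient is lost. -/
theorem qser_deriv_antider {c : ℕ → ℂ} (hc : PolyGrowth c) {w : ℂ} (hw : 0 < w.im) :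
    qser (fun n => 2 * Real.pi * Complex.I * n * antider c n) w =
      Complex.I / 2 * (qser c w - c 0) := by
  have h1 : HasSum (fun n : ℕ => (if n = 0 then c 0 else 0 : ℂ)) (c 0) := hasSum_ite_eq 0 (c 0)
  have h2 := (((hc.hasSum hw).sub h1).mul_left (Complex.I / 2)).tsum_eq
  rw [← h2, qser]
  refine tsum_congr fun n => ?_
  rcases eq_or_ne n 0 with rfl | hn
  · simp
  · have : (n : ℂ) ≠ 0 := by exact_mod_cast hn
    have := Complex.ofReal_ne_zero.mpr Real.pi_ne_zero
    rw [if_neg hn, antider]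
    field_simp
    ring

/-- A telescoping product rule: differentiating the power y^{j+1} in the leading term cancels the
derivative of the recursive term, and what remains is y^{j+1} times the derivative of the conjugate
q-series. -/
theorem dzbar_nonhol (j : ℕ) {c : ℕ → ℂ} (hc : PolyGrowth c) {w : ℂ} (hw : 0 < w.im) :
    dzbar (nonhol j c) w =
      -(Complex.I / 2) * (w.im : ℂ) ^ j * (starRingEnd ℂ) (qser c w - c 0) := by
  have hd : ∀ c : ℕ → ℂ, PolyGrowth c → dzbar (fun v => (starRingEnd ℂ) (qser (antider c) v)) w =
      -(Complex.I / 2) * (starRingEnd ℂ) (qser c w - c 0) := fun c hc => by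
    rw [dzbar_conj (hc.antider.hasDerivAt hw), qser_deriv_antider hc hw]
    simp [Complex.conj_ofNat]
    ring_nf
  induction j generalizing c with
  | zero => simpa using! hd c hc
  | succ j ih =>
    -- The telescoping is exact because the next coefficient sequence has no constant term to
    -- subtract.
    have e0 : antider c 0 = 0 := by simp [antider]
    have hdc := (hc.antider.analyticOnNhd_conj w hw).differentiableAt
    have hdp := (analyticOnNhd_im_pow (j + 1) {w : ℂ | 0 < w.im} w hw).differentiableAt
    have hdn := (analyticOnNhd_nonhol j hc.antider w hw).differentiableAt
    have : dzbar (nonhol (j + 1) c) w = _ :=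
      dzbar_add (hdp.mul hdc) ((differentiableAt_const (j + 1 : ℂ)).mul hdn)
    rw [this, dzbar_mul hdp hdc, dzbar_mul (differentiableAt_const _) hdn, dzbar_im_pow, hd c hc,
      ih hc.antider, dzbar_const, e0]
    simp only [Nat.add_sub_cancel]
    push_cast
    ring_nf

/-! ### Solutions of `∂F/∂z̄ = (i / 2) y^j conj E` with `E` holomorphic -/

theorem toC_coe (F : ℍ → ℂ) (z : ℍ) : toC F z = F z := by
  rw [toC, ofComplex_apply]

theorem toC_eventuallyEq {F : ℍ → ℂ} {f : ℂ → ℂ} (h : ∀ z : ℍ, F z = f z) {w : ℂ}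
    (hw : 0 < w.im) : toC F =ᶠ[nhds w] f := by
  filter_upwards [isOpen_im_pos.mem_nhds hw] with v hv
  simpa [toC, ofComplex_apply_of_im_pos hv] using h ⟨v, hv⟩

theorem xi_eq_of_dzbar (j : ℕ) {F : ℍ → ℂ} {E : ℂ → ℂ}
    (h : ∀ w : ℂ, 0 < w.im → dzbar (toC F) w =
      Complex.I / 2 * (w.im : ℂ) ^ j * (starRingEnd ℂ) (E w)) (z : ℍ) :
    xi (2 - ((j + 2 : ℕ) : ℤ)) F z = E z := by
  have hy : (z.im : ℂ) ≠ 0 := Complex.ofReal_ne_zero.mpr z.im_pos.ne'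
  rw [xi, h z z.im_pos, show 2 - ((j + 2 : ℕ) : ℤ) = -(j : ℤ) by push_cast; ring, zpow_neg,
    zpow_natCast]
  simp only [star_mul', star_div₀, star_pow, RCLike.star_def, Complex.conj_I, Complex.conj_conj,
    Complex.conj_ofReal, coe_im, Complex.conj_ofNat]
  field_simp
  linear_combination -(E z) * Complex.I_sq

/-- The operator ∂/∂x - i ∂/∂y is 2 ∂/∂z. It annihilates conjugates of holomorphic functions, so it
sees only y^j. -/
theorem hasFDerivAt_im_pow_mul_conj (j : ℕ) {E : ℂ → ℂ} {E' w : ℂ} (hE : HasDerivAt E E' w) :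
    ∃ D : ℂ →L[ℝ] ℂ, HasFDerivAt
      (fun v : ℂ => Complex.I * ((v.im : ℂ) ^ j * (starRingEnd ℂ) (E v))) D w ∧
      D 1 - Complex.I * D Complex.I = j * (w.im : ℂ) ^ (j - 1) * (starRingEnd ℂ) (E w) := by
  refine ⟨_, ((hasFDerivAt_im_pow j w).mul (hasFDerivAt_conj_comp hE)).const_mul Complex.I, ?_⟩
  simp
  linear_combination (Complex.I * (w.im : ℂ) ^ j * (starRingEnd ℂ) E' -
    j * (w.im : ℂ) ^ (j - 1) * (starRingEnd ℂ) (E w)) * Complex.I_mul_I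

/-- The factorization (∂_x - i∂_y)(∂_x + i∂_y), whose mixed terms cancel by symmetry of the second
derivative. It makes the Laplacian depend on f only through ∂f/∂z̄. -/
theorem laplacian_eq_of_contDiffAt {f : ℂ → ℂ} {w : ℂ} (hf : ContDiffAt ℝ 2 f w) :
    dx (dx f) w + dy (dy f) w =
      dx (fun v => dx f v + Complex.I * dy f v) w -
        Complex.I * dy (fun v => dx f v + Complex.I * dy f v) w := by
  have hd : DifferentiableAt ℝ (fderiv ℝ f) w :=
    (hf.fderiv_right (m := 1) (by norm_num)).differentiableAt (by norm_num)
  have hs : IsSymmSndFDerivAt ℝ f w := hf.isSymmSndFDerivAt (by simp)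
  have happ : ∀ u : ℂ, HasFDerivAt (fun v => fderiv ℝ f v u)
      ((fderiv ℝ (fderiv ℝ f) w).flip u) w := fun u => by
    refine (hd.hasFDerivAt.clm_apply (hasFDerivAt_const u w)).congr_fderiv ?_
    ext
    simp
  have hsum := (happ 1).add ((happ Complex.I).const_mul Complex.I)
  have h1 : fderiv ℝ (fun v => dx f v + Complex.I * dy f v) w = _ := hsum.fderiv
  have h2 : fderiv ℝ (dx f) w = _ := (happ 1).fderiv
  have h3 : fderiv ℝ (dy f) w = _ := (happ Complex.I).fderiv
  have hsym := hs.eq 1 Complex.I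
  rw [dx, dy, dx, dy, h1, h2, h3]
  simp only [ContinuousLinearMap.flip_apply, add_apply, smul_apply, smul_eq_mul]
  linear_combination -Complex.I * hsym +
    (fderiv ℝ (fderiv ℝ f) w Complex.I Complex.I) * Complex.I_mul_I

/-- With f_x + i f_y = i y^j Ē, the second-order part contributes j y^{j+1} Ē and the first-order
part of weight -j contributes its negative. -/
theorem hypLaplacian_eq_zero_of_dzbar (j : ℕ) {F : ℍ → ℂ} {E : ℂ → ℂ}
    (hF : AnalyticOnNhd ℝ (toC F) {w : ℂ | 0 < w.im})
    (hE : DifferentiableOn ℂ E {w : ℂ | 0 < w.im})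
    (h : ∀ w : ℂ, 0 < w.im → dzbar (toC F) w =
      Complex.I / 2 * (w.im : ℂ) ^ j * (starRingEnd ℂ) (E w)) (z : ℍ) :
    hypLaplacian (2 - ((j + 2 : ℕ) : ℤ)) F z = 0 := by
  have hU : ∀ w : ℂ, 0 < w.im → dx (toC F) w + Complex.I * dy (toC F) w =
      Complex.I * ((w.im : ℂ) ^ j * (starRingEnd ℂ) (E w)) := fun w hw => by
    have := h w hw
    rw [dzbar] at this
    linear_combination 2 * this
  have hev : (fun v => dx (toC F) v + Complex.I * dy (toC F) v) =ᶠ[nhds (z : ℂ)]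
      fun v => Complex.I * ((v.im : ℂ) ^ j * (starRingEnd ℂ) (E v)) := by
    filter_upwards [isOpen_im_pos.mem_nhds z.im_pos] with v hv using hU v hv
  obtain ⟨D, hD, hD'⟩ := hasFDerivAt_im_pow_mul_conj j
    ((hE.differentiableAt (isOpen_im_pos.mem_nhds z.im_pos)).hasDerivAt)
  have hsm : ContDiffAt ℝ 2 (toC F) z := (hF z z.im_pos).contDiffAt
  rw [hypLaplacian, laplacian_eq_of_contDiffAt hsm, hU z z.im_pos]
  rw [dx, dy, hev.fderiv_eq, hD.fderiv, hD', coe_im]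
  -- The exponent j - 1 is truncated at j = 0, where the term carries the factor j anyway.
  rcases j with _ | j
  · simp
  · push_cast
    linear_combination ((j + 1) * (z.im : ℂ) ^ (j + 2) * (starRingEnd ℂ) (E z)) * Complex.I_mul_I

theorem dzbar_comp {f g : ℂ → ℂ} {g' w : ℂ} (hf : DifferentiableAt ℝ f (g w))
    (hg : HasDerivAt g g' w) :
    dzbar (fun v => f (g v)) w = (starRingEnd ℂ) g' * dzbar f (g w) := by
  have h := hf.hasFDerivAt.comp w (hg.hasFDerivAt.restrictScalars ℝ)
  have h' : fderiv ℝ (fun v => f (g v)) w = _ := h.fderiv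
  have hlin : ∀ u : ℂ, fderiv ℝ f (g w) u =
      u.re * fderiv ℝ f (g w) 1 + u.im * fderiv ℝ f (g w) Complex.I := fun u => by
    conv_lhs => rw [show u = u.re • (1 : ℂ) + u.im • Complex.I by simp [Complex.re_add_im]]
    rw [map_add, map_smul, map_smul]
    simp
  simp only [dzbar, dx, dy, h', ContinuousLinearMap.comp_apply,
    ContinuousLinearMap.coe_restrictScalars', ContinuousLinearMap.toSpanSingleton_apply,
    smul_eq_mul, one_mul]
  rw [hlin g', hlin (Complex.I * g'), show (starRingEnd ℂ) g' = g'.re - g'.im * Complex.I from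
    Complex.ext (by simp) (by simp)]
  simp only [Complex.mul_re, Complex.I_re, Complex.I_im, Complex.mul_im]
  push_cast
  linear_combination ((g'.im : ℂ) / 2 * fderiv ℝ f (g w) Complex.I) * Complex.I_mul_I

/-- Apply ∂/∂z̄ to the transformation law of F. The automorphy factor is holomorphic and passes
through, while the inner derivative of γ contributes the conjugate of (cz + d)^{-2}. After y^j is
transformed and conjugates are taken, this is the law of weight j + 2 with the conjugate character.
-/
theorem isModular_of_dzbar (j N : ℕ) (χ : DirichletCharacter ℂ N) {F : ℍ → ℂ} {E : ℂ → ℂ}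
    (hF : AnalyticOnNhd ℝ (toC F) {w : ℂ | 0 < w.im})
    (hmod : IsModular (2 - ((j + 2 : ℕ) : ℤ)) N χ F)
    (h : ∀ w : ℂ, 0 < w.im → dzbar (toC F) w =
      Complex.I / 2 * (w.im : ℂ) ^ j * (starRingEnd ℂ) (E w)) :
    IsModular (j + 2 : ℕ) N (star χ) (fun z => E z) := by
  intro γ hγ z
  have hκ : 2 - ((j + 2 : ℕ) : ℤ) = -(j : ℤ) := by push_cast; ring
  have hdet : (γ 0 0 : ℂ) * γ 1 1 - γ 0 1 * γ 1 0 = 1 := by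
    have := γ.det_coe
    rw [Matrix.det_fin_two] at this
    exact_mod_cast this
  have hden : ∀ v : ℍ, (γ 1 0 : ℂ) * v + γ 1 1 ≠ 0 := fun v => by
    simpa [denom] using denom_ne_zero γ v
  have hcoe : ∀ v : ℍ, ((γ • v : ℍ) : ℂ) =
      ((γ 0 0 : ℂ) * v + γ 0 1) / ((γ 1 0 : ℂ) * v + γ 1 1) := fun v => by
    rw [UpperHalfPlane.specialLinearGroup_apply]
    simp
  set c : ℂ := (γ 1 0 : ℂ) * z + γ 1 1 with hc
  have hc0 : c ≠ 0 := hden z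
  have hg : HasDerivAt (fun v : ℂ => ((γ 0 0 : ℂ) * v + γ 0 1) / ((γ 1 0 : ℂ) * v + γ 1 1))
      ((c ^ 2)⁻¹) z := by
    have h1 : HasDerivAt (fun v : ℂ => (γ 0 0 : ℂ) * v + γ 0 1) (γ 0 0) z := by
      simpa using ((hasDerivAt_id (z : ℂ)).const_mul (γ 0 0 : ℂ)).add_const (γ 0 1 : ℂ)
    have h2 : HasDerivAt (fun v : ℂ => (γ 1 0 : ℂ) * v + γ 1 1) (γ 1 0) z := by
      simpa using ((hasDerivAt_id (z : ℂ)).const_mul (γ 1 0 : ℂ)).add_const (γ 1 1 : ℂ)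
    refine (h1.div h2 hc0).congr_deriv ?_
    rw [div_eq_iff (pow_ne_zero 2 hc0), inv_mul_cancel₀ (pow_ne_zero 2 hc0)]
    linear_combination hdet
  have hgz : ((γ 0 0 : ℂ) * z + γ 0 1) / ((γ 1 0 : ℂ) * z + γ 1 1) = ((γ • z : ℍ) : ℂ) :=
    (hcoe z).symm
  have hl : dzbar (fun v => toC F (((γ 0 0 : ℂ) * v + γ 0 1) / ((γ 1 0 : ℂ) * v + γ 1 1))) z =
      (starRingEnd ℂ) ((c ^ 2)⁻¹) * dzbar (toC F) ((γ • z : ℍ) : ℂ) := by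
    rw [dzbar_comp (by rw [hgz]; exact (hF _ (γ • z).im_pos).differentiableAt) hg, hgz]
  have hev : (fun v => toC F (((γ 0 0 : ℂ) * v + γ 0 1) / ((γ 1 0 : ℂ) * v + γ 1 1)))
      =ᶠ[nhds (z : ℂ)]
      fun v => (χ ((γ 1 1 : ℤ) : ZMod N) * (((γ 1 0 : ℂ) * v + γ 1 1) ^ j)⁻¹) * toC F v := by
    filter_upwards [isOpen_im_pos.mem_nhds z.im_pos] with v hv
    have h1 := hmod γ hγ ⟨v, hv⟩
    have h2 := hcoe ⟨v, hv⟩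
    change _ = ((γ 0 0 : ℂ) * v + γ 0 1) / ((γ 1 0 : ℂ) * v + γ 1 1) at h2
    rw [← h2, toC_coe, h1, hκ, zpow_neg, zpow_natCast]
    congr 1
    exact (toC_coe F ⟨v, hv⟩).symm
  have hr : dzbar (fun v => (χ ((γ 1 1 : ℤ) : ZMod N) * (((γ 1 0 : ℂ) * v + γ 1 1) ^ j)⁻¹) *
      toC F v) z = χ ((γ 1 1 : ℤ) : ZMod N) * (c ^ j)⁻¹ * dzbar (toC F) z := by
    have hd : DifferentiableAt ℂ
        (fun v : ℂ => χ ((γ 1 1 : ℤ) : ZMod N) * (((γ 1 0 : ℂ) * v + γ 1 1) ^ j)⁻¹) z := by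
      have h0 : DifferentiableAt ℂ (fun v : ℂ => ((γ 1 0 : ℂ) * v + γ 1 1) ^ j) z := by fun_prop
      exact (h0.inv (pow_ne_zero j hc0)).const_mul _
    rw [dzbar_mul (hd.restrictScalars ℝ) (hF z z.im_pos).differentiableAt,
      dzbar_of_hasDerivAt hd.hasDerivAt, zero_mul, zero_add]
  have key := (hl.symm.trans (dzbar_congr hev)).trans hr
  rw [h _ (γ • z).im_pos, h _ z.im_pos] at key
  have him : (((γ • z : ℍ) : ℂ).im : ℂ) = (z.im : ℂ) / (c * (starRingEnd ℂ) c) := by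
    rw [Complex.mul_conj, coe_im, ModularGroup.im_smul_eq_div_normSq]
    push_cast
    rfl
  have hcb : (starRingEnd ℂ) c ≠ 0 := (map_ne_zero _).mpr hc0
  have hy : (z.im : ℂ) ≠ 0 := Complex.ofReal_ne_zero.mpr z.im_pos.ne'
  have key2 : (starRingEnd ℂ) (E ((γ • z : ℍ) : ℂ)) =
      χ ((γ 1 1 : ℤ) : ZMod N) * (starRingEnd ℂ) c ^ (j + 2) * (starRingEnd ℂ) (E z) := by
    rw [him, map_inv₀, map_pow, div_pow, mul_pow, coe_im] at key
    field_simp at key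
    linear_combination key
  have key3 := congrArg (starRingEnd ℂ) key2
  rw [Complex.conj_conj, map_mul, map_mul, map_pow, Complex.conj_conj, Complex.conj_conj] at key3
  change E _ = _ * c ^ ((j + 2 : ℕ) : ℤ) * E z
  rw [key3, zpow_natCast]
  rfl

/-! ### Growth at the cusps -/

theorem IsModular.slash_eq {κ : ℤ} {N : ℕ} {χ : DirichletCharacter ℂ N} {F : ℍ → ℂ}
    (h : IsModular κ N χ F) {δ : SL(2, ℤ)} (hδ : δ ∈ CongruenceSubgroup.Gamma0 N)
    (hd : ((δ 1 1 : ℤ) : ZMod N) = 1) : F ∣[κ] δ = F := by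
  funext z
  rw [ModularForm.SL_slash_apply, h δ hδ z, hd, map_one, one_mul, zpow_neg]
  have hden : denom δ z = (δ 1 0 : ℂ) * z + δ 1 1 := ModularGroup.denom_apply δ z
  have h0 : denom δ z ≠ 0 := denom_ne_zero δ z
  rw [← hden]
  field_simp

/-- The conjugate γ T^{mN} γ⁻¹ lies in Γ₀(N) and has lower right entry 1 mod N, so F is invariant
under it. Hence N is a period of the slash at every cusp, whatever the character. -/
theorem IsModular.slash_periodic {κ : ℤ} {N : ℕ} {χ : DirichletCharacter ℂ N} {F : ℍ → ℂ}
    (h : IsModular κ N χ F) (γ : SL(2, ℤ)) (m : ℤ) (z : ℍ) :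
    (F ∣[κ] γ) (((m * N : ℤ) : ℝ) +ᵥ z) = (F ∣[κ] γ) z := by
  set δ : SL(2, ℤ) := γ * ModularGroup.T ^ (m * N : ℤ) * γ⁻¹ with hδ
  have hmul : γ * ModularGroup.T ^ (m * N : ℤ) = δ * γ := by rw [hδ, inv_mul_cancel_right]
  have hent : δ 1 0 = -(γ 1 0) ^ 2 * (m * N) ∧ δ 1 1 = 1 + γ 0 0 * γ 1 0 * (m * N) := by
    have hdet := γ.det_coe
    rw [Matrix.det_fin_two] at hdet
    rw [hδ]
    simp only [Matrix.SpecialLinearGroup.coe_mul, ModularGroup.coe_T_zpow,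
      Matrix.SpecialLinearGroup.coe_inv, Matrix.adjugate_fin_two, Matrix.mul_apply,
      Fin.sum_univ_two, Matrix.of_apply, Matrix.cons_val', Matrix.cons_val_zero,
      Matrix.cons_val_one, Matrix.cons_val_fin_one]
    constructor
    · ring
    · linear_combination hdet
  have hδ0 : δ ∈ CongruenceSubgroup.Gamma0 N := by
    rw [CongruenceSubgroup.Gamma0_mem, hent.1]
    simp
  have hδ1 : ((δ 1 1 : ℤ) : ZMod N) = 1 := by
    rw [hent.2]
    simp
  have h1 : (F ∣[κ] γ) ∣[κ] (ModularGroup.T ^ (m * N : ℤ)) = F ∣[κ] γ := by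
    rw [← SlashAction.slash_mul, hmul, SlashAction.slash_mul, h.slash_eq hδ0 hδ1]
  have h2 := congrFun h1 z
  rw [ModularForm.SL_slash_apply, modular_T_zpow_smul] at h2
  have h3 : ∀ ε : SL(2, ℤ), ε 1 0 = 0 → ε 1 1 = 1 → denom ε z = 1 := fun ε h0 h1 => by
    rw [ModularGroup.denom_apply, h0, h1]
    simp
  rw [h3 _ (by simp [ModularGroup.coe_T_zpow]) (by simp [ModularGroup.coe_T_zpow]), one_zpow,
    mul_one] at h2
  exact h2

theorem exists_vadd_re_le (N : ℕ) [NeZero N] (z : ℍ) :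
    ∃ m : ℤ, |((((m * N : ℤ) : ℝ) +ᵥ z : ℍ)).re| ≤ N := by
  have hN : (0 : ℝ) < N := by exact_mod_cast Nat.pos_of_ne_zero (NeZero.ne N)
  refine ⟨-⌊z.re / N⌋, ?_⟩
  rw [vadd_re]
  push_cast
  have h1 := Int.floor_le (z.re / N)
  have h2 := Int.lt_floor_add_one (z.re / N)
  rw [le_div_iff₀ hN] at h1
  rw [div_lt_iff₀ hN] at h2
  rw [abs_le]
  constructor <;> nlinarith

/-- For the lower bound: if c = 0 then d = ±1, and otherwise the imaginary part of cz + d already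
has modulus |c| y ≥ 1. The upper bound uses that x is confined to a strip. -/
theorem denom_bounds (γ : SL(2, ℤ)) (N : ℕ) :
    ∃ K : ℝ, 1 ≤ K ∧ ∀ z : ℍ, 1 ≤ z.im → |z.re| ≤ N →
      1 ≤ ‖denom γ z‖ ∧ ‖denom γ z‖ ≤ K * z.im := by
  refine ⟨|(γ 1 0 : ℝ)| * (N + 1) + |(γ 1 1 : ℝ)| + 1, ?_, fun z hz hx => ?_⟩
  · have h1 := abs_nonneg (γ 1 0 : ℝ)
    have h2 := abs_nonneg (γ 1 1 : ℝ)
    have h3 : (0 : ℝ) ≤ N := Nat.cast_nonneg N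
    nlinarith [mul_nonneg h1 h3]
  have hden : denom γ z = (γ 1 0 : ℂ) * z + γ 1 1 := ModularGroup.denom_apply γ z
  constructor
  · by_cases hc : γ 1 0 = 0
    · have hdet := γ.det_coe
      rw [Matrix.det_fin_two, hc, mul_zero, sub_zero] at hdet
      have : |γ 1 1| = 1 := Int.isUnit_iff_abs_eq.mp (IsUnit.of_mul_eq_one_right _ hdet)
      rw [hden, hc]
      simp only [Int.cast_zero, zero_mul, zero_add, Complex.norm_intCast]
      exact_mod_cast this.ge
    · have h1 : (1 : ℝ) ≤ |(γ 1 0 : ℝ)| := by exact_mod_cast Int.one_le_abs hc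
      have h2 : |(denom γ z).im| ≤ ‖denom γ z‖ := Complex.abs_im_le_norm _
      refine le_trans ?_ h2
      rw [hden]
      simp only [Complex.add_im, Complex.mul_im, Complex.intCast_re, Complex.intCast_im, zero_mul,
        add_zero, coe_im, abs_mul, abs_of_pos z.im_pos]
      nlinarith
  · have hzn : ‖(z : ℂ)‖ ≤ (N + 1) * z.im := by
      refine (Complex.norm_le_abs_re_add_abs_im _).trans ?_
      rw [coe_re, coe_im, abs_of_pos z.im_pos]
      have h3 : (0 : ℝ) ≤ N := Nat.cast_nonneg N
      nlinarith
    rw [hden]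
    refine (norm_add_le _ _).trans ?_
    rw [norm_mul, Complex.norm_intCast, Complex.norm_intCast]
    have h1 := abs_nonneg (γ 1 0 : ℝ)
    have h2 := abs_nonneg (γ 1 1 : ℝ)
    nlinarith [mul_le_mul_of_nonneg_left hzn h1]

/-- Periodicity allows a shift of z into the strip |x| ≤ N. There both the height of γz and its
inverse are at most a constant times y, so a moderate growth bound turns into a power of y. -/
theorem IsModular.norm_slash_le {κ : ℤ} {N : ℕ} [NeZero N] {χ : DirichletCharacter ℂ N}
    {F : ℍ → ℂ} (h : IsModular κ N χ F) {f : ℂ → ℂ} (hFf : ∀ z : ℍ, F z = f z)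
    (hf : ModGrowth f) (γ : SL(2, ℤ)) :
    ∃ (C : ℝ) (A : ℕ), ∀ z : ℍ, 1 ≤ z.im → ‖(F ∣[κ] γ) z‖ ≤ C * z.im ^ A := by
  obtain ⟨C, A, hC⟩ := hf
  obtain ⟨K, hK1, hK⟩ := denom_bounds γ N
  have hC0 : 0 ≤ C := by
    have := (norm_nonneg _).trans (hC Complex.I (by simp))
    have h2 : (0 : ℝ) < (Complex.I.im + Complex.I.im⁻¹) ^ A := by
      simp only [Complex.I_im]; positivity
    exact nonneg_of_mul_nonneg_left this h2
  refine ⟨C * (1 + K ^ 2) ^ A * K ^ κ.natAbs, A + κ.natAbs, fun z hz => ?_⟩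
  obtain ⟨m, hm⟩ := exists_vadd_re_le N z
  rw [← h.slash_periodic γ m z]
  have him : ((((m * N : ℤ) : ℝ) +ᵥ z : ℍ)).im = z.im := vadd_im _ _
  generalize (((m * N : ℤ) : ℝ) +ᵥ z : ℍ) = v at hm him
  rw [← him] at hz ⊢
  obtain ⟨hd1, hd2⟩ := hK v hz hm
  have hy := v.im_pos
  rw [ModularForm.SL_slash_apply, norm_mul, norm_zpow]
  have hY : (γ • v).im = v.im / ‖denom γ v‖ ^ 2 := by
    rw [ModularGroup.im_smul_eq_div_normSq, Complex.normSq_eq_norm_sq]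
  have hF : ‖F (γ • v)‖ ≤ C * ((1 + K ^ 2) * v.im) ^ A := by
    rw [hFf]
    refine (hC _ (γ • v).im_pos).trans ?_
    rw [coe_im, hY, inv_div]
    have e1 : v.im / ‖denom γ v‖ ^ 2 ≤ v.im := div_le_self hy.le (one_le_pow₀ hd1)
    have e2 : ‖denom γ v‖ ^ 2 / v.im ≤ K ^ 2 * v.im := by
      rw [div_le_iff₀ hy]
      calc ‖denom γ v‖ ^ 2 ≤ (K * v.im) ^ 2 := by gcongr
        _ = _ := by ring
    gcongr
    linarith
  have hden : ‖denom γ v‖ ^ (-κ) ≤ (K * v.im) ^ κ.natAbs := by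
    calc ‖denom γ v‖ ^ (-κ) ≤ ‖denom γ v‖ ^ (κ.natAbs : ℤ) :=
          zpow_le_zpow_right₀ hd1 (by omega)
      _ = ‖denom γ v‖ ^ κ.natAbs := zpow_natCast _ _
      _ ≤ _ := by gcongr
  calc ‖F (γ • v)‖ * ‖denom γ v‖ ^ (-κ)
      ≤ (C * ((1 + K ^ 2) * v.im) ^ A) * (K * v.im) ^ κ.natAbs := by gcongr
    _ = _ := by
      rw [mul_pow, mul_pow, pow_add]
      ring

theorem IsModular.linearExpGrowthAtCusps {κ : ℤ} {N : ℕ} [NeZero N] {χ : DirichletCharacter ℂ N}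
    {F : ℍ → ℂ} (h : IsModular κ N χ F) {f : ℂ → ℂ} (hFf : ∀ z : ℍ, F z = f z)
    (hf : ModGrowth f) : LinearExpGrowthAtCusps κ F := by
  intro γ
  obtain ⟨C, A, hC⟩ := h.norm_slash_le hFf hf γ
  refine ⟨1, Asymptotics.IsBigO.of_bound (|C| * A.factorial) ?_⟩
  have hev : ∀ᶠ z : ℍ in atImInfty, 1 ≤ z.im := by
    rw [Filter.Eventually, atImInfty_mem]
    exact ⟨1, fun z hz => hz⟩
  filter_upwards [hev] with z hz
  refine (hC z hz).trans ?_
  have h1 := Real.pow_div_factorial_le_exp z.im z.im_pos.le A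
  have h2 : (0 : ℝ) < A.factorial := by positivity
  rw [div_le_iff₀ h2] at h1
  have h3 := z.im_pos
  rw [Real.norm_of_nonneg (Real.exp_pos _).le, one_mul]
  calc C * z.im ^ A ≤ |C| * (Real.exp z.im * A.factorial) := by
        gcongr
        exact le_abs_self C
    _ = _ := by ring

/-- A power of y is a power of log(1/|q|), which is o(1/|q|) as q → 0. As a holomorphic function of
q on a punctured disc, f therefore has a removable singularity at 0, and so a limit at i∞. -/
theorem isBoundedAtImInfty_of_periodic {f : ℍ → ℂ} {N : ℕ} [NeZero N]
    (hper : ∀ z : ℍ, f ((N : ℝ) +ᵥ z) = f z)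
    (hhol : DifferentiableOn ℂ (toC f) {w : ℂ | 0 < w.im})
    {C : ℝ} {A : ℕ} (hC : ∀ z : ℍ, 1 ≤ z.im → ‖f z‖ ≤ C * z.im ^ A) :
    IsBoundedAtImInfty f := by
  have hN : (0 : ℝ) < N := by exact_mod_cast Nat.pos_of_ne_zero (NeZero.ne N)
  have hp : Function.Periodic (toC f) ((N : ℝ) : ℂ) := fun w => by
    simp only [toC]
    rcases lt_or_ge 0 w.im with hw | hw
    · have hw' : 0 < (w + ((N : ℝ) : ℂ)).im := by simpa using hw
      rw [ofComplex_apply_of_im_pos hw, ofComplex_apply_of_im_pos hw', ← hper ⟨w, hw⟩]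
      congr 1
      ext
      simp [add_comm]
    · have hw' : (w + ((N : ℝ) : ℂ)).im ≤ 0 := by simpa using hw
      rw [ofComplex_apply_of_im_nonpos hw, ofComplex_apply_of_im_nonpos hw']
  have hev : ∀ B : ℝ, ∀ᶠ w : ℂ in Filter.comap Complex.im Filter.atTop, B ≤ w.im := fun B =>
    Filter.tendsto_comap.eventually (Filter.eventually_ge_atTop B)
  have hd : ∀ᶠ w : ℂ in Filter.comap Complex.im Filter.atTop, DifferentiableAt ℂ (toC f) w := by
    filter_upwards [hev 1] with w hw
    exact hhol.differentiableAt (isOpen_im_pos.mem_nhds (lt_of_lt_of_le one_pos hw))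
  have hd' := Function.Periodic.eventually_differentiableAt_cuspFunction_nhds_ne_zero hN hp hd
  -- Any constant in place of `g 0` would satisfy the growth estimate; this one is the form in which
  -- the removable singularity theorem takes its hypothesis.
  set g := Function.Periodic.cuspFunction (N : ℝ) (toC f) with hg
  have ho : (fun w : ℂ => toC f w - g 0) =o[Filter.comap Complex.im Filter.atTop]
      fun w : ℂ => Real.exp (2 * Real.pi / N * w.im) := by
    have hb : (0 : ℝ) < 2 * Real.pi / N := by positivity
    have h1 : (fun y : ℝ => |C| * y ^ A + ‖g 0‖) =o[Filter.atTop]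
        fun y : ℝ => Real.exp (2 * Real.pi / N * y) := by
      have h2 := (isLittleO_pow_exp_pos_mul_atTop A hb).const_mul_left |C|
      have h3 := (isLittleO_pow_exp_pos_mul_atTop 0 hb).const_mul_left ‖g 0‖
      simpa using h2.add h3
    have h4 := h1.comp_tendsto (Filter.tendsto_comap (f := Complex.im) (x := Filter.atTop))
    refine Asymptotics.IsBigO.trans_isLittleO (Asymptotics.IsBigO.of_bound 1 ?_) h4
    filter_upwards [hev 1] with w hw
    have hw0 : 0 < w.im := lt_of_lt_of_le one_pos hw
    have h5 := hC ⟨w, hw0⟩ hw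
    have h6 : toC f w = f ⟨w, hw0⟩ := by rw [toC, ofComplex_apply_of_im_pos hw0]
    rw [one_mul]
    refine (norm_sub_le _ _).trans (le_trans ?_ (le_abs_self _))
    simp only [Function.comp]
    rw [h6]
    have h7 : C * w.im ^ A ≤ |C| * w.im ^ A := by
      gcongr
      exact le_abs_self C
    have h8 : ‖f ⟨w, hw0⟩‖ ≤ C * w.im ^ A := h5
    linarith
  have ho' : (fun q => g q - g 0) =o[nhdsWithin 0 {0}ᶜ] fun q : ℂ => (q - 0)⁻¹ := by
    have h1 := ho.comp_tendsto (Function.Periodic.invQParam_tendsto hN)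
    refine (h1.congr' ?_ ?_).of_norm_right
    · filter_upwards [self_mem_nhdsWithin] with q hq
      rw [hg, Function.Periodic.cuspFunction_eq_of_nonzero _ _ hq]
      rfl
    · filter_upwards [self_mem_nhdsWithin] with q hq
      have h2 := Function.Periodic.norm_qParam (N : ℝ) (Function.Periodic.invQParam N q)
      rw [Function.Periodic.qParam_right_inv hN.ne' hq] at h2
      simp only [Function.comp]
      rw [sub_zero, norm_inv, h2, ← Real.exp_neg]
      congr 1
      ring
  have hlim := Complex.tendsto_limUnder_of_differentiable_on_punctured_nhds_of_isLittleO hd' ho'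
  have hlim2 := hlim.comp (Function.Periodic.qParam_tendsto hN)
  have hlim3 := hlim2.comp (Filter.tendsto_comap_iff.mpr
    (show Filter.Tendsto (Complex.im ∘ ((↑) : ℍ → ℂ)) atImInfty Filter.atTop from
      Filter.tendsto_comap))
  refine (hlim3.congr fun z => ?_).isBigO_one ℝ |>.trans ?_
  · simp only [Function.comp]
    rw [hg, Function.Periodic.eq_cuspFunction hN.ne' hp, toC_coe]
  · exact Asymptotics.isBigO_of_le _ fun z => by simp

open scoped Manifold in
-- Slashing preserves holomorphy, so each slash is a periodic holomorphic function with a polynomial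
-- bound in y.
theorem IsModular.holomorphicAtCusps {κ : ℤ} {N : ℕ} [NeZero N] {χ : DirichletCharacter ℂ N}
    {E : ℂ → ℂ} (h : IsModular κ N χ fun z => E z) (hE : DifferentiableOn ℂ E {w : ℂ | 0 < w.im})
    (hf : ModGrowth E) : HolomorphicAtCusps κ fun z => E z := by
  intro γ
  obtain ⟨C, A, hC⟩ := h.norm_slash_le (fun _ => rfl) hf γ
  refine isBoundedAtImInfty_of_periodic (N := N) (fun z => ?_) ?_ hC
  · simpa using h.slash_periodic γ 1 z
  · have hm : MDiff (fun z : ℍ => E z) := by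
      rw [UpperHalfPlane.mdifferentiable_iff]
      exact hE.congr fun w hw => by simp [ofComplex_apply_of_im_pos hw]
    have := hm.slash κ (γ : GL (Fin 2) ℝ)
    rw [UpperHalfPlane.mdifferentiable_iff] at this
    exact this

/-! ### The Fourier expansion of `∑_n (τ + n)⁻¹ (τ̄ + n)^{-(j + 1)}` -/

/-- The function `w⁻¹ w̄^{-(j + 1)}`. -/
def phi (j : ℕ) (w : ℂ) : ℂ := w⁻¹ * ((starRingEnd ℂ) w ^ (j + 1))⁻¹

theorem qser_one_eq (τ : ℍ) :
    qser (fun _ => 1) τ = ∑' n : ℕ, Complex.exp (2 * Real.pi * Complex.I * τ) ^ n := by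
  rw [qser]
  refine tsum_congr fun n => ?_
  rw [one_mul, ← Complex.exp_nat_mul]
  congr 1
  ring

theorem hasSum_inv_pow (j : ℕ) (τ : ℍ) :
    HasSum (fun n : ℤ => (((τ : ℂ) + n) ^ (j + 2))⁻¹)
      ((-2 * Real.pi * Complex.I) ^ (j + 2) / (j + 1).factorial *
        qser (fun n => (n : ℂ) ^ (j + 1)) τ) := by
  have hs : Summable fun n : ℤ => (((τ : ℂ) + n) ^ (j + 2))⁻¹ := by
    have := EisensteinSeries.linear_right_summable (τ : ℂ) 1 (k := ((j + 2 : ℕ) : ℤ)) (by omega)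
    refine this.congr fun n => ?_
    rw [zpow_natCast, Int.cast_one, one_mul]
  have h := EisensteinSeries.qExpansion_identity (k := j + 1) (by omega) τ
  refine hasSum_of_eq hs.hasSum (fun _ => rfl) ?_
  simp only [one_div] at h
  rw [h, qser]
  congr 1
  refine tsum_congr fun n => ?_
  rw [← Complex.exp_nat_mul]
  congr 2
  ring

theorem im_mul_phi_zero {y : ℝ} (hy : y ≠ 0) {w : ℂ} (hw : w.im = y) :
    (y : ℂ) * phi 0 w = (2 * Complex.I)⁻¹ * ((starRingEnd ℂ) w⁻¹ - w⁻¹) := by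
  have h0 : w ≠ 0 := fun h => hy (by rw [← hw, h, Complex.zero_im])
  have h1 : (starRingEnd ℂ) w ≠ 0 := (map_ne_zero _).mpr h0
  have h2 : w - (starRingEnd ℂ) w = 2 * Complex.I * y := by
    rw [Complex.sub_conj, hw]
    push_cast
    ring
  have hI := Complex.I_ne_zero
  rw [phi, map_inv₀, zero_add, pow_one]
  field_simp
  linear_combination -h2

/-- A partial fraction: replacing one factor y by (w - w̄) / 2i cancels either w or one power of w̄.
The first piece is summed by the Lipschitz formula, the second by induction. -/
theorem im_pow_mul_phi_succ (j : ℕ) {y : ℝ} (hy : y ≠ 0) {w : ℂ} (hw : w.im = y) :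
    (y : ℂ) ^ (j + 2) * phi (j + 1) w = (2 * Complex.I)⁻¹ *
      ((y : ℂ) ^ (j + 1) * (starRingEnd ℂ) (w ^ (j + 2))⁻¹ - (y : ℂ) ^ (j + 1) * phi j w) := by
  have h0 : w ≠ 0 := fun h => hy (by rw [← hw, h, Complex.zero_im])
  have h1 : (starRingEnd ℂ) w ≠ 0 := (map_ne_zero _).mpr h0
  have h2 : w - (starRingEnd ℂ) w = 2 * Complex.I * y := by
    rw [Complex.sub_conj, hw]
    push_cast
    ring
  have hI := Complex.I_ne_zero
  rw [phi, phi, map_inv₀, map_pow]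
  field_simp
  linear_combination (-(y : ℂ) ^ (j + 1) * (starRingEnd ℂ) w ^ (j + 1)) * h2

/-- Here y / |w|² is the difference of 1/w̄ and 1/w divided by 2i, so pairing n with -n gives the
partial fractions of π cot πτ and its conjugate, both of which have known q-expansions. -/
theorem hasSum_im_mul_phi_zero (τ : ℍ) :
    HasSum (fun n : ℤ => (τ.im : ℂ) * phi 0 ((τ : ℂ) + n))
      (Real.pi * (qser (fun _ => 1) τ + (starRingEnd ℂ) (qser (fun _ => 1) τ) - 1)) := by
  have hs : Summable fun n : ℤ => (τ.im : ℂ) * phi 0 ((τ : ℂ) + n) := by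
    refine Summable.mul_left _ (Summable.of_norm ?_)
    refine (hasSum_inv_pow 0 τ).summable.norm.congr fun n => ?_
    rw [phi, norm_inv, norm_pow, norm_mul, norm_inv, norm_inv, norm_pow, Complex.norm_conj,
      ← mul_inv, zero_add, pow_one, pow_two]
  have him : ∀ n : ℤ, ((τ : ℂ) + n).im = τ.im := fun n => by simp
  have hc1 := (summable_cotTerm (coe_mem_integerComplement τ)).hasSum
  rw [← cot_series_rep' (coe_mem_integerComplement τ), pi_mul_cot_pi_q_exp, ← qser_one_eq] at hc1
  have hc2 := (Complex.conjCLE : ℂ →L[ℝ] ℂ).hasSum hc1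
  have hc := (hc2.sub hc1).mul_left (2 * Complex.I)⁻¹
  have hnat : ∀ n : ℕ, (τ.im : ℂ) * phi 0 ((τ : ℂ) + ((n : ℤ) + 1 : ℤ)) +
      (τ.im : ℂ) * phi 0 ((τ : ℂ) + (-((n : ℤ) + 1) : ℤ)) =
      (2 * Complex.I)⁻¹ * ((starRingEnd ℂ) (cotTerm τ n) - cotTerm τ n) := fun n => by
    rw [im_mul_phi_zero τ.im_pos.ne' (him _), im_mul_phi_zero τ.im_pos.ne' (him _), cotTerm]
    push_cast
    simp only [one_div, map_add]
    rw [show (τ : ℂ) - (n + 1) = τ + -(n + 1) by ring]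
    ring
  -- The cotangent series pairs ±(n + 1) and isolates n = 0; the lattice sum is folded in the same
  -- way before the two are compared.
  have h1 := (hasSum_nat_add_iff' 1).mpr hs.hasSum.nat_add_neg
  have h2 := (hasSum_of_eq h1 (fun n => (hnat n).symm) rfl).unique hc
  refine hasSum_of_eq hs.hasSum (fun _ => rfl) ?_
  have h3 := im_mul_phi_zero τ.im_pos.ne' (him 0)
  simp only [Finset.range_one, Finset.sum_singleton, Int.cast_zero, Nat.cast_zero, neg_zero,
    add_zero] at h2 h3
  rw [h3] at h2
  change _ = (2 * Complex.I)⁻¹ * ((starRingEnd ℂ) _ - _) at h2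
  simp only [map_sub, map_mul, Complex.conj_I, Complex.conj_ofReal, Complex.conj_ofNat,
    one_div] at h2
  have hI : (2 * Complex.I)⁻¹ * (2 * Complex.I) = 1 := inv_mul_cancel₀ (by simp)
  linear_combination -h2 - Real.pi * (qser (fun _ => 1) τ + (starRingEnd ℂ) (qser (fun _ => 1) τ)
    - 1) * hI

theorem qser_const_mul (a : ℂ) (c : ℕ → ℂ) (w : ℂ) :
    qser (fun n => a * c n) w = a * qser c w := by
  simp only [qser, mul_assoc, tsum_mul_left]

theorem antider_const_mul (a : ℂ) (c : ℕ → ℂ) :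
    antider (fun n => a * c n) = fun n => a * antider c n :=
  funext fun n => by simp only [antider, mul_div_assoc]

theorem nonhol_const_mul (j : ℕ) (a : ℂ) (c : ℕ → ℂ) (w : ℂ) :
    nonhol j (fun n => a * c n) w = (starRingEnd ℂ) a * nonhol j c w := by
  induction j generalizing c with
  | zero => simp only [nonhol, antider_const_mul, qser_const_mul, map_mul]
  | succ j ih =>
    simp only [nonhol, antider_const_mul, qser_const_mul, map_mul, ih]
    ring

theorem antider_pow_succ (j : ℕ) :
    antider (fun n => (n : ℂ) ^ (j + 2)) =
      fun n : ℕ => ((4 * Real.pi : ℝ) : ℂ)⁻¹ * (n : ℂ) ^ (j + 1) := by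
  funext n
  have := Complex.ofReal_ne_zero.mpr Real.pi_ne_zero
  rw [antider]
  push_cast
  rcases eq_or_ne n 0 with rfl | hn
  · simp
  · have : (n : ℂ) ≠ 0 := by exact_mod_cast hn
    field_simp
    ring

theorem hasSum_im_pow_mul_phi (j : ℕ) (τ : ℍ) :
    HasSum (fun n : ℤ => (τ.im : ℂ) ^ (j + 1) * phi j ((τ : ℂ) + n))
      (Real.pi * ((-2 * Complex.I) ^ j)⁻¹ * qser (fun _ => 1) τ +
        4 * Real.pi ^ 2 * (2 * Real.pi * Complex.I) ^ j / j.factorial *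
          nonhol j (fun n => (n : ℂ) ^ (j + 1)) τ) := by
  have hpi := Complex.ofReal_ne_zero.mpr Real.pi_ne_zero
  have hI := Complex.I_ne_zero
  induction j with
  | zero =>
    refine hasSum_of_eq (hasSum_im_mul_phi_zero τ) (fun n => by simp) ?_
    have h1 := (polyGrowth_const 1).hasSum τ.im_pos
    have h2 : HasSum (fun n : ℕ => (if n = 0 then 1 else 0 : ℂ)) 1 := hasSum_ite_eq 0 1
    have h3 : qser (antider fun n => (n : ℂ) ^ (0 + 1)) τ =
        (4 * Real.pi : ℂ)⁻¹ * (qser (fun _ => 1) τ - 1) := by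
      rw [← ((h1.sub h2).mul_left (4 * Real.pi : ℂ)⁻¹).tsum_eq, qser]
      refine tsum_congr fun n => ?_
      rcases eq_or_ne n 0 with rfl | hn
      · simp [antider]
      · have : (n : ℂ) ≠ 0 := by exact_mod_cast hn
        rw [if_neg hn, antider]
        field_simp
        simp
    rw [nonhol, h3]
    simp [Complex.conj_ofNat]
    field_simp
    ring
  | succ j ih =>
    have him : ∀ n : ℤ, ((τ : ℂ) + n).im = τ.im := fun n => by simp
    have h1 := ((Complex.conjCLE : ℂ →L[ℝ] ℂ).hasSum (hasSum_inv_pow j τ)).mul_left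
      ((τ.im : ℂ) ^ (j + 1))
    refine hasSum_of_eq ((h1.sub ih).mul_left (2 * Complex.I)⁻¹)
      (fun n => im_pow_mul_phi_succ j τ.im_pos.ne' (him n)) ?_
    change _ = (2 * Complex.I)⁻¹ * ((τ.im : ℂ) ^ (j + 1) * (starRingEnd ℂ) _ - _)
    -- `antider` lowers the coefficients n^{j+2} to n^{j+1} / 4π, which matches the recursive part
    -- of `nonhol` with the inductive hypothesis and its leading part with the Lipschitz formula.
    rw [nonhol, antider_pow_succ, nonhol_const_mul, qser_const_mul, map_mul, map_mul, map_div₀,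
      map_pow, map_natCast, ← Complex.ofReal_inv, Complex.conj_ofReal, Nat.factorial_succ]
    have hf : (j.factorial : ℂ) ≠ 0 := by exact_mod_cast j.factorial_ne_zero
    have hj : (j + 1 : ℂ) ≠ 0 := by exact_mod_cast j.succ_ne_zero
    have hc : (starRingEnd ℂ) (-2 * Real.pi * Complex.I) = 2 * Real.pi * Complex.I := by
      simp [Complex.conj_ofNat]
    rw [hc]
    have e2 : (-2 * Complex.I) ^ (j + 1) = (-2 * Complex.I) ^ j * (-2 * Complex.I) := pow_succ _ _
    have hp : (-2 * Complex.I) ^ j ≠ 0 := pow_ne_zero _ (by simp)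
    rw [e2, coe_im]
    generalize qser (fun n => (n : ℂ) ^ (j + 1)) (τ : ℂ) = Q
    generalize nonhol j (fun n => (n : ℂ) ^ (j + 1)) (τ : ℂ) = S
    generalize qser (fun _ => (1 : ℂ)) (τ : ℂ) = R
    rw [mul_pow (2 * (Real.pi : ℂ)), mul_pow (2 * (Real.pi : ℂ)), mul_pow (2 * (Real.pi : ℂ)),
      mul_pow 2 (Real.pi : ℂ), mul_pow 2 (Real.pi : ℂ), mul_pow 2 (Real.pi : ℂ)]
    generalize (-2 * Complex.I) ^ j = P at *
    push_cast
    simp only [pow_succ]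
    field_simp
    ring_nf
    simp only [Complex.I_sq]
    ring

/-! ### Gauss sums of imprimitive characters -/

theorem conductor_star {M : ℕ} (χ : DirichletCharacter ℂ M) :
    (star χ).conductor = χ.conductor := by
  rcases eq_zero_or_neZero M with rfl | h
  · rw [DirichletCharacter.conductor_eq_zero_iff_level_eq_zero.mpr rfl,
      DirichletCharacter.conductor_eq_zero_iff_level_eq_zero.mpr rfl]
  · rw [MulChar.star_eq_inv, DirichletCharacter.conductor_inv]

theorem ell_star {M : ℕ} (χ : DirichletCharacter ℂ M) : ell (star χ) = ell χ := by
  rw [ell, ell, conductor_star]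

theorem primitiveCharacter_star_apply {M : ℕ} [NeZero M] (χ : DirichletCharacter ℂ M) (n : ℕ) :
    (star χ).primitiveCharacter (n : ZMod (star χ).conductor) =
      star (χ.primitiveCharacter (n : ZMod χ.conductor)) := by
  have hc : NeZero χ.conductor := ⟨χ.conductor_ne_zero⟩
  rw [MulChar.star_apply']
  by_cases ha : IsCoprime (n : ℤ) χ.conductor
  · suffices h : DirichletCharacter.changeLevel (dvd_of_eq (conductor_star χ))
        (star χ).primitiveCharacter = χ.primitiveCharacter⁻¹ by
      have := DFunLike.congr_fun h ((n : ℤ) : ZMod _)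
      rw [DirichletCharacter.changeLevel_eq_cast_of_dvd' _ _ ha] at this
      simpa using this
    apply DirichletCharacter.changeLevel_injective χ.conductor_dvd_level
    rw [← DirichletCharacter.changeLevel_trans, DirichletCharacter.changeLevel_primitiveCharacter,
      map_inv, DirichletCharacter.changeLevel_primitiveCharacter, MulChar.star_eq_inv]
  · have h1 := (DirichletCharacter.apply_eq_zero_iff χ.primitiveCharacter⁻¹ (n : ℤ)).mpr ha
    have h2 := (DirichletCharacter.apply_eq_zero_iff (star χ).primitiveCharacter (n : ℤ)).mpr
      (by rwa [conductor_star])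
    rw [Int.cast_natCast] at h1 h2
    rw [h1, h2]

/-- The Gauss sum `∑_{a mod M} χ(a) e^{2 π i a c / M}`. -/
def gaussC {M : ℕ} (χ : DirichletCharacter ℂ M) (c : ℤ) : ℂ :=
  ∑ a ∈ Finset.range M, χ (a : ZMod M) * Complex.exp (2 * Real.pi * Complex.I * (a * c) / M)

/-- The arithmetic factor of the Gauss sum of the conjugate of `χ`. -/
def gaussFactor {M : ℕ} (χ : DirichletCharacter ℂ M) (c : ℕ) : ℂ :=
  ∑ d ∈ (Nat.gcd (ell χ) c).divisors,
    (d : ℂ) * (ArithmeticFunction.moebius (ell χ / d) : ℂ) *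
      star (χ.primitiveCharacter ((ell χ / d : ℕ) : ZMod χ.conductor)) *
      χ.primitiveCharacter ((c / d : ℕ) : ZMod χ.conductor)

theorem sum_range_mul_eq {α : Type*} [AddCommMonoid α] (f : ℕ → α) (m d : ℕ) :
    ∑ b ∈ Finset.range (m * d), f b =
      ∑ i ∈ Finset.range d, ∑ b ∈ Finset.range m, f (m * i + b) := by
  induction d with
  | zero => simp
  | succ d ih => rw [mul_add, mul_one, Finset.sum_range_add, ih, Finset.sum_range_succ]

theorem sum_range_filter_dvd {α : Type*} [AddCommMonoid α] (f : ℕ → α) {e : ℕ} (he : 0 < e)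
    (n : ℕ) :
    ∑ a ∈ (Finset.range (e * n)).filter (e ∣ ·), f a = ∑ b ∈ Finset.range n, f (e * b) := by
  refine (Finset.sum_nbij (fun b => e * b) ?_ ?_ ?_ ?_).symm
  · intro b hb
    simp only [Finset.mem_range, Finset.mem_filter] at hb ⊢
    exact ⟨by gcongr, dvd_mul_right _ _⟩
  · intro b _ b' _ h
    exact Nat.eq_of_mul_eq_mul_left he h
  · intro a ha
    simp only [Finset.coe_filter, Finset.mem_range, Set.mem_ofPred_eq] at ha
    obtain ⟨⟨b, rfl⟩, h⟩ := And.intro ha.2 ha.1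
    exact ⟨b, by simpa using lt_of_mul_lt_mul_left h (Nat.zero_le e), rfl⟩
  · intro _ _
    rfl

theorem exp_two_pi_I_nat (n : ℕ) : Complex.exp (2 * Real.pi * Complex.I * n) = 1 := by
  rw [Complex.exp_eq_one_iff]
  exact ⟨n, by push_cast; ring⟩

theorem geom_sum_exp {d : ℕ} (hd : d ≠ 0) (c : ℕ) :
    ∑ i ∈ Finset.range d, Complex.exp (2 * Real.pi * Complex.I * (i * c) / d) =
      if d ∣ c then (d : ℂ) else 0 := by
  have hd' : (d : ℂ) ≠ 0 := by exact_mod_cast hd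
  set ζ := Complex.exp (2 * Real.pi * Complex.I * c / d) with hζ
  have h1 : ∀ i : ℕ, Complex.exp (2 * Real.pi * Complex.I * (i * c) / d) = ζ ^ i := fun i => by
    rw [hζ, ← Complex.exp_nat_mul]
    congr 1
    ring
  have h2 : ζ ^ d = 1 := by
    rw [← h1, ← exp_two_pi_I_nat c]
    congr 1
    field_simp
  have h3 : ζ = 1 ↔ d ∣ c := by
    rw [hζ, Complex.exp_eq_one_iff]
    have h2pi := Complex.two_pi_I_ne_zero
    constructor
    · rintro ⟨n, hn⟩
      have : (c : ℂ) = d * n := by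
        field_simp at hn
        linear_combination hn
      have h4 : (c : ℤ) = d * n := by exact_mod_cast this
      exact_mod_cast Dvd.intro _ h4.symm
    · rintro ⟨b, rfl⟩
      exact ⟨b, by push_cast; field_simp⟩
  simp only [h1]
  split_ifs with h
  · simp [h3.mpr h]
  · have := mul_geom_sum ζ d
    rw [h2, sub_self] at this
    exact (mul_eq_zero.mp this).resolve_left (sub_ne_zero.mpr (fun h' => h (h3.mp h')))

theorem sum_zmod_eq_sum_range {α : Type*} [AddCommMonoid α] {m : ℕ} [NeZero m] (f : ZMod m → α) :
    ∑ a : ZMod m, f a = ∑ b ∈ Finset.range m, f (b : ZMod m) := by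
  refine Finset.sum_nbij ZMod.val ?_ ?_ ?_ ?_
  · intro a _
    simpa using ZMod.val_lt a
  · intro a _ b _ h
    exact ZMod.val_injective m h
  · intro b hb
    exact ⟨b, by simp, ZMod.val_cast_of_lt (by simpa using hb)⟩
  · intro a _
    rw [ZMod.natCast_zmod_val]

/-- Separability of Gauss sums of primitive characters, valid also at n not coprime to m, where both
sides vanish. -/
theorem gaussC_of_isPrimitive {m : ℕ} [NeZero m] {χ : DirichletCharacter ℂ m}
    (h : χ.IsPrimitive) (n : ℕ) : gaussC χ n = star (χ (n : ZMod m)) * gaussC χ 1 := by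
  have h1 : ∀ c : ℕ, gaussC χ c = gaussSum χ ((ZMod.stdAddChar (N := m)).mulShift (c : ZMod m)) :=
    fun c => by
      rw [gaussC, gaussSum, sum_zmod_eq_sum_range]
      refine Finset.sum_congr rfl fun a _ => ?_
      rw [AddChar.mulShift_apply, mul_comm (c : ZMod m), show (a : ZMod m) * c =
        ((a * c : ℤ) : ZMod m) by push_cast; rfl, ZMod.stdAddChar_coe]
      push_cast
      rfl
  have h2 := h1 1
  rw [Nat.cast_one, Nat.cast_one, AddChar.mulShift_one] at h2
  rw [h1, gaussSum_mulShift_of_isPrimitive _ h, h2, MulChar.star_apply']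

theorem gaussW_eq {M : ℕ} [NeZero M] (χ : DirichletCharacter ℂ M) :
    gaussW χ = gaussC χ.primitiveCharacter 1 := by
  have hc : NeZero χ.conductor := ⟨χ.conductor_ne_zero⟩
  have hm : (χ.conductor : ℂ) ≠ 0 := by exact_mod_cast χ.conductor_ne_zero
  set f : ℕ → ℂ := fun n => χ.primitiveCharacter (n : ZMod χ.conductor) *
    Complex.exp (2 * Real.pi * Complex.I * n / χ.conductor) with hf
  have h0 : f χ.conductor = f 0 := by
    simp only [hf]
    rw [mul_div_cancel_right₀ _ hm, Complex.exp_two_pi_mul_I]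
    simp
  have h1 := Finset.sum_range_succ f χ.conductor
  rw [Finset.sum_range_succ', h0, add_left_inj] at h1
  have h2 : Finset.Icc 1 χ.conductor = Finset.Ico 1 (χ.conductor + 1) := by
    ext
    simp
  rw [gaussW, gaussC, h2, Finset.sum_Ico_eq_sum_range, Nat.add_sub_cancel]
  simp only [add_comm 1]
  refine h1.trans (Finset.sum_congr rfl fun a _ => ?_)
  simp [hf]

/-- Since M = m_χ ℓ_χ, the character χ is its primitive character restricted to integers prime to
ℓ_χ; that coprimality is detected by a Möbius sum over common divisors. -/
theorem apply_eq_sum_moebius {M : ℕ} [NeZero M] (χ : DirichletCharacter ℂ M) (a : ℕ) :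
    χ (a : ZMod M) = ∑ e ∈ (ell χ).divisors.filter (· ∣ a),
      (ArithmeticFunction.moebius e : ℂ) * χ.primitiveCharacter (a : ZMod χ.conductor) := by
  have hM : χ.conductor * ell χ = M := Nat.mul_div_cancel' χ.conductor_dvd_level
  have hℓ : ell χ ≠ 0 := fun h => NeZero.ne M (by rw [← hM, h, mul_zero])
  have hset : (ell χ).divisors.filter (· ∣ a) = (Nat.gcd (ell χ) a).divisors := by
    ext e
    simp [Nat.dvd_gcd_iff, hℓ]
  have hμ : ∑ e ∈ (Nat.gcd (ell χ) a).divisors, ArithmeticFunction.moebius e =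
      if Nat.gcd (ell χ) a = 1 then 1 else 0 := by
    rw [← ArithmeticFunction.coe_zeta_mul_apply, ArithmeticFunction.coe_zeta_mul_moebius,
      ArithmeticFunction.one_apply]
  rw [hset, ← Finset.sum_mul, ← Int.cast_sum, hμ]
  by_cases haM : Nat.Coprime a M
  · have hco : Nat.gcd (ell χ) a = 1 :=
      Nat.Coprime.symm (haM.coprime_dvd_right (Dvd.intro_left _ hM))
    have := χ.primitiveCharacter_apply_of_isCoprime (a := a) (Nat.isCoprime_iff_coprime.mpr haM)
    rw [Int.cast_natCast, Int.cast_natCast] at this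
    rw [if_pos hco, this]
    simp
  · have h0 : χ (a : ZMod M) = 0 := by
      have := (DirichletCharacter.apply_eq_zero_iff χ (a : ℤ)).mpr
        (by rwa [Nat.isCoprime_iff_coprime])
      simpa using this
    rw [h0]
    split_ifs with hg
    · have h1 : ¬ Nat.Coprime a χ.conductor := fun h =>
        haM (hM ▸ Nat.Coprime.mul_right h (Nat.Coprime.symm hg))
      have := (DirichletCharacter.apply_eq_zero_iff χ.primitiveCharacter (a : ℤ)).mpr
        (by rwa [Nat.isCoprime_iff_coprime])
      rw [Int.cast_natCast] at this
      rw [this, mul_zero]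
    · simp

/-- After Möbius inversion a = eb, with b modulo m_χ d and d = ℓ_χ / e. Writing b = m_χ i + b₀, the
sum over i is geometric and forces d ∣ c, and the sum over b₀ is a primitive Gauss sum at c / d. -/
theorem gaussC_eq {M : ℕ} [NeZero M] (χ : DirichletCharacter ℂ M) (c : ℕ) :
    gaussC χ c = gaussW χ * gaussFactor (star χ) c := by
  have hM : χ.conductor * ell χ = M := Nat.mul_div_cancel' χ.conductor_dvd_level
  have hℓ : ell χ ≠ 0 := fun h => NeZero.ne M (by rw [← hM, h, mul_zero])
  have hc : NeZero χ.conductor := ⟨χ.conductor_ne_zero⟩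
  set m := χ.conductor with hm
  set χ₀ := χ.primitiveCharacter with hχ₀
  have hm0 : (m : ℂ) ≠ 0 := by exact_mod_cast NeZero.ne m
  have inner : ∀ d : ℕ, d ≠ 0 →
      ∑ b ∈ Finset.range (m * d), χ₀ (b : ZMod m) *
        Complex.exp (2 * Real.pi * Complex.I * (b * c) / (m * d : ℕ)) =
      if d ∣ c then d * (star (χ₀ ((c / d : ℕ) : ZMod m)) * gaussW χ) else 0 := by
    intro d hd
    have hd' : (d : ℂ) ≠ 0 := by exact_mod_cast hd
    rw [sum_range_mul_eq]
    have h1 : ∀ i b : ℕ, χ₀ ((m * i + b : ℕ) : ZMod m) *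
        Complex.exp (2 * Real.pi * Complex.I * ((m * i + b : ℕ) * c) / (m * d : ℕ)) =
        Complex.exp (2 * Real.pi * Complex.I * (i * c) / d) * (χ₀ (b : ZMod m) *
          Complex.exp (2 * Real.pi * Complex.I * (b * c) / (m * d : ℕ))) := fun i b => by
      rw [mul_left_comm (Complex.exp _), ← Complex.exp_add]
      congr 2
      · simp [hm]
      · push_cast
        field_simp
    simp only [h1, ← Finset.mul_sum]
    rw [← Finset.sum_mul, geom_sum_exp hd]
    split_ifs with hdc
    · obtain ⟨n, rfl⟩ := hdc
      rw [gaussW_eq, ← gaussC_of_isPrimitive χ.primitiveCharacter_isPrimitive,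
        Nat.mul_div_cancel_left n (Nat.pos_of_ne_zero hd), gaussC]
      congr 1
      refine Finset.sum_congr rfl fun b _ => ?_
      congr 2
      rw [← hm]
      push_cast
      field_simp
    · rw [zero_mul]
  have step : gaussC χ c = ∑ e ∈ (ell χ).divisors,
      (ArithmeticFunction.moebius e : ℂ) * (χ₀ (e : ZMod m) *
        if ell χ / e ∣ c then ((ell χ / e : ℕ) : ℂ) *
          (star (χ₀ ((c / (ell χ / e) : ℕ) : ZMod m)) * gaussW χ) else 0) := by
    rw [gaussC]
    simp only [apply_eq_sum_moebius χ, Finset.sum_filter, Finset.sum_mul]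
    rw [Finset.sum_comm]
    refine Finset.sum_congr rfl fun e he => ?_
    have he' := (Nat.mem_divisors.mp he).1
    obtain ⟨d, hd⟩ := he'
    have he0 : 0 < e := Nat.pos_of_mem_divisors he
    have hd0 : d ≠ 0 := fun h => hℓ (by rw [hd, h, mul_zero])
    have hMe : M = e * (m * d) := by rw [← hM, hd]; ring
    have he1 : (e : ℂ) ≠ 0 := by exact_mod_cast he0.ne'
    have hd1 : (d : ℂ) ≠ 0 := by exact_mod_cast hd0
    rw [hd, Nat.mul_div_cancel_left d he0, ← inner d hd0, Finset.mul_sum, Finset.mul_sum]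
    simp only [ite_mul, zero_mul]
    rw [← Finset.sum_filter]
    have := sum_range_filter_dvd (fun a : ℕ => (ArithmeticFunction.moebius e : ℂ) *
      χ₀ (a : ZMod m) * Complex.exp (2 * Real.pi * Complex.I * (a * (c : ℤ)) / M)) he0 (m * d)
    rw [← hMe] at this
    rw [this]
    refine Finset.sum_congr rfl fun b _ => ?_
    have hexp : Complex.exp (2 * Real.pi * Complex.I * ((e * b : ℕ) * (c : ℤ)) / M) =
        Complex.exp (2 * Real.pi * Complex.I * (b * c) / (m * d : ℕ)) := by
      congr 1
      rw [hMe]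
      push_cast
      field_simp
    rw [hexp]
    push_cast
    rw [map_mul]
    ring
  -- The Möbius sum runs over e and the target over the complementary divisor d = ℓ_χ / e.
  rw [step, gaussFactor, ell_star, Finset.mul_sum,
    ← Nat.sum_div_divisors (ell χ) (fun e => (ArithmeticFunction.moebius e : ℂ) *
      (χ₀ (e : ZMod m) * if ell χ / e ∣ c then ((ell χ / e : ℕ) : ℂ) *
          (star (χ₀ ((c / (ell χ / e) : ℕ) : ZMod m)) * gaussW χ) else 0))]
  have hset : (Nat.gcd (ell χ) c).divisors = (ell χ).divisors.filter (· ∣ c) := by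
    ext e
    simp [Nat.dvd_gcd_iff, hℓ]
  rw [hset, Finset.sum_filter]
  refine Finset.sum_congr rfl fun d hd => ?_
  rw [Nat.div_div_self (Nat.mem_divisors.mp hd).1 hℓ]
  split_ifs with h
  · rw [primitiveCharacter_star_apply, primitiveCharacter_star_apply, star_star]
    ring
  · ring

/-! ### Character sums of `phi` -/

theorem hasSum_int_of_residues {M : ℕ} [NeZero M] {f : ℤ → ℂ} {S : ℕ → ℂ}
    (h : ∀ a < M, HasSum (fun n : ℤ => f (a + M * n)) (S a)) :
    HasSum f (∑ a ∈ Finset.range M, S a) := by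
  have hM : (0 : ℤ) < M := by exact_mod_cast Nat.pos_of_ne_zero (NeZero.ne M)
  have h1 : ∀ a ∈ Finset.range M,
      HasSum (fun n : ℤ => if n % M = a then f n else 0) (S a) := fun a ha => by
    have ha' : (a : ℤ) < M := by exact_mod_cast Finset.mem_range.mp ha
    have hinj : Function.Injective fun n : ℤ => (a + M * n : ℤ) := fun x y hxy => by
      simpa [NeZero.ne M] using hxy
    refine (hinj.hasSum_iff fun n hn => ?_).mp
      (hasSum_of_eq (h a (Finset.mem_range.mp ha)) (fun n => ?_) rfl)
    · rw [if_neg]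
      intro hmod
      exact hn ⟨n / M, by rw [← hmod]; exact Int.emod_add_mul_ediv n M⟩
    · simp only [Function.comp]
      rw [if_pos]
      rw [Int.add_mul_emod_self_left, Int.emod_eq_of_lt (by positivity) ha']
  refine hasSum_of_eq (hasSum_sum h1) (fun n => ?_) rfl
  have h0 := Int.emod_nonneg n hM.ne'
  have h2 := Int.emod_lt_of_pos n hM
  rw [Finset.sum_eq_single (n % M).toNat]
  · rw [if_pos (by omega)]
  · intro b _ hb
    rw [if_neg (by omega)]
  · intro hb
    exact absurd (Finset.mem_range.mpr (by omega)) hb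

theorem phi_real_mul (j : ℕ) (r : ℝ) (w : ℂ) : phi j (r * w) = ((r : ℂ) ^ (j + 2))⁻¹ * phi j w := by
  rw [phi, phi, map_mul, Complex.conj_ofReal, mul_pow, mul_inv, mul_inv, pow_succ (r : ℂ) (j + 1),
    mul_inv]
  ring

theorem norm_gaussC_le {M : ℕ} (χ : DirichletCharacter ℂ M) (c : ℤ) : ‖gaussC χ c‖ ≤ M := by
  refine (norm_sum_le _ _).trans ?_
  refine (Finset.sum_le_sum (g := fun _ => (1 : ℝ)) fun a _ => ?_).trans (by simp)
  rw [norm_mul]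
  have h2 : ‖Complex.exp (2 * Real.pi * Complex.I * (a * c) / M)‖ = 1 := by
    rw [show (2 * Real.pi * Complex.I * (a * c) / M : ℂ) =
      ((2 * Real.pi * (a * c) / M : ℝ) : ℂ) * Complex.I by push_cast; ring]
    exact Complex.norm_exp_ofReal_mul_I _
  rw [h2, mul_one]
  exact DirichletCharacter.norm_le_one _ _

theorem PolyGrowth.pow {a : ℕ → ℂ} (ha : PolyGrowth a) (j : ℕ) : PolyGrowth fun n => a n ^ j := by
  induction j with
  | zero => simpa using polyGrowth_const 1
  | succ j ih => simpa [pow_succ] using ih.mul ha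

theorem polyGrowth_gaussC {M : ℕ} (χ : DirichletCharacter ℂ M) :
    PolyGrowth fun c => gaussC χ c :=
  ⟨M, 0, fun c => by simpa using norm_gaussC_le χ c⟩

theorem star_gaussC {M : ℕ} (χ : DirichletCharacter ℂ M) (c : ℤ) :
    star (gaussC (star χ) c) = gaussC χ (-c) := by
  rw [gaussC, gaussC, star_sum]
  refine Finset.sum_congr rfl fun a _ => ?_
  rw [star_mul', MulChar.star_apply, star_star]
  congr 1
  rw [RCLike.star_def, ← Complex.exp_conj]
  congr 1
  simp [Complex.conj_ofNat]

/-- The value of `M^{j + 2} (Im τ)^{j + 1} ∑_n χ(n) phi j (M τ + n)`. -/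
def charSum (j : ℕ) {M : ℕ} (χ : DirichletCharacter ℂ M) (w : ℂ) : ℂ :=
  Real.pi * ((-2 * Complex.I) ^ j)⁻¹ * qser (fun c => gaussC χ c) w +
    4 * Real.pi ^ 2 * (2 * Real.pi * Complex.I) ^ j / j.factorial *
      nonhol j (fun c => (c : ℂ) ^ (j + 1) * gaussC (star χ) c) w

theorem hasSum_char_mul_phi (j : ℕ) {M : ℕ} [NeZero M] (χ : DirichletCharacter ℂ M) (τ : ℍ) :
    HasSum (fun n : ℤ => (M : ℂ) ^ (j + 2) * (τ.im : ℂ) ^ (j + 1) *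
      (χ (n : ZMod M) * phi j (M * τ + n))) (charSum j χ τ) := by
  have hM : (M : ℂ) ≠ 0 := by exact_mod_cast NeZero.ne M
  have him : ∀ a : ℕ, ((τ : ℂ) + a / M).im = τ.im := fun a => by
    rw [Complex.add_im, show (a / M : ℂ) = ((a / M : ℝ) : ℂ) by push_cast; rfl,
      Complex.ofReal_im, add_zero, coe_im]
  have hτ : ∀ a : ℕ, 0 < ((τ : ℂ) + a / M).im := fun a => (him a).symm ▸ τ.im_pos
  have h1 := hasSum_int_of_residues (M := M) (f := fun n : ℤ =>
      (M : ℂ) ^ (j + 2) * (τ.im : ℂ) ^ (j + 1) * (χ (n : ZMod M) * phi j (M * τ + n)))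
    (S := fun a => χ (a : ZMod M) * (Real.pi * ((-2 * Complex.I) ^ j)⁻¹ *
      qser (fun _ => 1) (τ + a / M) +
        4 * Real.pi ^ 2 * (2 * Real.pi * Complex.I) ^ j / j.factorial *
          nonhol j (fun n => (n : ℂ) ^ (j + 1)) (τ + a / M))) (fun a _ => by
    have h2 := (hasSum_im_pow_mul_phi j ⟨τ + a / M, hτ a⟩).mul_left (χ (a : ZMod M))
    refine hasSum_of_eq h2 (fun n => ?_) rfl
    -- On the residue class of a, scaling by M reduces the sum to the untwisted one at τ + a/M; the
    -- exponentials of ac/M then assemble into Gauss sums.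
    have e1 : (M * τ + ((a + M * n : ℤ) : ℂ) : ℂ) = ((M : ℝ) : ℂ) * (τ + a / M + n) := by
      push_cast
      field_simp
      ring
    have e2 : ((⟨τ + a / M, hτ a⟩ : ℍ).im) = τ.im := him a
    rw [e1, phi_real_mul, e2]
    push_cast
    simp only [CharP.cast_eq_zero, zero_mul, add_zero]
    field_simp)
  refine hasSum_of_eq h1 (fun _ => rfl) ?_
  simp only [mul_add, Finset.sum_add_distrib]
  rw [charSum]
  have hexp : ∀ a c : ℕ, Complex.exp (2 * Real.pi * Complex.I * c * (τ + a / M)) =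
      Complex.exp (2 * Real.pi * Complex.I * (a * c) / M) *
        Complex.exp (2 * Real.pi * Complex.I * c * τ) := fun a c => by
    rw [← Complex.exp_add]
    congr 1
    field_simp
    ring
  have hexp' : ∀ a c : ℕ, Complex.exp (2 * Real.pi * Complex.I * (-c : ℤ) * (τ + a / M)) =
      Complex.exp (2 * Real.pi * Complex.I * (a * (-c : ℤ)) / M) *
        Complex.exp (2 * Real.pi * Complex.I * (-c : ℤ) * τ) := fun a c => by
    rw [← Complex.exp_add]
    congr 1
    field_simp
    ring
  congr 1
  · have h3 : HasSum (fun c : ℕ => gaussC χ c * Complex.exp (2 * Real.pi * Complex.I * c * τ))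
        (∑ a ∈ Finset.range M, χ (a : ZMod M) * qser (fun _ => 1) (τ + a / M)) := by
      refine hasSum_of_eq (hasSum_sum fun a _ =>
        ((polyGrowth_const 1).hasSum (hτ a)).mul_left (χ (a : ZMod M))) (fun c => ?_) rfl
      rw [gaussC, Finset.sum_mul]
      refine Finset.sum_congr rfl fun a _ => ?_
      rw [hexp, one_mul, Int.cast_natCast]
      ring
    rw [(polyGrowth_gaussC χ).hasSum τ.im_pos |>.unique h3, Finset.mul_sum]
    exact Finset.sum_congr rfl fun a _ => by ring
  · have hpg : PolyGrowth fun c : ℕ => (c : ℂ) ^ (j + 1) := polyGrowth_natCast.pow (j + 1)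
    have h3 : HasSum (fun c : ℕ => star ((c : ℂ) ^ (j + 1) * gaussC (star χ) c) *
          bexp (4 * Real.pi * c) j τ.im * Complex.exp (2 * Real.pi * Complex.I * (-c : ℤ) * τ))
        (∑ a ∈ Finset.range M, χ (a : ZMod M) *
          nonhol j (fun n => (n : ℂ) ^ (j + 1)) (τ + a / M)) := by
      refine hasSum_of_eq (hasSum_sum fun a _ =>
        (hasSum_nonhol j hpg (hτ a)).mul_left (χ (a : ZMod M))) (fun c => ?_) rfl
      rw [star_mul', star_gaussC, gaussC, Finset.mul_sum, Finset.sum_mul, Finset.sum_mul]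
      refine Finset.sum_congr rfl fun a _ => ?_
      rw [hexp', him]
      ring
    rw [(hasSum_nonhol j (hpg.mul (polyGrowth_gaussC (star χ))) τ.im_pos).unique h3,
      Finset.mul_sum]
    exact Finset.sum_congr rfl fun a _ => by ring

/-! ### Regrouping double sums along divisors -/

/-- The sequence `v` decays faster than every power. -/
def RapidDecay (v : ℕ → ℂ) : Prop := ∀ B : ℕ, ∃ D : ℝ, ∀ n : ℕ, n ≠ 0 → ‖v n‖ ≤ D * ((n : ℝ) ^ B)⁻¹

/-- The divisor sum `∑_{c ∣ n / t} u(n / (t c), c)`, zero unless `n` is a positive multiple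
of `t`. -/
def divSum (t : ℕ) (u : ℕ → ℕ → ℂ) (n : ℕ) : ℂ :=
  if t ∣ n then ∑ c ∈ (n / t).divisors, u (n / t / c) c else 0

theorem divSum_mul {t : ℕ} (ht : 0 < t) (u : ℕ → ℕ → ℂ) (n : ℕ) :
    divSum t u (t * n) = ∑ c ∈ n.divisors, u (n / c) c := by
  rw [divSum, if_pos (dvd_mul_right t n), Nat.mul_div_cancel_left n ht]

theorem summable_pair {u : ℕ → ℕ → ℂ} {v : ℕ → ℂ} {t : ℕ} (ht : 0 < t) {C : ℝ} {B : ℕ}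
    (hu : ∀ m c : ℕ, m ≠ 0 → c ≠ 0 → ‖u m c‖ ≤ C * (m * c : ℝ) ^ B) (hv : RapidDecay v) :
    Summable fun p : ℕ+ × ℕ+ => u p.1 p.2 * v (t * (p.1 * p.2)) := by
  obtain ⟨D, hD⟩ := hv (B + 2)
  have hC : 0 ≤ C := by simpa using (norm_nonneg _).trans (hu 1 1 one_ne_zero one_ne_zero)
  have hD0 : 0 ≤ D := by simpa using (norm_nonneg _).trans (hD 1 one_ne_zero)
  have hs : Summable fun n : ℕ+ => ((n : ℝ) ^ 2)⁻¹ :=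
    (Real.summable_nat_pow_inv.mpr one_lt_two).comp_injective PNat.coe_injective
  have hp : Summable fun p : ℕ+ × ℕ+ => C * D * (((p.1 : ℝ) ^ 2)⁻¹ * ((p.2 : ℝ) ^ 2)⁻¹) :=
    (hs.mul_of_nonneg hs (fun n => by positivity) (fun n => by positivity)).mul_left _
  refine Summable.of_norm_bounded hp fun p => ?_
  have h1 := hu p.1 p.2 p.1.ne_zero p.2.ne_zero
  have h2 := hD (t * (p.1 * p.2)) (by simp [ht.ne'])
  have hm : (0 : ℝ) < (p.1 : ℝ) * p.2 := by
    have := p.1.pos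
    have := p.2.pos
    positivity
  have h3 : ((((t * (p.1 * p.2) : ℕ) : ℝ)) ^ (B + 2))⁻¹ ≤ (((p.1 : ℝ) * p.2) ^ (B + 2))⁻¹ := by
    have ht1 : (1 : ℝ) ≤ t := by exact_mod_cast ht
    gcongr
    push_cast
    nlinarith
  rw [norm_mul]
  calc ‖u p.1 p.2‖ * ‖v (t * (p.1 * p.2))‖
      ≤ (C * (p.1 * p.2 : ℝ) ^ B) * (D * (((p.1 : ℝ) * p.2) ^ (B + 2))⁻¹) :=
        mul_le_mul h1 (h2.trans (by gcongr)) (norm_nonneg _) (by positivity)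
    _ = _ := by
        rw [pow_add]
        field_simp

/-- Fubini for an absolutely convergent family over pairs (m, c): summed by rows it gives X, and
summed along the fibres of mc it gives the divisor sums. -/
theorem hasSum_divSum {u : ℕ → ℕ → ℂ} {v : ℕ → ℂ} {t : ℕ} (ht : 0 < t) {C : ℝ} {B : ℕ}
    (hu : ∀ m c : ℕ, m ≠ 0 → c ≠ 0 → ‖u m c‖ ≤ C * (m * c : ℝ) ^ B) (hv : RapidDecay v)
    {X : ℕ+ → ℂ} {S : ℂ}
    (hX : ∀ m : ℕ+, HasSum (fun c : ℕ+ => u m c * v (t * (m * c))) (X m))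
    (hS : HasSum (fun n : ℕ => divSum t u n * v n) S) : HasSum X S := by
  have hs := summable_pair ht hu hv
  refine hasSum_of_eq (hs.hasSum.prod_fiberwise hX) (fun _ => rfl) ?_
  have h1 := (sigmaAntidiagonalEquivProd.hasSum_iff).mpr hs.hasSum
  have h2 : HasSum (fun n : ℕ+ => divSum t u (t * n) * v (t * n)) _ := h1.sigma fun n => by
    refine hasSum_of_eq (hasSum_fintype _) (fun _ => rfl) ?_
    rw [divSum_mul ht, ← Nat.sum_divisorsAntidiagonal' (fun a b => u a b), Finset.sum_mul]
    rw [← Finset.sum_coe_sort]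
    refine Finset.sum_congr rfl fun x _ => ?_
    have hx := (Nat.mem_divisorsAntidiagonal.mp x.2).1
    change u x.1.1 x.1.2 * v (t * n) = u x.1.1 x.1.2 * v (t * (x.1.1 * x.1.2))
    rw [hx]
  have hinj : Function.Injective fun n : ℕ+ => t * (n : ℕ) := fun a b hab =>
    PNat.coe_injective (Nat.eq_of_mul_eq_mul_left ht hab)
  -- Indices that are not positive multiples of t contribute nothing; this includes 0, whose set of
  -- divisors is empty by convention.
  have h3 := (hinj.hasSum_iff (f := fun n : ℕ => divSum t u n * v n) (a := S) (fun n hn => by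
    rw [divSum]
    split_ifs with h
    · obtain ⟨n, rfl⟩ := h
      rcases Nat.eq_zero_or_pos n with rfl | hn0
      · simp
      · exact absurd ⟨⟨n, hn0⟩, rfl⟩ hn
    · rw [zero_mul])).mpr hS
  exact h3.unique h2

/-- The substitution u ↦ su in the integral. With s = mt, the factor s^{j+1} cancels the
(mt)^{-(j+1)} in front of each row, which is why the shadow coefficients carry no such power. -/
theorem bexp_scale (a s : ℝ) (hs : s ≠ 0) (j : ℕ) (y : ℝ) :
    bexp a j (s * y) = s ^ (j + 1) * bexp (s * a) j y := by
  rcases eq_or_ne a 0 with rfl | ha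
  · rw [mul_zero, bexp_zero_left, bexp_zero_left, mul_zero]
  induction j with
  | zero =>
    rw [bexp, bexp, show a * (s * y) = s * a * y by ring]
    field_simp
    simp
  | succ j ih =>
    rw [bexp, bexp, show a * (s * y) = s * a * y by ring, ih]
    field_simp
    ring

theorem bexp_nonneg {a y : ℝ} (ha : 0 < a) (hy : 0 < y) (j : ℕ) : 0 ≤ bexp a j y := by
  induction j with
  | zero => rw [bexp]; positivity
  | succ j ih => rw [bexp]; positivity

theorem bexp_le (j : ℕ) {y : ℝ} (hy : 0 < y) :
    ∃ K : ℝ, 0 ≤ K ∧ ∀ a : ℝ, 1 ≤ a → bexp a j y ≤ K * Real.exp (-(a * y)) := by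
  induction j with
  | zero =>
    refine ⟨1, zero_le_one, fun a ha => ?_⟩
    rw [bexp, one_mul]
    exact div_le_self (Real.exp_pos _).le ha
  | succ j ih =>
    obtain ⟨K, hK0, hK⟩ := ih
    refine ⟨y ^ (j + 1) + (j + 1) * K, by positivity, fun a ha => ?_⟩
    have h1 := hK a ha
    have h0 := bexp_nonneg (by linarith : 0 < a) hy j
    rw [bexp]
    refine (div_le_self (by positivity) ha).trans ?_
    have : ((j : ℝ) + 1) * bexp a j y ≤ (j + 1) * (K * Real.exp (-(a * y))) := by gcongr
    linarith

theorem rapidDecay_of_le {v : ℕ → ℂ} {y K : ℝ} (hy : 0 < y)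
    (h : ∀ n : ℕ, n ≠ 0 → ‖v n‖ ≤ K * Real.exp (-(2 * Real.pi * n * y))) : RapidDecay v := by
  intro B
  refine ⟨|K| * ((2 ^ B * (B + 2).factorial) * (y ^ (B + 2))⁻¹), fun n hn => ?_⟩
  have h1 := pow_mul_exp_neg_le B hn hy
  have hn1 : (1 : ℝ) ≤ n := by exact_mod_cast Nat.one_le_iff_ne_zero.mpr hn
  have h2 : Real.exp (-(2 * Real.pi * n * y)) ≤
      (2 ^ B * (B + 2).factorial) * (y ^ (B + 2))⁻¹ * ((n : ℝ) ^ B)⁻¹ := by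
    rw [← div_eq_mul_inv _ ((n : ℝ) ^ B), le_div_iff₀ (by positivity)]
    calc Real.exp (-(2 * Real.pi * n * y)) * (n : ℝ) ^ B
        ≤ (n + 1 : ℝ) ^ B * Real.exp (-(2 * Real.pi * n * y)) := by
          rw [mul_comm]
          gcongr
          linarith
      _ ≤ _ := h1
      _ ≤ (2 ^ B * (B + 2).factorial) * 1 * (y ^ (B + 2))⁻¹ := by
          gcongr
          exact inv_le_one_of_one_le₀ (one_le_pow₀ hn1)
      _ = _ := by ring
  calc ‖v n‖ ≤ K * Real.exp (-(2 * Real.pi * n * y)) := h n hn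
    _ ≤ |K| * ((2 ^ B * (B + 2).factorial) * (y ^ (B + 2))⁻¹ * ((n : ℝ) ^ B)⁻¹) := by
        gcongr
        exact le_abs_self K
    _ = _ := by ring

theorem rapidDecay_qexp {w : ℂ} (hw : 0 < w.im) :
    RapidDecay fun n => Complex.exp (2 * Real.pi * Complex.I * n * w) :=
  rapidDecay_of_le (K := 1) hw fun n _ => by rw [norm_qexp_nat, one_mul]

theorem rapidDecay_bexp (j : ℕ) {w : ℂ} (hw : 0 < w.im) :
    RapidDecay fun n => (bexp (4 * Real.pi * n) j w.im : ℂ) *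
      Complex.exp (2 * Real.pi * Complex.I * (-n : ℤ) * w) := by
  obtain ⟨K, _, hK⟩ := bexp_le j hw
  refine rapidDecay_of_le (K := K) hw fun n hn => ?_
  have hn1 : (1 : ℝ) ≤ n := by exact_mod_cast Nat.one_le_iff_ne_zero.mpr hn
  have hpi := Real.pi_gt_three
  have h1 : 1 ≤ 4 * Real.pi * n := by nlinarith
  have h2 := norm_qexp (-n : ℤ) w
  rw [norm_mul, Complex.norm_real, Real.norm_of_nonneg (bexp_nonneg (by linarith) hw j)]
  rw [Complex.ofReal_intCast] at h2
  rw [h2]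
  calc bexp (4 * Real.pi * n) j w.im * Real.exp (-(2 * Real.pi * ((-n : ℤ) : ℝ) * w.im))
      ≤ (K * Real.exp (-(4 * Real.pi * n * w.im))) *
        Real.exp (-(2 * Real.pi * ((-n : ℤ) : ℝ) * w.im)) := by
        gcongr
        exact hK _ h1
    _ = _ := by
        rw [mul_assoc, ← Real.exp_add]
        congr 2
        push_cast
        ring

theorem polyGrowth_divSum {u : ℕ → ℕ → ℂ} {t : ℕ} {C : ℝ} {B : ℕ}
    (hu : ∀ m c : ℕ, m ≠ 0 → c ≠ 0 → ‖u m c‖ ≤ C * (m * c : ℝ) ^ B) :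
    PolyGrowth (divSum t u) := by
  have hC : 0 ≤ C := by simpa using (norm_nonneg _).trans (hu 1 1 one_ne_zero one_ne_zero)
  refine ⟨C, B + 1, fun n => ?_⟩
  rw [divSum]
  split_ifs with h
  · refine (norm_sum_le _ _).trans ?_
    have hle : ((n / t : ℕ) : ℝ) ≤ n + 1 := by
      have : n / t ≤ n + 1 := (Nat.div_le_self n t).trans (Nat.le_succ n)
      exact_mod_cast this
    have hb : ∀ c ∈ (n / t).divisors, ‖u (n / t / c) c‖ ≤ C * (n + 1 : ℝ) ^ B := fun c hc => by
      have hc1 := (Nat.mem_divisors.mp hc).1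
      have hc0 := Nat.pos_of_mem_divisors hc
      have hne := (Nat.mem_divisors.mp hc).2
      refine (hu _ _ (Nat.div_pos (Nat.le_of_dvd (Nat.pos_of_ne_zero hne) hc1) hc0).ne'
        hc0.ne').trans ?_
      have : ((n / t / c : ℕ) : ℝ) * c = (n / t : ℕ) := by
        exact_mod_cast Nat.div_mul_cancel hc1
      rw [this]
      gcongr
    refine (Finset.sum_le_card_nsmul _ _ _ hb).trans ?_
    rw [nsmul_eq_mul, pow_succ]
    have hcard : (((n / t).divisors.card : ℕ) : ℝ) ≤ n + 1 :=
      le_trans (by exact_mod_cast Nat.card_divisors_le_self (n / t)) hle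
    calc (((n / t).divisors.card : ℕ) : ℝ) * (C * (n + 1 : ℝ) ^ B)
        ≤ (n + 1) * (C * (n + 1 : ℝ) ^ B) := by gcongr
      _ = _ := by ring
  · rw [norm_zero]
    positivity

/-! ### The Fourier expansion of the sum over positive rows -/

theorem hasSum_pnat {f : ℕ → ℂ} {S : ℂ} (h : HasSum f S) :
    HasSum (fun n : ℕ+ => f n) (S - f 0) := by
  have h1 : HasSum (fun n : ℕ => f (n + 1)) (S - f 0) := by
    rw [hasSum_nat_add_iff 1]
    simpa using h
  exact (Equiv.pnatEquivNat.symm.hasSum_iff (f := fun n : ℕ+ => f n)).mp h1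

theorem star_divSum (t : ℕ) (u : ℕ → ℕ → ℂ) (n : ℕ) :
    star (divSum t u n) = divSum t (fun m c => star (u m c)) n := by
  rw [divSum, divSum]
  split_ifs
  · rw [star_sum]
  · rw [star_zero]

section
variable {L M : ℕ}

/-- The terms of the divisor sums in the holomorphic part. -/
def holTerm (j t : ℕ) (ψ : DirichletCharacter ℂ L) (ϱ : DirichletCharacter ℂ M) (m c : ℕ) : ℂ :=
  star ψ (m : ZMod L) * (((m * t : ℕ) : ℂ) ^ (j + 1))⁻¹ * gaussC ϱ c

/-- The terms of the divisor sums in the non-holomorphic part. -/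
def nonholTerm (j : ℕ) (ψ : DirichletCharacter ℂ L) (ϱ : DirichletCharacter ℂ M) (m c : ℕ) : ℂ :=
  ψ (m : ZMod L) * (c : ℂ) ^ (j + 1) * gaussC (star ϱ) c

theorem norm_holTerm_le (j : ℕ) {t : ℕ} (ht : 0 < t) (ψ : DirichletCharacter ℂ L)
    (ϱ : DirichletCharacter ℂ M) (m c : ℕ) (hm : m ≠ 0) :
    ‖holTerm j t ψ ϱ m c‖ ≤ M * (m * c : ℝ) ^ 0 := by
  rw [holTerm, norm_mul, norm_mul, pow_zero, mul_one, norm_inv, norm_pow, Complex.norm_natCast]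
  have h1 : (1 : ℝ) ≤ (m * t : ℕ) := by
    exact_mod_cast Nat.one_le_iff_ne_zero.mpr (Nat.mul_ne_zero hm ht.ne')
  have h2 := inv_le_one_of_one_le₀ (one_le_pow₀ (n := j + 1) h1)
  have h3 := DirichletCharacter.norm_le_one (star ψ) (m : ZMod L)
  have h4 := norm_gaussC_le ϱ c
  calc _ ≤ 1 * 1 * (M : ℝ) := by gcongr
    _ = M := by ring

theorem norm_nonholTerm_le (j : ℕ) (ψ : DirichletCharacter ℂ L)
    (ϱ : DirichletCharacter ℂ M) (m c : ℕ) (hm : m ≠ 0) :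
    ‖nonholTerm j ψ ϱ m c‖ ≤ M * (m * c : ℝ) ^ (j + 1) := by
  rw [nonholTerm, norm_mul, norm_mul, norm_pow, Complex.norm_natCast]
  have h1 : (1 : ℝ) ≤ m := by exact_mod_cast Nat.one_le_iff_ne_zero.mpr hm
  have h3 := DirichletCharacter.norm_le_one ψ (m : ZMod L)
  have h4 := norm_gaussC_le (star ϱ) c
  calc _ ≤ 1 * (m * c : ℝ) ^ (j + 1) * (M : ℝ) := by
        gcongr
        exact le_mul_of_one_le_left (by positivity) h1
    _ = _ := by ring

/-- The constant term of each row is removed first: it does not decay exponentially in m, and for j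
= 0 its sum is only conditionally convergent. The remainder is absolutely summable over pairs (m,
c). -/
theorem hasSum_charSum (j : ℕ) {t : ℕ} (ht : 0 < t) (ψ : DirichletCharacter ℂ L)
    (ϱ : DirichletCharacter ℂ M) (z : ℍ) :
    HasSum (fun m : ℕ+ => star ψ ((m : ℕ) : ZMod L) * (((m * t : ℕ) : ℂ) ^ (j + 1))⁻¹ *
        (charSum j ϱ ((m * t : ℕ) * z) - Real.pi * ((-2 * Complex.I) ^ j)⁻¹ * gaussC ϱ 0))
      (Real.pi * ((-2 * Complex.I) ^ j)⁻¹ * qser (divSum t (holTerm j t ψ ϱ)) z +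
        4 * Real.pi ^ 2 * (2 * Real.pi * Complex.I) ^ j / j.factorial *
          nonhol j (divSum t (nonholTerm j ψ ϱ)) z) := by
  have him : ∀ m : ℕ+, (((m * t : ℕ) : ℂ) * z).im = (m * t : ℕ) * z.im := fun m => by
    rw [Complex.mul_im, Complex.natCast_re, Complex.natCast_im, zero_mul, add_zero, coe_im]
  have hpos : ∀ m : ℕ+, 0 < (((m * t : ℕ) : ℂ) * z).im := fun m => by
    rw [him]
    have := m.pos
    have := z.im_pos
    positivity
  have hne : ∀ m : ℕ+, ((m * t : ℕ) : ℝ) ≠ 0 := fun m => by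
    exact_mod_cast (Nat.mul_pos m.pos ht).ne'
  have h1 : HasSum (fun m : ℕ+ => star ψ ((m : ℕ) : ZMod L) * (((m * t : ℕ) : ℂ) ^ (j + 1))⁻¹ *
      (qser (fun c => gaussC ϱ c) ((m * t : ℕ) * z) - gaussC ϱ 0))
      (qser (divSum t (holTerm j t ψ ϱ)) z) := by
    have hu : ∀ m c : ℕ, m ≠ 0 → c ≠ 0 → ‖holTerm j t ψ ϱ m c‖ ≤ M * (m * c : ℝ) ^ 0 :=
      fun m c hm _ => norm_holTerm_le j ht ψ ϱ m c hm
    refine hasSum_divSum ht hu (rapidDecay_qexp z.im_pos) (fun m => ?_)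
      ((polyGrowth_divSum hu).hasSum z.im_pos)
    refine hasSum_of_eq ((hasSum_pnat ((polyGrowth_gaussC ϱ).hasSum (hpos m))).mul_left
      (star ψ ((m : ℕ) : ZMod L) * (((m * t : ℕ) : ℂ) ^ (j + 1))⁻¹)) (fun c => ?_) (by simp)
    have e : (2 * Real.pi * Complex.I * (t * (m * c) : ℕ) * z : ℂ) =
        2 * Real.pi * Complex.I * c * (((m * t : ℕ) : ℂ) * z) := by
      push_cast
      ring
    rw [holTerm, e]
    ring
  have h2 : HasSum (fun m : ℕ+ => star ψ ((m : ℕ) : ZMod L) * (((m * t : ℕ) : ℂ) ^ (j + 1))⁻¹ *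
      nonhol j (fun c => (c : ℂ) ^ (j + 1) * gaussC (star ϱ) c) ((m * t : ℕ) * z))
      (nonhol j (divSum t (nonholTerm j ψ ϱ)) z) := by
    have hu : ∀ m c : ℕ, m ≠ 0 → c ≠ 0 → ‖nonholTerm j ψ ϱ m c‖ ≤ M * (m * c : ℝ) ^ (j + 1) :=
      fun m c hm _ => norm_nonholTerm_le j ψ ϱ m c hm
    have hu' : ∀ m c : ℕ, m ≠ 0 → c ≠ 0 →
        ‖star (nonholTerm j ψ ϱ m c)‖ ≤ M * (m * c : ℝ) ^ (j + 1) :=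
      fun m c hm hc => (norm_star _).trans_le (hu m c hm hc)
    refine hasSum_divSum ht hu' (rapidDecay_bexp j z.im_pos) (fun m => ?_)
      (hasSum_of_eq (hasSum_nonhol j (polyGrowth_divSum (t := t) hu) z.im_pos)
        (fun n => by rw [← star_divSum, ← mul_assoc]) rfl)
    have hpg : PolyGrowth fun c : ℕ => (c : ℂ) ^ (j + 1) * gaussC (star ϱ) c :=
      (polyGrowth_natCast.pow (j + 1)).mul (polyGrowth_gaussC (star ϱ))
    refine hasSum_of_eq ((hasSum_pnat (hasSum_nonhol j hpg (hpos m))).mul_left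
      (star ψ ((m : ℕ) : ZMod L) * (((m * t : ℕ) : ℂ) ^ (j + 1))⁻¹)) (fun c => ?_) (by simp)
    rw [him, bexp_scale _ _ (hne m), nonholTerm, star_mul', star_mul', star_mul',
      ← MulChar.star_apply]
    have hmt : ((m * t : ℕ) : ℂ) ≠ 0 := by exact_mod_cast hne m
    have e1 : ((m * t : ℕ) : ℝ) * (4 * Real.pi * c) = 4 * Real.pi * (t * (m * c) : ℕ) := by
      push_cast
      ring
    have e2 : (2 * Real.pi * Complex.I * (-c : ℤ) * (((m * t : ℕ) : ℂ) * z) : ℂ) =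
        2 * Real.pi * Complex.I * (-(t * (m * c) : ℕ) : ℤ) * z := by
      push_cast
      ring
    rw [e1, e2, coe_im]
    have h4 := inv_mul_cancel₀ (pow_ne_zero (j + 1) hmt)
    generalize (bexp (4 * Real.pi * (t * (m * c) : ℕ)) j z.im) = b
    generalize Complex.exp _ = e
    rw [Complex.ofReal_mul, Complex.ofReal_pow, Complex.ofReal_natCast]
    linear_combination (-(star ψ) ((m : ℕ) : ZMod L) * star ((c : ℂ) ^ (j + 1)) *
      star (gaussC (star ϱ) c) * b * e) * h4
  refine hasSum_of_eq ((h1.mul_left (Real.pi * ((-2 * Complex.I) ^ j)⁻¹)).add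
    (h2.mul_left (4 * Real.pi ^ 2 * (2 * Real.pi * Complex.I) ^ j / j.factorial)))
    (fun m => ?_) rfl
  rw [charSum]
  ring

/-- With n = tmc, the factor (mt)^{-(j+1)} is n^{-(j+1)} c^{j+1}; this is the source of both n^{1-k}
and the power c^{k-1} inside the divisor sum. -/
theorem divSum_holTerm [NeZero M] (j : ℕ) {t : ℕ} (ht : 0 < t) (ψ : DirichletCharacter ℂ L)
    (ϱ : DirichletCharacter ℂ M) (n : ℕ) :
    divSum t (holTerm j t ψ ϱ) n = gaussW ϱ * ((n : ℂ) ^ (j + 1))⁻¹ *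
      (if t ∣ n then sigma (j + 2) (star ψ) (star ϱ) (n / t) else 0) := by
  rw [divSum]
  split_ifs with h
  · obtain ⟨n, rfl⟩ := h
    rw [Nat.mul_div_cancel_left _ ht, sigma, Finset.mul_sum]
    refine Finset.sum_congr rfl fun c hc => ?_
    obtain ⟨hc1, hc2⟩ := Nat.mem_divisors.mp hc
    obtain ⟨m, rfl⟩ := hc1
    have hc0 : c ≠ 0 := fun h => hc2 (by rw [h, zero_mul])
    have hcC : (c : ℂ) ≠ 0 := by exact_mod_cast hc0
    have hG := gaussC_eq ϱ c
    rw [Nat.mul_div_cancel_left _ (Nat.pos_of_ne_zero hc0), holTerm, hG, gaussFactor]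
    push_cast
    simp only [mul_pow, mul_inv]
    field_simp
  · rw [mul_zero]

theorem divSum_nonholTerm [NeZero M] (j : ℕ) {t : ℕ} (ψ : DirichletCharacter ℂ L)
    (ϱ : DirichletCharacter ℂ M) (n : ℕ) :
    divSum t (nonholTerm j ψ ϱ) n = gaussW (star ϱ) *
      (if t ∣ n then sigma (j + 2) ψ ϱ (n / t) else 0) := by
  rw [divSum]
  split_ifs with h
  · rw [sigma, Finset.mul_sum]
    refine Finset.sum_congr rfl fun c hc => ?_
    have hG := gaussC_eq (star ϱ) c
    rw [star_star] at hG
    rw [nonholTerm, hG, gaussFactor]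
    rw [show j + 2 - 1 = j + 1 from rfl]
    ring
  · rw [mul_zero]

end

/-! ### Summation by blocks and the zero mode -/

theorem hasSum_block {L : ℕ} [NeZero L] {f : ℤ → ℂ} {S : ℂ} (h : HasSum f S) :
    HasSum (fun p : ℤ => ∑ a : Fin L, f (p * L + (a : ℕ))) S :=
  ((Int.divModEquiv L).symm.hasSum_iff.mpr h).prod_fiberwise fun _ => hasSum_fintype _

theorem hasSum_block_nat {L : ℕ} [NeZero L] {f : ℕ → ℂ} {S : ℂ} (h : HasSum f S) :
    HasSum (fun p : ℕ => ∑ a : Fin L, f (p * L + a)) S :=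
  ((Nat.divModEquiv L).symm.hasSum_iff.mpr h).prod_fiberwise fun _ => hasSum_fintype _

theorem abs_rpow_neg_sub_le {r m x y : ℝ} (hr : 0 ≤ r) (hm : 0 < m) (hx : m ≤ x) (hy : m ≤ y) :
    |y ^ (-r) - x ^ (-r)| ≤ r * m ^ (-r - 1) * |y - x| := by
  refine Convex.norm_image_sub_le_of_norm_hasDerivWithin_le (𝕜 := ℝ) (s := Set.Ici m)
    (f := fun x : ℝ => x ^ (-r)) (f' := fun x => -r * x ^ (-r - 1)) (fun u hu => ?_)
    (fun u hu => ?_) (convex_Ici m) hx hy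
  · exact (Real.hasDerivAt_rpow_const (Or.inl (hm.trans_le hu).ne')).hasDerivWithinAt
  · have hu' : m ≤ u := hu
    rw [norm_mul, norm_neg, Real.norm_of_nonneg hr,
      Real.norm_of_nonneg (Real.rpow_nonneg (hm.le.trans hu') _)]
    gcongr ?_ * ?_
    exact Real.rpow_le_rpow_of_nonpos hm hu' (by linarith)

/-- As the weights sum to zero, a constant may be subtracted from h. Only indices of nonzero weight
need an estimate, which later keeps the singular lattice point out of the argument. -/
theorem norm_sum_mul_le_of_sum_eq_zero {ι : Type*} (s : Finset ι) {f h : ι → ℂ} (h₀ : ℂ) {K : ℝ}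
    (hf : ∑ a ∈ s, f a = 0) (hf1 : ∀ a ∈ s, ‖f a‖ ≤ 1)
    (hK : ∀ a ∈ s, f a ≠ 0 → ‖h a - h₀‖ ≤ K) (hK0 : 0 ≤ K) :
    ‖∑ a ∈ s, f a * h a‖ ≤ s.card * K := by
  have e : ∑ a ∈ s, f a * h a = ∑ a ∈ s, f a * (h a - h₀) := by
    simp only [mul_sub, Finset.sum_sub_distrib, ← Finset.sum_mul, hf, zero_mul, sub_zero]
  rw [e, ← nsmul_eq_mul]
  refine (norm_sum_le _ _).trans (Finset.sum_le_card_nsmul _ _ _ fun a ha => ?_)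
  rw [norm_mul]
  by_cases h0 : f a = 0
  · rw [h0, norm_zero, zero_mul]
    exact hK0
  · exact (mul_le_of_le_one_left (norm_nonneg _) (hf1 a ha)).trans (hK a ha h0)

theorem sum_fin_char_eq_zero {L : ℕ} [NeZero L] {ψ : DirichletCharacter ℂ L} (hψ : ψ ≠ 1) :
    ∑ a : Fin L, ψ ((a : ℕ) : ZMod L) = 0 := by
  rw [Fin.sum_univ_eq_sum_range fun a => ψ (a : ZMod L), ← sum_zmod_eq_sum_range fun a => ψ a]
  exact MulChar.sum_eq_zero_of_ne_one hψ

theorem char_zero_of_ne_one {L : ℕ} {ψ : DirichletCharacter ℂ L} (hψ : ψ ≠ 1) :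
    ψ 0 = 0 := by
  refine ψ.map_nonunit fun h => hψ ?_
  have : Subsingleton (ZMod L) := isUnit_zero_iff.mp h |> subsingleton_of_zero_eq_one
  ext a
  rw [Subsingleton.elim a 1]
  simp

/-! ### L-values as sums over blocks of residues -/

theorem hasSum_LFunction {L : ℕ} [NeZero L] (ψ : DirichletCharacter ℂ L) {r : ℝ} (hr : 1 < r) :
    HasSum (fun n : ℕ => ψ (n : ZMod L) * (((n : ℝ) ^ (-r) : ℝ) : ℂ))
      (DirichletCharacter.LFunction ψ r) := by
  have hr' : 1 < (r : ℂ).re := by simpa using hr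
  rw [DirichletCharacter.LFunction_eq_LSeries ψ hr']
  refine hasSum_of_eq (ψ.LSeriesSummable_of_one_lt_re hr').LSeriesHasSum (fun n => ?_) rfl
  rw [LSeries.term_def]
  split_ifs with h
  · rw [h, Nat.cast_zero, Nat.cast_zero, Real.zero_rpow (by linarith), Complex.ofReal_zero,
      mul_zero]
  · rw [Real.rpow_neg (Nat.cast_nonneg n), Complex.ofReal_inv, Complex.ofReal_cpow
      (Nat.cast_nonneg n), Complex.ofReal_natCast, div_eq_mul_inv]

/-- Over a full block of residues the nontrivial character cancels, so each block is O(p⁻²)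
uniformly in the exponent 1 + s for 0 ≤ s ≤ 1. Dominated convergence as s → 0⁺ and continuity of the
L-function identify the block sum at 1. -/
theorem hasSum_LFunction_one {L : ℕ} [NeZero L] {ψ : DirichletCharacter ℂ L} (hψ : ψ ≠ 1) :
    HasSum (fun p : ℕ => ∑ a : Fin L, ψ ((a : ℕ) : ZMod L) * (((p * L + a : ℕ) : ℂ))⁻¹)
      (DirichletCharacter.LFunction ψ 1) := by
  set f : ℝ → ℕ → ℂ := fun s p => ∑ a : Fin L, ψ ((a : ℕ) : ZMod L) *
    ((((p * L + a : ℕ) : ℝ) ^ (-(1 + s)) : ℝ) : ℂ) with hf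
  have hsum : ∀ s : ℝ, 0 < s → HasSum (f s) (DirichletCharacter.LFunction ψ (1 + s : ℝ)) :=
    fun s hs => by
      refine hasSum_of_eq (hasSum_block_nat (L := L)
        (hasSum_LFunction ψ (by linarith : 1 < 1 + s))) (fun p => ?_) rfl
      simp [hf]
  have hL1 : (1 : ℝ) ≤ L := by exact_mod_cast NeZero.one_le
  -- The comparison point pL + 1/2 is at least (p + 1)/2, as are all points of nonzero weight. The
  -- constant 16 is 2 · 2³, from 1 + s ≤ 2 and from the powers of 1/2 with s ≤ 1.
  have hbound : ∀ s ∈ Set.Icc (0 : ℝ) 1, ∀ p : ℕ,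
      ‖f s p‖ ≤ L * (16 * L * (((p + 1 : ℕ) : ℝ) ^ 2)⁻¹) := by
    intro s hs p
    have h := norm_sum_mul_le_of_sum_eq_zero (Finset.univ : Finset (Fin L))
      (f := fun a => ψ ((a : ℕ) : ZMod L))
      (h := fun a => ((((p * L + a : ℕ) : ℝ) ^ (-(1 + s)) : ℝ) : ℂ))
      ((((p * L + 1 / 2) : ℝ) ^ (-(1 + s)) : ℝ) : ℂ) (K := 16 * L * (((p + 1 : ℕ) : ℝ) ^ 2)⁻¹)
      (sum_fin_char_eq_zero hψ) (fun a _ => ψ.norm_le_one _) (fun a _ ha => ?_) (by positivity)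
    · rwa [Finset.card_univ, Fintype.card_fin] at h
    · rw [← Complex.ofReal_sub, Complex.norm_real, Real.norm_eq_abs]
      have ha0 : (a : ℕ) ≠ 0 := fun h => ha (by rw [h, Nat.cast_zero, char_zero_of_ne_one hψ])
      have ha1 : (1 : ℝ) ≤ (a : ℕ) := by exact_mod_cast Nat.one_le_iff_ne_zero.mpr ha0
      have haL : ((a : ℕ) : ℝ) ≤ L := by exact_mod_cast a.2.le
      have hp : (0 : ℝ) ≤ p := p.cast_nonneg
      have hm : (0 : ℝ) < (p + 1) / 2 := by positivity
      have hpL : (p : ℝ) ≤ p * L := le_mul_of_one_le_right hp hL1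
      have h1 : ((p : ℝ) + 1) / 2 ≤ p * L + 1 / 2 := by linarith
      have h2 : ((p : ℝ) + 1) / 2 ≤ ((p * L + a : ℕ) : ℝ) := by
        push_cast
        linarith
      refine (abs_rpow_neg_sub_le (by linarith [hs.1]) hm h1 h2).trans ?_
      have h3 : |((p * L + a : ℕ) : ℝ) - (p * L + 1 / 2)| ≤ L := by
        push_cast
        rw [abs_le]
        constructor <;> linarith
      have h4 : (((p : ℝ) + 1) / 2) ^ (-(1 + s) - 1) ≤ 8 * (((p + 1 : ℕ) : ℝ) ^ 2)⁻¹ := by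
        rw [Real.div_rpow (by positivity) (by norm_num), div_eq_mul_inv, mul_comm, ← Real.rpow_neg
          (by norm_num)]
        gcongr
        · calc (2 : ℝ) ^ (-(-(1 + s) - 1)) ≤ 2 ^ (3 : ℝ) :=
                Real.rpow_le_rpow_of_exponent_le (by norm_num) (by linarith [hs.2])
            _ = 8 := by norm_num
        · calc ((p : ℝ) + 1) ^ (-(1 + s) - 1) ≤ ((p : ℝ) + 1) ^ (-2 : ℝ) :=
                Real.rpow_le_rpow_of_exponent_le (by linarith) (by linarith [hs.1])
            _ = _ := by
                rw [Real.rpow_neg (by positivity)]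
                norm_num
      calc (1 + s) * (((p : ℝ) + 1) / 2) ^ (-(1 + s) - 1) * |((p * L + a : ℕ) : ℝ) - (p * L + 1 / 2)|
          ≤ 2 * (8 * (((p + 1 : ℕ) : ℝ) ^ 2)⁻¹) * L := by
            gcongr
            linarith [hs.2]
        _ = _ := by ring
  have hsb : Summable fun p : ℕ => (L : ℝ) * (16 * L * (((p + 1 : ℕ) : ℝ) ^ 2)⁻¹) :=
    (((summable_nat_add_iff 1).mpr (Real.summable_nat_pow_inv.mpr one_lt_two)).mul_left _).mul_left _
  have hlim : ∀ p, Filter.Tendsto (fun s => f s p) (nhdsWithin 0 (Set.Ioi 0)) (nhds (f 0 p)) := by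
    intro p
    refine tendsto_finsetSum _ fun a _ => ?_
    by_cases ha0 : (a : ℕ) = 0
    · simp [ha0, char_zero_of_ne_one hψ]
    refine Filter.Tendsto.const_mul _ ?_
    refine (Complex.continuous_ofReal.tendsto _).comp ?_
    have hne : ((p * L + a : ℕ) : ℝ) ≠ 0 := by
      exact_mod_cast (by omega : p * L + (a : ℕ) ≠ 0)
    have : Continuous fun s : ℝ => ((p * L + a : ℕ) : ℝ) ^ (-(1 + s)) :=
      Continuous.rpow continuous_const (by fun_prop) fun _ => Or.inl hne
    exact this.continuousAt.tendsto.mono_left nhdsWithin_le_nhds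
  have hmem : Set.Ioc (0 : ℝ) 1 ∈ nhdsWithin (0 : ℝ) (Set.Ioi 0) := Ioc_mem_nhdsGT one_pos
  have htend := tendsto_tsum_of_dominated_convergence hsb hlim (by
    filter_upwards [hmem] with s hs p using hbound s ⟨hs.1.le, hs.2⟩ p)
  have htend2 : Filter.Tendsto (fun s : ℝ => ∑' p, f s p) (nhdsWithin 0 (Set.Ioi 0))
      (nhds (DirichletCharacter.LFunction ψ 1)) := by
    have hc : Continuous fun s : ℝ => DirichletCharacter.LFunction ψ (1 + s : ℝ) :=
      (DirichletCharacter.differentiable_LFunction hψ).continuous.comp (by fun_prop)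
    have h0 := (hc.tendsto 0).mono_left (nhdsWithin_le_nhds (s := Set.Ioi 0))
    rw [add_zero, Complex.ofReal_one] at h0
    refine h0.congr' ?_
    filter_upwards [self_mem_nhdsWithin] with s hs using (hsum s hs).tsum_eq.symm
  have hs0 : Summable (f 0) := Summable.of_norm_bounded hsb (hbound 0 (by simp))
  refine hasSum_of_eq hs0.hasSum (fun p => ?_) (tendsto_nhds_unique htend2 htend)
  simp only [hf]
  refine Finset.sum_congr rfl fun a _ => ?_
  rw [add_zero, Real.rpow_neg_one]
  push_cast
  rfl

theorem hasSum_even {f : ℕ → ℂ} {S : ℂ} (h : HasSum f S) :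
    HasSum (fun m : ℤ => f m.natAbs) (2 * S - f 0) := by
  have h1 : HasSum (fun n : ℕ => f ((n : ℤ)).natAbs) S := by simpa using h
  have h2 : HasSum (fun n : ℕ => f (-(n : ℤ)).natAbs) S := by simpa using h
  refine hasSum_of_eq (HasSum.of_nat_of_neg (f := fun m : ℤ => f m.natAbs) h1 h2)
    (fun _ => rfl) ?_
  simp
  ring

/-- For j ≥ 1 the sum over all integers is absolutely convergent and even. For j = 0 only the
grouping by blocks converges, so the negative blocks are matched with the positive ones by hand. -/
theorem hasSum_zeroMode {L : ℕ} [NeZero L] (j : ℕ) {ψ : DirichletCharacter ℂ L}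
    (h : 1 ≤ j ∨ ψ ≠ 1) :
    HasSum (fun p : ℤ => ∑ a : Fin L, ψ ((p * L + (a : ℕ)).natAbs : ZMod L) *
      ((((p * L + (a : ℕ)).natAbs : ℂ)) ^ (j + 1))⁻¹)
      (2 * DirichletCharacter.LFunction ψ (j + 1)) := by
  by_cases hj : 1 ≤ j
  · have hj' : (1 : ℝ) < (j + 1 : ℕ) := by exact_mod_cast Nat.lt_succ_of_le hj
    have h1 : HasSum (fun n : ℕ => ψ (n : ZMod L) * ((n : ℂ) ^ (j + 1))⁻¹)
        (DirichletCharacter.LFunction ψ (j + 1)) := by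
      refine hasSum_of_eq (hasSum_LFunction ψ hj') (fun n => ?_) (by push_cast; rfl)
      rw [Real.rpow_neg n.cast_nonneg, Real.rpow_natCast]
      push_cast
      rfl
    refine hasSum_of_eq (hasSum_block (L := L) (hasSum_even h1)) (fun p => rfl) ?_
    simp
  · have hψ : ψ ≠ 1 := h.resolve_left hj
    obtain rfl : j = 0 := by omega
    have h1 := hasSum_LFunction_one hψ
    simp only [zero_add, pow_one, Nat.cast_zero]
    rw [two_mul]
    have hL : 0 < L := Nat.pos_of_ne_zero (NeZero.ne L)
    refine HasSum.of_nat_of_neg_add_one (hasSum_of_eq h1 (fun p => ?_) rfl)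
      (hasSum_of_eq h1 (fun p => ?_) rfl)
    · refine Finset.sum_congr rfl fun a _ => ?_
      have e : ((p : ℤ) * L + (a : ℕ)).natAbs = p * L + a := by
        rw [← Nat.cast_mul, ← Nat.cast_add, Int.natAbs_natCast]
      rw [e]
      simp
    · rw [Fin.sum_univ_eq_sum_range fun a => ψ (a : ZMod L) * (((p * L + a : ℕ) : ℂ))⁻¹,
        Fin.sum_univ_eq_sum_range fun a => ψ (((-((p : ℤ) + 1) * L + a).natAbs : ℕ) : ZMod L) *
          (((-((p : ℤ) + 1) * L + a).natAbs : ℕ) : ℂ)⁻¹]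
      obtain ⟨K, rfl⟩ : ∃ K, L = K + 1 := ⟨L - 1, by omega⟩
      -- The absolute values in block -(p + 1) are pL + 1, …, pL + L in reverse order. The endpoint
      -- (p + 1)L replaces pL, and the character kills both.
      rw [Finset.sum_range_succ', Finset.sum_range_succ', ← Finset.sum_range_reflect]
      have e0 : (-((p : ℤ) + 1) * (K + 1 : ℕ) + (0 : ℕ)).natAbs = (p + 1) * (K + 1) := by
        rw [Nat.cast_zero, add_zero, neg_mul, Int.natAbs_neg]
        exact_mod_cast Int.natAbs_natCast ((p + 1) * (K + 1))
      rw [e0, Nat.cast_mul (p + 1) (K + 1), ZMod.natCast_self, mul_zero, Nat.cast_zero,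
        char_zero_of_ne_one hψ, zero_mul, zero_mul]
      congr 1
      refine Finset.sum_congr rfl fun b hb => ?_
      have hb' := Finset.mem_range.mp hb
      have e1 : (-((p : ℤ) + 1) * (K + 1 : ℕ) + (K - 1 - b + 1 : ℕ)).natAbs =
          p * (K + 1) + (b + 1) := by
        have : (-((p : ℤ) + 1) * (K + 1 : ℕ) + (K - 1 - b + 1 : ℕ)) =
            -((p * (K + 1) + (b + 1) : ℕ) : ℤ) := by
          have hKb : ((K - 1 - b + 1 : ℕ) : ℤ) = K - b := by omega
          rw [hKb]
          push_cast
          ring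
        rw [this, Int.natAbs_neg, Int.natAbs_natCast]
      rw [e1]
      simp

/-! ### Evaluation of the lattice sum -/

section
variable {L M : ℕ}

theorem phi_neg (j : ℕ) (w : ℂ) : phi j (-w) = (-1) ^ j * phi j w := by
  have h := phi_real_mul j (-1) w
  have h1 : (((-1 : ℝ) : ℂ) ^ (j + 2))⁻¹ = (-1) ^ j := by
    rw [Complex.ofReal_neg, Complex.ofReal_one, ← inv_pow, pow_add]
    norm_num
  rw [h1] at h
  simpa using h

/-- The general term of the lattice sum. -/
def latTerm (j Q : ℕ) (ψ : DirichletCharacter ℂ L) (ϱ : DirichletCharacter ℂ M) (z : ℍ)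
    (m n : ℤ) : ℂ :=
  star ψ (m : ZMod L) * ϱ (n : ZMod M) * phi j (m * Q * z + n)

/-- This is where parity enters: without it the terms at (m, n) and (-m, -n) would cancel. It makes
rows m and -m equal, which gives the factor 2 in the final value. -/
theorem latTerm_neg_neg (j Q : ℕ) {ψ : DirichletCharacter ℂ L} {ϱ : DirichletCharacter ℂ M}
    (hparity : ψ (-1) * ϱ (-1) = (-1) ^ j) (z : ℍ) (m n : ℤ) :
    latTerm j Q ψ ϱ z (-m) (-n) = latTerm j Q ψ ϱ z m n := by
  have h1 : star ψ (-1) = ψ (-1) := by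
    rw [MulChar.star_apply]
    rcases ψ.even_or_odd with h | h
    · rw [h]; simp
    · rw [h]; simp
  have e1 : star ψ ((-m : ℤ) : ZMod L) = ψ (-1) * star ψ (m : ZMod L) := by
    rw [← h1, ← map_mul, Int.cast_neg, neg_one_mul]
  have e2 : ϱ ((-n : ℤ) : ZMod M) = ϱ (-1) * ϱ (n : ZMod M) := by
    rw [← map_mul, Int.cast_neg, neg_one_mul]
  have e3 : (((-m : ℤ) : ℂ) * Q * z + ((-n : ℤ) : ℂ)) = -(m * Q * z + n) := by
    push_cast
    ring
  rw [latTerm, latTerm, e1, e2, e3, phi_neg]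
  have h2 : ((-1 : ℂ) ^ j) * (-1) ^ j = 1 := by
    rw [← mul_pow]
    norm_num
  linear_combination (star ψ (m : ZMod L) * ϱ (n : ZMod M) * phi j (m * Q * z + n)) *
    ((-1) ^ j * hparity + h2)

/-- The sums of the rows of the lattice sum. -/
def rowSum (j t : ℕ) [NeZero M] (ψ : DirichletCharacter ℂ L) (ϱ : DirichletCharacter ℂ M) (z : ℍ)
    (m : ℕ) : ℂ :=
  if m = 0 then star ψ 0 * (2 * DirichletCharacter.LFunction ϱ (j + 2)) else
    star ψ (m : ZMod L) * ((M : ℂ) ^ (j + 2) * (((m * t : ℕ) : ℂ) * z.im) ^ (j + 1))⁻¹ *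
      charSum j ϱ ((m * t : ℕ) * z)

theorem hasSum_latTerm_row [NeZero M] (j : ℕ) {t : ℕ} (ht : 0 < t) {ψ : DirichletCharacter ℂ L}
    {ϱ : DirichletCharacter ℂ M} (hparity : ψ (-1) * ϱ (-1) = (-1) ^ j) (z : ℍ) (m : ℕ) :
    HasSum (fun n : ℤ => latTerm j (t * M) ψ ϱ z m n) (rowSum j t ψ ϱ z m) := by
  have hM : (M : ℂ) ≠ 0 := by exact_mod_cast NeZero.ne M
  rw [rowSum]
  split_ifs with hm
  · subst hm
    have hj : (1 : ℝ) < (j + 2 : ℕ) := by exact_mod_cast (by omega : 1 < j + 2)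
    have h1 : HasSum (fun n : ℕ => latTerm j (t * M) ψ ϱ z 0 n)
        (star ψ 0 * DirichletCharacter.LFunction ϱ (j + 2)) := by
      refine hasSum_of_eq ((hasSum_LFunction ϱ hj).mul_left (star ψ 0)) (fun n => ?_)
        (by push_cast; rfl)
      rw [latTerm, phi, Real.rpow_neg n.cast_nonneg, Real.rpow_natCast]
      simp only [Int.cast_zero, zero_mul, zero_add, Int.cast_natCast, map_natCast]
      push_cast
      rw [pow_succ (n : ℂ) (j + 1), mul_inv]
      ring
    refine hasSum_of_eq (hasSum_even h1) (fun n => ?_) ?_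
    · rcases Int.natAbs_eq n with h | h
      · rw [Nat.cast_zero]
        conv_lhs => rw [h]
      · rw [Nat.cast_zero, ← latTerm_neg_neg j _ hparity z 0 (n.natAbs : ℤ)]
        conv_lhs => rw [h]
        rw [neg_zero]
    · simp [latTerm, phi]
      ring
  · have him : 0 < (((m * t : ℕ) : ℂ) * z).im := by
      rw [Complex.mul_im, Complex.natCast_re, Complex.natCast_im, zero_mul, add_zero, coe_im]
      have := z.im_pos
      have : 0 < m * t := Nat.mul_pos (Nat.pos_of_ne_zero hm) ht
      positivity
    have h1 := (hasSum_char_mul_phi j ϱ ⟨_, him⟩).mul_left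
      (star ψ (m : ZMod L) * ((M : ℂ) ^ (j + 2) * (((m * t : ℕ) : ℂ) * z.im) ^ (j + 1))⁻¹)
    refine hasSum_of_eq h1 (fun n => ?_) rfl
    have e1 : (((⟨_, him⟩ : ℍ).im : ℝ) : ℂ) = ((m * t : ℕ) : ℂ) * z.im := by
      change (((((m * t : ℕ) : ℂ) * z).im : ℝ) : ℂ) = _
      rw [Complex.mul_im, Complex.natCast_re, Complex.natCast_im, zero_mul, add_zero, coe_im]
      push_cast
      rfl
    have e2 : ((m : ℤ) : ℂ) * (t * M : ℕ) * z + n = M * (((m * t : ℕ) : ℂ) * z) + n := by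
      push_cast
      ring
    have hz : (z.im : ℂ) ≠ 0 := by exact_mod_cast z.im_pos.ne'
    have hmt : ((m * t : ℕ) : ℂ) ≠ 0 := by
      exact_mod_cast (Nat.mul_pos (Nat.pos_of_ne_zero hm) ht).ne'
    rw [latTerm, e1, e2, Int.cast_natCast]
    change _ = _ * (_ * (_ * phi j (M * (((m * t : ℕ) : ℂ) * z) + n)))
    have hne : ((M : ℂ) ^ (j + 2) * (((m * t : ℕ) : ℂ) * z.im) ^ (j + 1)) ≠ 0 := by
      exact mul_ne_zero (pow_ne_zero _ hM) (pow_ne_zero _ (mul_ne_zero hmt hz))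
    have h4 := inv_mul_cancel₀ hne
    generalize phi j (M * (((m * t : ℕ) : ℂ) * z) + n) = P
    linear_combination (-(star ψ (m : ZMod L) * ϱ (n : ZMod M) * P)) * h4

theorem hasSum_latTerm_row_int [NeZero M] (j : ℕ) {t : ℕ} (ht : 0 < t)
    {ψ : DirichletCharacter ℂ L} {ϱ : DirichletCharacter ℂ M}
    (hparity : ψ (-1) * ϱ (-1) = (-1) ^ j) (z : ℍ) (m : ℤ) :
    HasSum (fun n : ℤ => latTerm j (t * M) ψ ϱ z m n) (rowSum j t ψ ϱ z m.natAbs) := by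
  have h := hasSum_latTerm_row j ht hparity z m.natAbs
  rcases Int.natAbs_eq m with hm | hm
  · rwa [← hm] at h
  · rw [← (Equiv.neg ℤ).hasSum_iff] at h
    refine hasSum_of_eq h (fun n => ?_) rfl
    rw [Function.comp_apply, Equiv.neg_apply, ← latTerm_neg_neg j _ hparity,
      show -m = (m.natAbs : ℤ) by omega]

/-- The value of `M^{j + 2} y^{j + 1}` times the lattice sum. -/
def latValue (j t : ℕ) [NeZero L] [NeZero M] (ψ : DirichletCharacter ℂ L)
    (ϱ : DirichletCharacter ℂ M) (z : ℍ) : ℂ :=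
  (M : ℂ) ^ (j + 2) * (z.im : ℂ) ^ (j + 1) *
      (star ψ 0 * (2 * DirichletCharacter.LFunction ϱ (j + 2))) +
    2 * (Real.pi * ((-2 * Complex.I) ^ j)⁻¹ * qser (divSum t (holTerm j t ψ ϱ)) z +
        4 * Real.pi ^ 2 * (2 * Real.pi * Complex.I) ^ j / j.factorial *
          nonhol j (divSum t (nonholTerm j ψ ϱ)) z) +
    2 * (Real.pi * ((-2 * Complex.I) ^ j)⁻¹ * gaussC ϱ 0 * ((t : ℂ) ^ (j + 1))⁻¹ *
      DirichletCharacter.LFunction (star ψ) (j + 1))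

/-- Summing the blocks over q for fixed p gives L complete rows. Each row splits into its constant
term, summed by `hasSum_zeroMode`, and a remainder, summed by `hasSum_charSum`. For j = 0 and ψ
trivial the hypothesis `hj` makes the constant terms vanish through `gaussC ϱ 0`. -/
theorem latValue_eq [NeZero L] [NeZero M] (j : ℕ) {t : ℕ} (ht : 0 < t)
    {ψ : DirichletCharacter ℂ L} {ϱ : DirichletCharacter ℂ M}
    (hparity : ψ (-1) * ϱ (-1) = (-1) ^ j) (hj : 1 ≤ j ∨ ψ ≠ 1 ∨ gaussC ϱ 0 = 0) (z : ℍ) {T : ℂ}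
    (hT : HasSum (fun x : ℤ × ℤ => ∑ a : Fin L, ∑ b : Fin M,
      latTerm j (t * M) ψ ϱ z (x.1 * L + (a : ℕ)) (x.2 * M + (b : ℕ))) T) :
    (M : ℂ) ^ (j + 2) * (z.im : ℂ) ^ (j + 1) * T = latValue j t ψ ϱ z := by
  have hrows : ∀ p : ℤ, HasSum (fun q : ℤ => ∑ a : Fin L, ∑ b : Fin M,
      latTerm j (t * M) ψ ϱ z (p * L + (a : ℕ)) (q * M + (b : ℕ)))
      (∑ a : Fin L, rowSum j t ψ ϱ z (p * L + (a : ℕ)).natAbs) := fun p =>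
    hasSum_sum fun a _ => hasSum_block (hasSum_latTerm_row_int j ht hparity z (p * L + (a : ℕ)))
  have h1 := (hT.prod_fiberwise hrows).mul_left ((M : ℂ) ^ (j + 2) * (z.im : ℂ) ^ (j + 1))
  set A : ℂ := Real.pi * ((-2 * Complex.I) ^ j)⁻¹ with hA
  set K : ℂ := (M : ℂ) ^ (j + 2) * (z.im : ℂ) ^ (j + 1) with hK
  have hz : (z.im : ℂ) ≠ 0 := by exact_mod_cast z.im_pos.ne'
  have hM : (M : ℂ) ≠ 0 := by exact_mod_cast NeZero.ne M
  set e : ℕ → ℂ := fun m => if m = 0 then K * rowSum j t ψ ϱ z 0 else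
    star ψ (m : ZMod L) * (((m * t : ℕ) : ℂ) ^ (j + 1))⁻¹ *
        (charSum j ϱ ((m * t : ℕ) * z) - A * gaussC ϱ 0) with he
  -- At m = 0 the added term is zero because the inverse of 0 is 0, so the decomposition holds for
  -- every row.
  have hrow : ∀ m : ℕ, K * rowSum j t ψ ϱ z m = e m + A * gaussC ϱ 0 * ((t : ℂ) ^ (j + 1))⁻¹ *
      (star ψ (m : ZMod L) * ((m : ℂ) ^ (j + 1))⁻¹) := fun m => by
    simp only [he]
    split_ifs with hm
    · subst hm
      simp
    · rw [rowSum, if_neg hm, hK]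
      push_cast
      simp only [mul_pow, mul_inv]
      field_simp
      ring
  have hS := hasSum_charSum j ht ψ ϱ z
  set S : ℂ := Real.pi * ((-2 * Complex.I) ^ j)⁻¹ * qser (divSum t (holTerm j t ψ ϱ)) z +
        4 * Real.pi ^ 2 * (2 * Real.pi * Complex.I) ^ j / j.factorial *
          nonhol j (divSum t (nonholTerm j ψ ϱ)) z with hSdef
  have he1 : HasSum e (S + e 0) := by
    have h2 : HasSum (fun n : ℕ => e (n + 1)) S :=
      (Equiv.pnatEquivNat.symm.hasSum_iff).mpr hS |> fun h => hasSum_of_eq h (fun n => by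
        simp only [he]
        rw [if_neg (Nat.succ_ne_zero n)]
        rfl) rfl
    have h3 := (hasSum_nat_add_iff 1).mp h2
    simpa using h3
  have he2 := hasSum_block (L := L) (hasSum_even he1)
  have hz2 : HasSum (fun p : ℤ => A * gaussC ϱ 0 * ((t : ℂ) ^ (j + 1))⁻¹ *
      ∑ a : Fin L, star ψ ((p * L + (a : ℕ)).natAbs : ZMod L) *
      ((((p * L + (a : ℕ)).natAbs : ℂ)) ^ (j + 1))⁻¹)
      (A * gaussC ϱ 0 * ((t : ℂ) ^ (j + 1))⁻¹ *
        (2 * DirichletCharacter.LFunction (star ψ) (j + 1))) := by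
    by_cases hg : gaussC ϱ 0 = 0
    · simp [hg]
    · refine (hasSum_zeroMode j ?_).mul_left _
      rcases hj with h | h | h
      · exact Or.inl h
      · exact Or.inr fun h' => h (by rw [← star_star ψ, h']; simp)
      · exact absurd h hg
  have h5 : K * T = _ := h1.unique (hasSum_of_eq (he2.add hz2) (fun p => by
    rw [Finset.mul_sum, Finset.mul_sum, ← Finset.sum_add_distrib]
    exact Finset.sum_congr rfl fun a _ => hrow _) rfl)
  have h6 : e 0 = K * (star ψ 0 * (2 * DirichletCharacter.LFunction ϱ (j + 2))) := by
    simp [he, rowSum]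
  rw [h5, latValue, h6]
  ring

end

/-! ### Convergence and modularity of the lattice sum -/

section
variable {L M : ℕ}

theorem norm_phi (j : ℕ) (w : ℂ) : ‖phi j w‖ = (‖w‖ ^ (j + 2))⁻¹ := by
  rw [phi, norm_mul, norm_inv, norm_inv, norm_pow, RCLike.norm_conj, pow_succ ‖w‖ (j + 1),
    mul_inv, mul_comm]

/-- The general term of the lattice sum with the convergence factor `|m Q z + n|^{-2 s}`. -/
def latTermS (j Q : ℕ) (s : ℝ) (ψ : DirichletCharacter ℂ L) (ϱ : DirichletCharacter ℂ M) (z : ℍ)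
    (x : ℤ × ℤ) : ℂ :=
  latTerm j Q ψ ϱ z x.1 x.2 * ((‖(x.1 * Q * z + x.2 : ℂ)‖ ^ (-(2 * s)) : ℝ) : ℂ)

theorem latTermS_zero (j Q : ℕ) (ψ : DirichletCharacter ℂ L) (ϱ : DirichletCharacter ℂ M) (z : ℍ)
    (x : ℤ × ℤ) : latTermS j Q 0 ψ ϱ z x = latTerm j Q ψ ϱ z x.1 x.2 := by
  simp [latTermS]

theorem im_natCast_mul {Q : ℕ} (hQ : 0 < Q) (z : ℍ) : 0 < ((Q : ℂ) * z).im := by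
  rw [Complex.mul_im, Complex.natCast_re, Complex.natCast_im, zero_mul, add_zero, coe_im]
  have := z.im_pos
  positivity

/-- The terms are O(|w|^{-(j+2+2s)}), and a planar lattice sum needs an exponent above 2; hence the
condition on j + 2s. -/
theorem summable_latTermS (j : ℕ) {Q : ℕ} (hQ : 0 < Q) {s : ℝ} (hs : 0 < j + 2 * s) (hs0 : 0 ≤ s)
    (ψ : DirichletCharacter ℂ L) (ϱ : DirichletCharacter ℂ M) (z : ℍ) :
    Summable (latTermS j Q s ψ ϱ z) := by
  rw [← (finTwoArrowEquiv ℤ).summable_iff]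
  set τ : ℍ := ⟨Q * z, im_natCast_mul hQ z⟩ with hτ
  refine Summable.of_norm_bounded ((EisensteinSeries.summable_one_div_norm_rpow
    (k := j + 2 + 2 * s) (by linarith)).mul_left (EisensteinSeries.r τ ^ (-(j + 2 + 2 * s))))
    fun x => ?_
  refine le_trans ?_ (EisensteinSeries.summand_bound τ (by positivity) x)
  have e : ((x 0 : ℂ) * τ + x 1) = x 0 * Q * z + x 1 := by
    rw [mul_assoc]
  rw [e]
  simp only [Function.comp_apply, latTermS, latTerm, finTwoArrowEquiv_apply]
  set w : ℂ := x 0 * Q * z + x 1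
  rw [norm_mul, norm_mul, norm_mul, norm_phi, Complex.norm_real,
    Real.norm_of_nonneg (by positivity)]
  have h1 := DirichletCharacter.norm_le_one (star ψ) (x 0 : ZMod L)
  have h2 := DirichletCharacter.norm_le_one ϱ (x 1 : ZMod M)
  have h3 : (‖w‖ ^ (j + 2))⁻¹ * ‖w‖ ^ (-(2 * s)) ≤ ‖w‖ ^ (-(j + 2 + 2 * s)) := by
    rcases (norm_nonneg w).eq_or_lt with h | h
    · rw [← h, zero_pow (by omega), inv_zero, zero_mul]
      positivity
    · rw [neg_add, Real.rpow_add h, Real.rpow_neg h.le (j + 2 : ℝ)]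
      exact_mod_cast le_rfl
  calc ‖star ψ (x 0 : ZMod L)‖ * ‖ϱ (x 1 : ZMod M)‖ * (‖w‖ ^ (j + 2))⁻¹ * ‖w‖ ^ (-(2 * s))
      ≤ 1 * 1 * (‖w‖ ^ (j + 2))⁻¹ * ‖w‖ ^ (-(2 * s)) := by gcongr
    _ ≤ _ := by rwa [one_mul, one_mul]

theorem star_prodChar_apply (t : ℕ) (ψ : DirichletCharacter ℂ L) (ϱ : DirichletCharacter ℂ M)
    {d : ℤ} (hd : IsCoprime d ((t * L * M : ℕ) : ℤ)) :
    star (prodChar t ψ ϱ) (d : ZMod (t * L * M)) =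
      star ψ (d : ZMod L) * star (ϱ (d : ZMod M)) := by
  rw [MulChar.star_apply, MulChar.star_apply, prodChar, MulChar.mul_apply, star_mul',
    DirichletCharacter.changeLevel_eq_cast_of_dvd' _ _ hd,
    DirichletCharacter.changeLevel_eq_cast_of_dvd' _ _ hd]

theorem phi_mul (j : ℕ) (v w : ℂ) : phi j (v * w) = phi j v * phi j w := by
  simp only [phi, map_mul, mul_pow, mul_inv]
  ring

/-- The unimodular substitution of the summation indices. -/
def indexEquiv (a b c d : ℤ) (h : a * d - b * c = 1) : ℤ × ℤ ≃ ℤ × ℤ where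
  toFun x := (x.1 * a + x.2 * c, x.1 * b + x.2 * d)
  invFun x := (x.1 * d - x.2 * c, x.2 * a - x.1 * b)
  left_inv x := by
    ext
    · change (x.1 * a + x.2 * c) * d - (x.1 * b + x.2 * d) * c = x.1
      linear_combination x.1 * h
    · change (x.1 * b + x.2 * d) * a - (x.1 * a + x.2 * c) * b = x.2
      linear_combination x.2 * h
  right_inv x := by
    ext
    · change (x.1 * d - x.2 * c) * a + (x.2 * a - x.1 * b) * c = x.1
      linear_combination x.1 * h
    · change (x.1 * d - x.2 * c) * b + (x.2 * a - x.1 * b) * d = x.2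
      linear_combination x.2 * h

/-- With c = tLMe, multiplying m t M γz + n by J = cz + d gives m' t M z + n', where m' = ma + nLe
and n' = m t M b + nd. This is unimodular in (m, n), and it multiplies the character values by ψ̄(a)
= ψ̄(d)⁻¹ and by ϱ(d). -/
theorem hasSum_latTermS_smul (j : ℕ) {t : ℕ} (s : ℝ) (ψ : DirichletCharacter ℂ L)
    (ϱ : DirichletCharacter ℂ M) {γ : SL(2, ℤ)} (hγ : γ ∈ CongruenceSubgroup.Gamma0 (t * L * M))
    {z : ℍ} {T : ℂ} (hT : HasSum (latTermS j (t * M) s ψ ϱ z) T) :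
    HasSum (latTermS j (t * M) s ψ ϱ (γ • z))
      (star (prodChar t ψ ϱ) ((γ 1 1 : ℤ) : ZMod (t * L * M)) *
        phi j ((γ 1 0 : ℂ) * z + γ 1 1)⁻¹ *
        ((‖(γ 1 0 : ℂ) * z + γ 1 1‖ ^ (2 * s) : ℝ) : ℂ) * T) := by
  rw [CongruenceSubgroup.Gamma0_mem, ZMod.intCast_zmod_eq_zero_iff_dvd] at hγ
  obtain ⟨e, he⟩ := hγ
  have hdet := Matrix.det_fin_two γ.1
  rw [γ.2] at hdet
  change 1 = γ 0 0 * γ 1 1 - γ 0 1 * γ 1 0 at hdet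
  set J : ℂ := (γ 1 0 : ℂ) * z + γ 1 1 with hJ
  have hJ0 : J ≠ 0 := by
    have h := denom_ne_zero γ z
    rwa [ModularGroup.denom_apply] at h
  have hz : ((γ • z : ℍ) : ℂ) = (γ 0 0 * z + γ 0 1) / J := by
    rw [coe_specialLinearGroup_apply]
    simp [hJ]
  generalize γ 0 0 = a at *
  generalize γ 0 1 = b at *
  generalize γ 1 0 = c at *
  generalize γ 1 1 = d at *
  push_cast at he
  -- The determinant relation is itself a Bézout identity for d and the level.
  have hd : IsCoprime d ((t * L * M : ℕ) : ℤ) :=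
    ⟨a, -b * e, by push_cast; rw [he] at hdet; linear_combination -hdet⟩
  have hdM : IsUnit (d : ZMod M) := by
    have : IsCoprime d (M : ℤ) := hd.of_isCoprime_of_dvd_right (by push_cast; exact dvd_mul_left _ _)
    exact (ZMod.coe_int_isUnit_iff_isCoprime d M).mpr this.symm
  have hdL : (a : ZMod L) * d = 1 := by
    have h1 : ((1 : ℤ) : ZMod L) = ((a * d - b * c : ℤ) : ZMod L) := by rw [hdet]
    rw [he] at h1
    push_cast at h1
    simpa using h1.symm
  have hϱ : ϱ (d : ZMod M) * star (ϱ (d : ZMod M)) = 1 := by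
    have h1 := ϱ.unit_norm_eq_one hdM.unit
    rw [IsUnit.unit_spec] at h1
    rw [RCLike.star_def, Complex.mul_conj, Complex.normSq_eq_norm_sq, h1]
    simp
  have hψ : star ψ (a : ZMod L) * star ψ (d : ZMod L) = 1 := by
    rw [← map_mul, hdL, map_one]
  have hdet' : a * d - (t * M * b) * (L * e) = 1 := by
    rw [hdet, he]
    ring
  rw [star_prodChar_apply t ψ ϱ hd]
  have h2 := ((indexEquiv a (t * M * b) (L * e) d hdet').hasSum_iff.mpr hT).mul_left
    (star ψ (d : ZMod L) * star (ϱ (d : ZMod M)) * phi j J⁻¹ * ((‖J‖ ^ (2 * s) : ℝ) : ℂ))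
  refine hasSum_of_eq h2 (fun x => ?_) rfl
  obtain ⟨m, n⟩ := x
  change _ = _ * latTermS j (t * M) s ψ ϱ z (m * a + n * (L * e), m * (t * M * b) + n * d)
  simp only [latTermS, latTerm]
  have hw : ((m * a + n * (L * e) : ℤ) : ℂ) * (t * M : ℕ) * z + (m * (t * M * b) + n * d : ℤ) =
      J * (m * (t * M : ℕ) * ((γ • z : ℍ) : ℂ) + n) := by
    have hzJ : J * ((γ • z : ℍ) : ℂ) = a * z + b := by rw [hz, mul_div_cancel₀ _ hJ0]
    have hc : (c : ℂ) = t * L * M * e := by exact_mod_cast congrArg (Int.cast : ℤ → ℂ) he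
    push_cast
    linear_combination (-(m * (t * M) : ℂ)) * hzJ - n * hJ - n * z * hc
  have c1 : star ψ ((m * a + n * (L * e) : ℤ) : ZMod L) =
      star ψ (m : ZMod L) * star ψ (a : ZMod L) := by
    rw [← map_mul]
    congr 1
    simp
  have c2 : ϱ ((m * (t * M * b) + n * d : ℤ) : ZMod M) = ϱ (n : ZMod M) * ϱ (d : ZMod M) := by
    rw [← map_mul]
    congr 1
    simp
  rw [hw, c1, c2, phi_mul, norm_mul, Real.mul_rpow (norm_nonneg _) (norm_nonneg _)]
  generalize (m * (t * M : ℕ) * ((γ • z : ℍ) : ℂ) + n) = w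
  have h5 : phi j J⁻¹ * phi j J = 1 := by
    rw [← phi_mul, inv_mul_cancel₀ hJ0]
    simp [phi]
  have h6 : ((‖J‖ ^ (2 * s) : ℝ) : ℂ) * ((‖J‖ ^ (-(2 * s)) : ℝ) : ℂ) = 1 := by
    rw [← Complex.ofReal_mul, ← Real.rpow_add (norm_pos_iff.mpr hJ0)]
    simp
  rw [Complex.ofReal_mul]
  set P := phi j J⁻¹
  set P' := phi j J
  set N := ((‖J‖ ^ (2 * s) : ℝ) : ℂ)
  set N' := ((‖J‖ ^ (-(2 * s)) : ℝ) : ℂ)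
  calc _ = (star ψ (m : ZMod L) * ϱ (n : ZMod M) * phi j w * ((‖w‖ ^ (-(2 * s)) : ℝ) : ℂ)) *
        ((star ψ (a : ZMod L) * star ψ (d : ZMod L)) *
        (ϱ (d : ZMod M) * star (ϱ (d : ZMod M))) * (P * P') * (N * N')) := by
        rw [hψ, hϱ, h5, h6]
        ring
    _ = _ := by ring

end

/-! ### Limits of conditionally convergent lattice sums -/

theorem hasSum_block_two {L M : ℕ} [NeZero L] [NeZero M] {f : ℤ × ℤ → ℂ} {S : ℂ}
    (h : HasSum f S) : HasSum (fun x : ℤ × ℤ => ∑ a : Fin L, ∑ b : Fin M,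
      f (x.1 * L + (a : ℕ), x.2 * M + (b : ℕ))) S := by
  have h1 := (((Int.divModEquiv L).prodCongr (Int.divModEquiv M)).trans
    (Equiv.prodProdProdComm ℤ (Fin L) ℤ (Fin M))).symm.hasSum_iff.mpr h
  refine hasSum_of_eq (h1.prod_fiberwise fun _ => hasSum_fintype _) (fun x => ?_) rfl
  rw [Fintype.sum_prod_type]
  rfl

/-- The size `max (1, |p|, |q|)` of an index. -/
def idxSize (x : ℤ × ℤ) : ℝ := max 1 (max |(x.1 : ℝ)| |(x.2 : ℝ)|)

theorem one_le_idxSize (x : ℤ × ℤ) : 1 ≤ idxSize x := le_max_left _ _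

theorem summable_idxSize : Summable fun x : ℤ × ℤ => (idxSize x ^ 3)⁻¹ := by
  rw [← (finTwoArrowEquiv ℤ).summable_iff]
  have h1 := EisensteinSeries.summable_one_div_norm_rpow (k := 3) (by norm_num)
  have h2 : Summable fun x : Fin 2 → ℤ => if x = 0 then (1 : ℝ) else 0 :=
    (hasSum_ite_eq (0 : Fin 2 → ℤ) (1 : ℝ)).summable
  refine Summable.of_nonneg_of_le (fun x => ?_) (fun x => ?_) (h1.add h2)
  · have := one_le_idxSize (finTwoArrowEquiv ℤ x)
    simp only [Function.comp_apply]
    positivity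
  · simp only [Function.comp_apply]
    by_cases hx : x = 0
    · rw [if_pos hx, hx]
      simp [idxSize]
    · rw [if_neg hx, add_zero, Real.rpow_neg (norm_nonneg x)]
      have hn : 0 < ‖x‖ := norm_pos_iff.mpr hx
      have e : ‖x‖ ≤ idxSize (finTwoArrowEquiv ℤ x) := by
        refine (pi_norm_le_iff_of_nonneg (zero_le_one.trans (one_le_idxSize _))).mpr fun i => ?_
        rw [Int.norm_eq_abs]
        fin_cases i
        · exact (le_max_left _ _).trans (le_max_right _ _)
        · exact (le_max_right _ _).trans (le_max_right _ _)
      have e3 : ‖x‖ ^ (3 : ℝ) = ‖x‖ ^ 3 := by exact_mod_cast Real.rpow_natCast ‖x‖ 3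
      rw [e3]
      gcongr

section
variable {L M : ℕ}

theorem latTermS_weight_two (Q : ℕ) {s : ℝ} (hs : 0 ≤ s) (ψ : DirichletCharacter ℂ L)
    (ϱ : DirichletCharacter ℂ M) (z : ℍ) (x : ℤ × ℤ) :
    latTermS 0 Q s ψ ϱ z x = star ψ (x.1 : ZMod L) * ϱ (x.2 : ZMod M) *
      ((‖(x.1 * Q * z + x.2 : ℂ)‖ ^ (-(2 + 2 * s)) : ℝ) : ℂ) := by
  rw [latTermS, latTerm, mul_assoc]
  congr 1
  set w : ℂ := x.1 * Q * z + x.2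
  have hphi : phi 0 w = (((‖w‖ ^ 2)⁻¹ : ℝ) : ℂ) := by
    rw [phi, zero_add, pow_one, ← mul_inv, Complex.mul_conj, Complex.normSq_eq_norm_sq,
      Complex.ofReal_inv]
  rw [hphi, ← Complex.ofReal_mul]
  congr 1
  rcases (norm_nonneg w).eq_or_lt with h | h
  · rw [← h, zero_pow (by omega), inv_zero, zero_mul, Real.zero_rpow (by linarith)]
  · rw [neg_add, Real.rpow_add h, Real.rpow_neg h.le (2 : ℝ)]
    norm_num

theorem idxSize_le {m n p q : ℤ} {K : ℝ} (hm : |(p : ℝ)| ≤ |(m : ℝ)| + K)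
    (hn : |(q : ℝ)| ≤ |(n : ℝ)| + K) (hK : 0 ≤ K) (h : ![m, n] ≠ 0) :
    idxSize (p, q) ≤ (1 + K) * ‖![m, n]‖ := by
  have h1 : (1 : ℝ) ≤ ‖![m, n]‖ := by
    rw [EisensteinSeries.norm_eq_max_natAbs]
    by_contra hlt
    apply h
    have h0 : max (![m, n] 0).natAbs (![m, n] 1).natAbs < 1 := by exact_mod_cast not_le.mp hlt
    have hm0 : m = 0 := by
      have := (le_max_left _ _).trans_lt h0
      simpa using this
    have hn0 : n = 0 := by
      have := (le_max_right _ _).trans_lt h0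
      simpa using this
    rw [hm0, hn0]
    simp
  have h2 : |(m : ℝ)| ≤ ‖![m, n]‖ := by
    have := norm_le_pi_norm ![m, n] 0
    rwa [Int.norm_eq_abs] at this
  have h3 : |(n : ℝ)| ≤ ‖![m, n]‖ := by
    have := norm_le_pi_norm ![m, n] 1
    rwa [Int.norm_eq_abs] at this
  refine max_le ?_ (max_le ?_ ?_) <;> nlinarith

/-- The modulus |mQz + n| is at least a constant times max(|m|, |n|) away from the origin, and
passing from (m, n) to its block index changes sizes by at most L + M. -/
theorem exists_le_norm_block [NeZero L] [NeZero M] {Q : ℕ} (hQ : 0 < Q) (z : ℍ) :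
    ∃ ε : ℝ, 0 < ε ∧ ε ≤ 1 ∧ ∀ (x : ℤ × ℤ) (a : Fin L) (b : Fin M),
      (x.1 * L + (a : ℕ) ≠ 0 ∨ x.2 * M + (b : ℕ) ≠ 0) →
      ε * idxSize x ≤ ‖((x.1 * L + (a : ℕ) : ℤ) * Q * z + (x.2 * M + (b : ℕ) : ℤ) : ℂ)‖ := by
  set τ : ℍ := ⟨Q * z, im_natCast_mul hQ z⟩ with hτ
  have hr := EisensteinSeries.r_pos τ
  have hK : (0 : ℝ) < 1 + (L + M) := by positivity
  refine ⟨min 1 (EisensteinSeries.r τ / (1 + (L + M))), lt_min one_pos (div_pos hr hK),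
    min_le_left _ _, fun x a b h => ?_⟩
  set m : ℤ := x.1 * L + (a : ℕ) with hm
  set n : ℤ := x.2 * M + (b : ℕ) with hn
  have hmn : ![m, n] ≠ 0 := fun h0 => by
    have e0 := congrFun h0 0
    have e1 := congrFun h0 1
    simp at e0 e1
    tauto
  have key : ∀ (p : ℤ) (N : ℕ) (_ : NeZero N) (c : Fin N),
      |(p : ℝ)| ≤ |((p * N + (c : ℕ) : ℤ) : ℝ)| + N := fun p N hN c => by
    have hN1 : (1 : ℝ) ≤ N := by exact_mod_cast Nat.one_le_iff_ne_zero.mpr hN.out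
    have hcN : ((c : ℕ) : ℝ) ≤ N := by exact_mod_cast c.2.le
    have hc0 : (0 : ℝ) ≤ (c : ℕ) := Nat.cast_nonneg _
    have h1 : |(p : ℝ)| ≤ |(p : ℝ) * N| := by
      rw [abs_mul, abs_of_pos (by linarith : (0 : ℝ) < N)]
      exact le_mul_of_one_le_right (abs_nonneg _) hN1
    have h2 : |(p : ℝ) * N| ≤ |(p : ℝ) * N + (c : ℕ)| + |((c : ℕ) : ℝ)| := by
      have := abs_sub ((p : ℝ) * N + (c : ℕ)) ((c : ℕ) : ℝ)
      rwa [add_sub_cancel_right] at this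
    rw [abs_of_nonneg hc0] at h2
    push_cast
    linarith
  have k1 := key x.1 L inferInstance a
  have k2 := key x.2 M inferInstance b
  rw [← hm] at k1
  rw [← hn] at k2
  have hL0 : (0 : ℝ) ≤ L := L.cast_nonneg
  have hM0 : (0 : ℝ) ≤ M := M.cast_nonneg
  have h1 := idxSize_le (m := m) (n := n) (p := x.1) (q := x.2) (K := L + M)
    (by linarith) (by linarith) (by positivity) hmn
  have h2 := EisensteinSeries.r_mul_max_le τ hmn
  have e : (((![m, n] 0 : ℤ) : ℂ) * τ + (![m, n] 1 : ℤ)) = m * Q * z + n := by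
    rw [mul_assoc]
    rfl
  rw [e] at h2
  calc min 1 (EisensteinSeries.r τ / (1 + (L + M))) * idxSize x
      ≤ EisensteinSeries.r τ / (1 + (L + M)) * ((1 + (L + M)) * ‖![m, n]‖) := by
        have := one_le_idxSize x
        gcongr
        exact min_le_right _ _
    _ = EisensteinSeries.r τ * ‖![m, n]‖ := by
        field_simp
    _ ≤ _ := h2

/-- Unless both characters are trivial, the weights on a block sum to zero. Comparing |w|^{-(2+2s)}
with its value at one point of the block by the mean value inequality gains a power, and the
resulting exponent 3 is summable over ℤ². -/
theorem norm_block_le [NeZero L] [NeZero M] {Q : ℕ} (hQ : 0 < Q) {ψ : DirichletCharacter ℂ L}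
    {ϱ : DirichletCharacter ℂ M} (h : ¬ (ψ = 1 ∧ ϱ = 1)) (z : ℍ) :
    ∃ K : ℝ, ∀ s ∈ Set.Icc (0 : ℝ) 1, ∀ x : ℤ × ℤ, ‖∑ a : Fin L, ∑ b : Fin M,
      latTermS 0 Q s ψ ϱ z (x.1 * L + (a : ℕ), x.2 * M + (b : ℕ))‖ ≤ K * (idxSize x ^ 3)⁻¹ := by
  obtain ⟨ε, hε0, hε1, hε⟩ := exists_le_norm_block (L := L) (M := M) hQ z
  set D : ℝ := L * ‖(Q * z : ℂ)‖ + M with hD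
  have hD0 : 0 ≤ D := by positivity
  refine ⟨(Fintype.card (Fin L × Fin M)) * (4 * (ε ^ 5)⁻¹ * D), fun s hs x => ?_⟩
  have hψ0 : ψ = 1 ↔ star ψ = 1 :=
    ⟨fun h => by rw [h]; simp, fun h => by rw [← star_star ψ, h]; simp⟩
  set f : Fin L × Fin M → ℂ := fun y => star ψ ((y.1 : ℕ) : ZMod L) * ϱ ((y.2 : ℕ) : ZMod M) with hf
  set W : Fin L × Fin M → ℂ := fun y => ((x.1 * L + (y.1 : ℕ) : ℤ) : ℂ) * Q * z +
    ((x.2 * M + (y.2 : ℕ) : ℤ) : ℂ) with hW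
  have hf0 : ∑ y, f y = 0 := by
    simp only [hf, Fintype.sum_prod_type, ← Finset.mul_sum, ← Finset.sum_mul]
    by_cases h1 : ϱ = 1
    · rw [sum_fin_char_eq_zero (fun h2 => h ⟨hψ0.mpr h2, h1⟩), zero_mul]
    · rw [sum_fin_char_eq_zero h1, mul_zero]
  have hchar : ∀ y : Fin L × Fin M, star ψ ((x.1 * L + (y.1 : ℕ) : ℤ) : ZMod L) *
      ϱ ((x.2 * M + (y.2 : ℕ) : ℤ) : ZMod M) = f y := fun y => by simp [hf]
  have hne : ∀ y, f y ≠ 0 → ε * idxSize x ≤ ‖W y‖ := fun y hy => by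
    refine hε x y.1 y.2 ?_
    by_contra hcon
    push Not at hcon
    rw [← hchar, hcon.1, hcon.2, Int.cast_zero, Int.cast_zero] at hy
    by_cases h1 : ϱ = 1
    · rw [char_zero_of_ne_one (fun h2 => h ⟨hψ0.mpr h2, h1⟩), zero_mul] at hy
      exact hy rfl
    · rw [char_zero_of_ne_one h1, mul_zero] at hy
      exact hy rfl
  have hL := NeZero.pos L
  have hM := NeZero.pos M
  -- The reference point has residues (1, 1), where both characters are nonzero, so the lower bound
  -- on |w| applies to it as well.
  set y₀ : Fin L × Fin M := (⟨1 % L, Nat.mod_lt _ hL⟩, ⟨1 % M, Nat.mod_lt _ hM⟩) with hy₀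
  have hfy₀ : f y₀ ≠ 0 := by
    simp [hf, hy₀, ZMod.natCast_mod]
  have hdist : ∀ y, ‖W y - W y₀‖ ≤ D := fun y => by
    have e : W y - W y₀ = (((y.1 : ℕ) : ℝ) - ((y₀.1 : ℕ) : ℝ) : ℝ) * (Q * z : ℂ) +
        (((y.2 : ℕ) : ℝ) - ((y₀.2 : ℕ) : ℝ) : ℝ) := by
      simp only [hW]
      push_cast
      ring
    have key : ∀ (N : ℕ) (c c' : Fin N), |((c : ℕ) : ℝ) - ((c' : ℕ) : ℝ)| ≤ N := fun N c c' => by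
      have h1 : ((c : ℕ) : ℝ) ≤ N := by exact_mod_cast c.2.le
      have h2 : ((c' : ℕ) : ℝ) ≤ N := by exact_mod_cast c'.2.le
      have h3 : (0 : ℝ) ≤ (c : ℕ) := Nat.cast_nonneg _
      have h4 : (0 : ℝ) ≤ (c' : ℕ) := Nat.cast_nonneg _
      rw [abs_le]
      constructor <;> linarith
    rw [e]
    refine (norm_add_le _ _).trans ?_
    rw [norm_mul, Complex.norm_real, Complex.norm_real, Real.norm_eq_abs, Real.norm_eq_abs, hD]
    gcongr
    · exact key _ _ _
    · exact key _ _ _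
  have hI := one_le_idxSize x
  have hεI : 0 < ε * idxSize x := by positivity
  -- The exponent lies between -5 and -3. Since ε ≤ 1 and the index size is at least 1, each factor
  -- takes the opposite extreme.
  have hpow : (ε * idxSize x) ^ (-(2 + 2 * s) - 1) ≤ (ε ^ 5)⁻¹ * (idxSize x ^ 3)⁻¹ := by
    rw [Real.mul_rpow hε0.le (by linarith)]
    gcongr
    · calc ε ^ (-(2 + 2 * s) - 1) ≤ ε ^ (-5 : ℝ) :=
            Real.rpow_le_rpow_of_exponent_ge hε0 hε1 (by linarith [hs.2])
        _ = _ := by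
            rw [Real.rpow_neg hε0.le]
            norm_num
    · calc idxSize x ^ (-(2 + 2 * s) - 1) ≤ idxSize x ^ (-3 : ℝ) :=
            Real.rpow_le_rpow_of_exponent_le hI (by linarith [hs.1])
        _ = _ := by
            rw [Real.rpow_neg (by linarith)]
            norm_num
  have hmain := norm_sum_mul_le_of_sum_eq_zero (Finset.univ : Finset (Fin L × Fin M))
    (f := f) (h := fun y => ((‖W y‖ ^ (-(2 + 2 * s)) : ℝ) : ℂ))
    ((‖W y₀‖ ^ (-(2 + 2 * s)) : ℝ) : ℂ)
    (K := 4 * (ε ^ 5)⁻¹ * D * (idxSize x ^ 3)⁻¹) hf0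
    (fun y _ => by
      simp only [hf]
      rw [norm_mul]
      exact mul_le_one₀ (DirichletCharacter.norm_le_one _ _) (norm_nonneg _)
        (DirichletCharacter.norm_le_one _ _))
    (fun y _ hy => by
      rw [← Complex.ofReal_sub, Complex.norm_real, Real.norm_eq_abs]
      refine (abs_rpow_neg_sub_le (by linarith [hs.1]) hεI (hne y₀ hfy₀) (hne y hy)).trans ?_
      calc (2 + 2 * s) * (ε * idxSize x) ^ (-(2 + 2 * s) - 1) * |‖W y‖ - ‖W y₀‖|
          ≤ 4 * ((ε ^ 5)⁻¹ * (idxSize x ^ 3)⁻¹) * D := by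
            gcongr
            · linarith [hs.2]
            · exact (abs_norm_sub_norm_le _ _).trans (hdist y)
        _ = _ := by ring)
    (by positivity)
  rw [Finset.card_univ] at hmain
  calc _ = ‖∑ y, f y * ((‖W y‖ ^ (-(2 + 2 * s)) : ℝ) : ℂ)‖ := by
        rw [Fintype.sum_prod_type]
        congr 1
        refine Finset.sum_congr rfl fun a _ => Finset.sum_congr rfl fun b _ => ?_
        rw [latTermS_weight_two Q hs.1, hchar (a, b)]
    _ ≤ _ := hmain
    _ = _ := by ring

theorem tendsto_latTermS [NeZero L] [NeZero M] {Q : ℕ} (hQ : 0 < Q) {ψ : DirichletCharacter ℂ L}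
    {ϱ : DirichletCharacter ℂ M} (h : ¬ (ψ = 1 ∧ ϱ = 1)) (z : ℍ) :
    ∃ T : ℂ, HasSum (fun x : ℤ × ℤ => ∑ a : Fin L, ∑ b : Fin M,
        latTerm 0 Q ψ ϱ z (x.1 * L + (a : ℕ)) (x.2 * M + (b : ℕ))) T ∧
      Filter.Tendsto (fun s : ℝ => ∑' x, latTermS 0 Q s ψ ϱ z x) (nhdsWithin 0 (Set.Ioi 0))
        (nhds T) := by
  obtain ⟨K, hK⟩ := norm_block_le hQ h z
  have hsb := summable_idxSize.mul_left K
  have hlim : ∀ x : ℤ × ℤ, Filter.Tendsto (fun s : ℝ => ∑ a : Fin L, ∑ b : Fin M,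
      latTermS 0 Q s ψ ϱ z (x.1 * L + (a : ℕ), x.2 * M + (b : ℕ))) (nhdsWithin 0 (Set.Ioi 0))
      (nhds (∑ a : Fin L, ∑ b : Fin M,
        latTermS 0 Q 0 ψ ϱ z (x.1 * L + (a : ℕ), x.2 * M + (b : ℕ)))) := fun x => by
    refine tendsto_finsetSum _ fun a _ => tendsto_finsetSum _ fun b _ => ?_
    simp only [latTermS, latTerm]
    set w : ℂ := ((x.1 * L + (a : ℕ) : ℤ) : ℂ) * Q * z + ((x.2 * M + (b : ℕ) : ℤ) : ℂ)
    -- At the origin the term is zero for every s, since `phi` vanishes there by the convention for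
    -- inverses.
    by_cases hw : w = 0
    · simp [hw, phi]
    · refine Filter.Tendsto.const_mul _ ((Complex.continuous_ofReal.tendsto _).comp ?_)
      have : Continuous fun s : ℝ => ‖w‖ ^ (-(2 * s)) :=
        Continuous.rpow continuous_const (by fun_prop) fun _ => Or.inl (norm_ne_zero_iff.mpr hw)
      exact this.continuousAt.tendsto.mono_left nhdsWithin_le_nhds
  have hmem : Set.Ioc (0 : ℝ) 1 ∈ nhdsWithin (0 : ℝ) (Set.Ioi 0) := Ioc_mem_nhdsGT one_pos
  have htend := tendsto_tsum_of_dominated_convergence hsb hlim (by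
    filter_upwards [hmem] with s hs x using hK s ⟨hs.1.le, hs.2⟩ x)
  have hs0 := Summable.of_norm_bounded hsb (hK 0 (by simp))
  refine ⟨_, hasSum_of_eq hs0.hasSum (fun x => ?_) rfl, htend.congr' ?_⟩
  · simp only [latTermS_zero]
  · filter_upwards [self_mem_nhdsWithin] with s hs
    have hs' : (0 : ℝ) < s := hs
    exact (hasSum_block_two (summable_latTermS 0 hQ (by simpa using hs') hs'.le ψ ϱ z).hasSum).tsum_eq

/-- The lattice sum, defined by absolute convergence for `j > 0` and by Hecke summation for
`j = 0`, transforms like a modular form. -/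
theorem exists_latSum [NeZero L] [NeZero M] (j : ℕ) {t : ℕ} (ht : 0 < t)
    {ψ : DirichletCharacter ℂ L} {ϱ : DirichletCharacter ℂ M}
    (h : 1 ≤ j ∨ (j = 0 ∧ ¬ (ψ = 1 ∧ ϱ = 1))) :
    ∃ T : ℍ → ℂ, (∀ z, HasSum (fun x : ℤ × ℤ => ∑ a : Fin L, ∑ b : Fin M,
        latTerm j (t * M) ψ ϱ z (x.1 * L + (a : ℕ)) (x.2 * M + (b : ℕ))) (T z)) ∧
      ∀ γ ∈ CongruenceSubgroup.Gamma0 (t * L * M), ∀ z : ℍ,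
        T (γ • z) = star (prodChar t ψ ϱ) ((γ 1 1 : ℤ) : ZMod (t * L * M)) *
          phi j ((γ 1 0 : ℂ) * z + γ 1 1)⁻¹ * T z := by
  have hQ : 0 < t * M := Nat.mul_pos ht (NeZero.pos M)
  rcases h with hj | ⟨rfl, h⟩
  · have hs : ∀ z : ℍ, Summable (latTermS j (t * M) 0 ψ ϱ z) := fun z =>
      summable_latTermS j hQ (by simpa using (by omega : 0 < j)) le_rfl ψ ϱ z
    refine ⟨fun z => ∑' x, latTermS j (t * M) 0 ψ ϱ z x, fun z => ?_, fun γ hγ z => ?_⟩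
    · refine hasSum_of_eq (hasSum_block_two (L := L) (M := M) (hs z).hasSum) (fun x => ?_) rfl
      simp only [latTermS_zero]
    · refine (hasSum_latTermS_smul j 0 ψ ϱ hγ (hs z).hasSum).tsum_eq.trans ?_
      simp
  · choose T hT hlim using fun z => tendsto_latTermS hQ h z
    refine ⟨T, hT, fun γ hγ z => ?_⟩
    have hJ0 : (γ 1 0 : ℂ) * z + γ 1 1 ≠ 0 := by
      have h := denom_ne_zero γ z
      rwa [ModularGroup.denom_apply] at h
    set J : ℂ := (γ 1 0 : ℂ) * z + γ 1 1
    have hc : Continuous fun s : ℝ => ((‖J‖ ^ (2 * s) : ℝ) : ℂ) :=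
      Complex.continuous_ofReal.comp (Continuous.rpow continuous_const (by fun_prop) fun _ =>
        Or.inl (norm_ne_zero_iff.mpr hJ0))
    -- For s > 0 the law carries the extra factor |J|^{2s}, which tends to 1.
    have h1 := (hc.tendsto 0).mono_left (nhdsWithin_le_nhds (s := Set.Ioi 0))
    rw [mul_zero, Real.rpow_zero, Complex.ofReal_one] at h1
    have h2 := (h1.const_mul (star (prodChar t ψ ϱ) ((γ 1 1 : ℤ) : ZMod (t * L * M)) *
      phi 0 J⁻¹)).mul (hlim z)
    rw [mul_one] at h2
    refine tendsto_nhds_unique (hlim (γ • z)) (h2.congr' ?_)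
    filter_upwards [self_mem_nhdsWithin] with s hs
    have hs' : (0 : ℝ) < s := hs
    exact (hasSum_latTermS_smul 0 s ψ ϱ hγ
      (summable_latTermS 0 hQ (by simpa using hs') hs'.le ψ ϱ z).hasSum).tsum_eq.symm

end

/-! ### The coefficients of the Maass form -/

/-- The sequence `a` with its constant term replaced by `c₀`. -/
def withConst (c₀ : ℂ) (a : ℕ → ℂ) (n : ℕ) : ℂ := if n = 0 then c₀ else a n

theorem PolyGrowth.withConst {a : ℕ → ℂ} (ha : PolyGrowth a) (c₀ : ℂ) :
    PolyGrowth (withConst c₀ a) := by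
  obtain ⟨C, B, h⟩ := ha
  refine ⟨‖c₀‖ + |C|, B, fun n => ?_⟩
  have h1 : (1 : ℝ) ≤ (n + 1 : ℝ) ^ B := one_le_pow₀ (by simp)
  rw [MockEis.withConst]
  split_ifs with hn
  · calc ‖c₀‖ ≤ (‖c₀‖ + |C|) * 1 := by
          rw [mul_one]
          exact le_add_of_nonneg_right (abs_nonneg C)
      _ ≤ _ := by gcongr
  · refine (h n).trans ?_
    gcongr
    exact (le_abs_self C).trans (le_add_of_nonneg_left (norm_nonneg _))

theorem qser_withConst {a : ℕ → ℂ} (ha : PolyGrowth a) (ha0 : a 0 = 0) (c₀ : ℂ) {w : ℂ}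
    (hw : 0 < w.im) : qser (withConst c₀ a) w = c₀ + qser a w := by
  refine ((ha.withConst c₀).hasSum hw).unique
    (hasSum_of_eq ((hasSum_ite_eq 0 c₀).add (ha.hasSum hw)) (fun n => ?_) rfl)
  rw [withConst]
  split_ifs with hn
  · simp [hn, ha0]
  · simp

theorem nonhol_withConst (j : ℕ) (c₀ : ℂ) (a : ℕ → ℂ) (w : ℂ) :
    nonhol j (withConst c₀ a) w = nonhol j a w := by
  have h : antider (withConst c₀ a) = antider a := funext fun n => by
    rw [antider, antider, withConst]
    split_ifs with hn
    · simp [hn]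
    · rfl
  cases j <;> simp only [nonhol, h]

theorem divSum_zero (t : ℕ) (u : ℕ → ℕ → ℂ) : divSum t u 0 = 0 := by
  simp [divSum]

theorem star_LFunction {M : ℕ} [NeZero M] (χ : DirichletCharacter ℂ M) (j : ℕ) :
    (starRingEnd ℂ) (DirichletCharacter.LFunction (star χ) (j + 2 : ℕ)) =
      DirichletCharacter.LFunction χ (j + 2) := by
  have hj : (1 : ℝ) < (j + 2 : ℕ) := by exact_mod_cast (by omega : 1 < j + 2)
  have h1 := hasSum_LFunction χ hj
  have h2 := (Complex.conjCLE : ℂ →L[ℝ] ℂ).hasSum (hasSum_LFunction (star χ) hj)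
  have h3 := h1.unique (hasSum_of_eq h2 (fun n => by
    change _ = (starRingEnd ℂ) _
    rw [map_mul, Complex.conj_ofReal, MulChar.star_apply, RCLike.star_def, Complex.conj_conj]) rfl)
  push_cast at h3 ⊢
  exact h3.symm

/-- Orthogonality of characters; for the trivial character the sum counts units, and φ(M) = M ∏ (1 -
p⁻¹). This explains the case distinction in the constant coefficient of the mock modular form. -/
theorem gaussC_zero {M : ℕ} [NeZero M] (χ : DirichletCharacter ℂ M) [Decidable (χ = 1)] :
    gaussC χ 0 = if χ = 1 then M * eulerProd M else 0 := by
  have e : gaussC χ 0 = ∑ a : ZMod M, χ a := by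
    rw [sum_zmod_eq_sum_range, gaussC]
    simp
  rw [e]
  split_ifs with h
  · rw [h, MulChar.sum_one_eq_card_units, ZMod.card_units_eq_totient]
    have h1 := Nat.totient_eq_mul_prod_factors M
    rw [eulerProd]
    have h2 := congrArg (Rat.cast : ℚ → ℂ) h1
    push_cast at h2
    exact h2
  · exact MulChar.sum_eq_zero_of_ne_one h

section
variable {L M : ℕ}

/-- The normalizing constant of the holomorphic part. -/
def holNorm (j M : ℕ) : ℂ := Real.pi * ((-2 * Complex.I) ^ j)⁻¹ / ((j + 1) * (M : ℂ) ^ (j + 2))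

/-- The normalizing constant of the shadow. -/
def shadowNorm (j M : ℕ) : ℂ := (-(2 * Real.pi * Complex.I) / M) ^ (j + 2) / (j + 1).factorial

theorem two_zpow_mul (j : ℕ) :
    (2 : ℂ) ^ (2 - ((j + 2 : ℕ) : ℤ)) * Real.pi * Complex.I ^ (((j + 2 : ℕ) : ℤ) - 2) =
      Real.pi * ((-2 * Complex.I) ^ j)⁻¹ := by
  rw [show 2 - ((j + 2 : ℕ) : ℤ) = -(j : ℤ) by push_cast; ring,
    show ((j + 2 : ℕ) : ℤ) - 2 = (j : ℤ) by push_cast; ring, zpow_neg, zpow_natCast, zpow_natCast,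
    ← inv_pow, ← inv_pow]
  have h : (-2 * Complex.I)⁻¹ = 2⁻¹ * Complex.I := by
    rw [mul_inv, Complex.inv_I]
    ring
  rw [h, mul_pow]
  ring

theorem mockCoeff_eq [NeZero L] [NeZero M] (j : ℕ) {t : ℕ} (ht : 0 < t)
    (ψ : DirichletCharacter ℂ L) (ϱ : DirichletCharacter ℂ M) :
    mockCoeff (j + 2) t ψ ϱ = withConst (holNorm j M * (gaussC ϱ 0 * ((t : ℂ) ^ (j + 1))⁻¹ *
        DirichletCharacter.LFunction (star ψ) (j + 1)))
      (fun n => holNorm j M * divSum t (holTerm j t ψ ϱ) n) := by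
  classical
  have hM : (M : ℂ) ≠ 0 := by exact_mod_cast NeZero.ne M
  have htC : (t : ℂ) ≠ 0 := by exact_mod_cast ht.ne'
  have hj : (j + 1 : ℂ) ≠ 0 := by exact_mod_cast Nat.succ_ne_zero j
  have hk : (((j + 2 : ℕ) : ℂ) - 1) = j + 1 := by push_cast; ring
  funext n
  rw [mockCoeff, withConst, two_zpow_mul, hk, show j + 2 - 1 = j + 1 from rfl]
  by_cases hn : n = 0
  · rw [if_pos hn, if_pos hn, gaussC_zero]
    split_ifs with h
    · rw [holNorm, pow_succ (M : ℂ) (j + 1)]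
      field_simp
      ring
    · simp
  · rw [if_neg hn, if_neg hn, divSum_holTerm j ht, holNorm,
      show 1 - ((j + 2 : ℕ) : ℤ) = -((j + 1 : ℕ) : ℤ) by push_cast; ring, zpow_neg, zpow_natCast]
    ring

/-- The Fourier coefficients of the shadow. -/
def shadowCoeff (j t : ℕ) [NeZero M] (ψ : DirichletCharacter ℂ L) (ϱ : DirichletCharacter ℂ M) :
    ℕ → ℂ :=
  withConst (eisConst (j + 2) ψ ϱ) fun n => shadowNorm j M * divSum t (nonholTerm j ψ ϱ) n

theorem polyGrowth_holTerm (j : ℕ) {t : ℕ} (ht : 0 < t) (ψ : DirichletCharacter ℂ L)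
    (ϱ : DirichletCharacter ℂ M) : PolyGrowth (divSum t (holTerm j t ψ ϱ)) :=
  polyGrowth_divSum fun m c hm _ => norm_holTerm_le j ht ψ ϱ m c hm

theorem polyGrowth_nonholTerm (j t : ℕ) (ψ : DirichletCharacter ℂ L)
    (ϱ : DirichletCharacter ℂ M) : PolyGrowth (divSum t (nonholTerm j ψ ϱ)) :=
  polyGrowth_divSum fun m c hm _ => norm_nonholTerm_le j ψ ϱ m c hm

theorem polyGrowth_mockCoeff [NeZero L] [NeZero M] (j : ℕ) {t : ℕ} (ht : 0 < t)
    (ψ : DirichletCharacter ℂ L) (ϱ : DirichletCharacter ℂ M) :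
    PolyGrowth (mockCoeff (j + 2) t ψ ϱ) := by
  rw [mockCoeff_eq j ht]
  exact ((polyGrowth_const _).mul (polyGrowth_holTerm j ht ψ ϱ)).withConst _

theorem polyGrowth_shadowCoeff [NeZero M] (j t : ℕ) (ψ : DirichletCharacter ℂ L)
    (ϱ : DirichletCharacter ℂ M) : PolyGrowth (shadowCoeff j t ψ ϱ) :=
  ((polyGrowth_const _).mul (polyGrowth_nonholTerm j t ψ ϱ)).withConst _

theorem eisSeriesT_eq_qser [NeZero M] (j : ℕ) {t : ℕ} (ht : 0 < t) (ψ : DirichletCharacter ℂ L)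
    (ϱ : DirichletCharacter ℂ M) (z : ℍ) :
    eisSeriesT (j + 2) t ψ ϱ z = qser (shadowCoeff j t ψ ϱ) z := by
  have hp := polyGrowth_nonholTerm j t ψ ϱ
  rw [shadowCoeff, qser_withConst ((polyGrowth_const _).mul hp) (by rw [divSum_zero, mul_zero]) _
    z.im_pos, qser_const_mul, eisSeriesT, eisSeries, shadowNorm, show j + 2 - 1 = j + 1 from rfl]
  -- The series in q^{tn} is rewritten as one in q^n supported on multiples of t.
  have hinj : Function.Injective fun n : ℕ => t * n := fun a b hab =>
    Nat.eq_of_mul_eq_mul_left ht hab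
  have h1 := (hinj.hasSum_iff (f := fun n : ℕ => divSum t (nonholTerm j ψ ϱ) n *
    Complex.exp (2 * Real.pi * Complex.I * n * z)) (fun n hn => by
      rw [divSum, if_neg fun h => hn ?_, zero_mul]
      obtain ⟨m, rfl⟩ := h
      exact ⟨m, rfl⟩)).mpr (hp.hasSum z.im_pos)
  have h2 : qser (divSum t (nonholTerm j ψ ϱ)) z = gaussW (star ϱ) * ∑' n : ℕ, if n = 0 then 0 else
      sigma (j + 2) ψ ϱ n * Complex.exp (2 * Real.pi * Complex.I * n * (t * z)) := by
    rw [← tsum_mul_left, ← h1.tsum_eq]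
    refine tsum_congr fun n => ?_
    simp only [Function.comp_apply]
    split_ifs with hn
    · simp [hn, divSum_zero]
    · rw [divSum_nonholTerm, if_pos (dvd_mul_right t n), Nat.mul_div_cancel_left n ht, ← mul_assoc]
      congr 2
      push_cast
      ring
  rw [h2]
  ring

/-- The harmonic Maass form, as a function on `ℂ`. -/
def maass (j t : ℕ) [NeZero L] [NeZero M] (ψ : DirichletCharacter ℂ L)
    (ϱ : DirichletCharacter ℂ M) (w : ℂ) : ℂ :=
  qser (mockCoeff (j + 2) t ψ ϱ) w +
    ((starRingEnd ℂ) (eisConst (j + 2) ψ ϱ) / (j + 1) * (w.im : ℂ) ^ (j + 1) +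
      -1 * nonhol j (shadowCoeff j t ψ ϱ) w)

/-- The factor 2 comes from the rows ±m, M^{j+2} from scaling the residue classes, and j + 1 = k - 1
from the normalization of the shadow. -/
theorem maass_eq_latValue [NeZero L] [NeZero M] (j : ℕ) {t : ℕ} (ht : 0 < t)
    (ψ : DirichletCharacter ℂ L) (ϱ : DirichletCharacter ℂ M) (z : ℍ) :
    maass j t ψ ϱ z = latValue j t ψ ϱ z / (2 * (j + 1) * (M : ℂ) ^ (j + 2)) := by
  have hM : (M : ℂ) ≠ 0 := by exact_mod_cast NeZero.ne M
  have hj : (j + 1 : ℂ) ≠ 0 := by exact_mod_cast Nat.succ_ne_zero j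
  have hfac : (j.factorial : ℂ) ≠ 0 := by exact_mod_cast j.factorial_ne_zero
  rw [maass, latValue, mockCoeff_eq j ht, shadowCoeff, nonhol_withConst, nonhol_const_mul,
    qser_withConst ((polyGrowth_const _).mul (polyGrowth_holTerm j ht ψ ϱ))
      (by rw [divSum_zero, mul_zero]) _ z.im_pos, qser_const_mul]
  have h1 : (starRingEnd ℂ) (eisConst (j + 2) ψ ϱ) =
      star ψ 0 * DirichletCharacter.LFunction ϱ (j + 2) := by
    rw [eisConst]
    split_ifs with h
    · subst h
      rw [star_LFunction, show (0 : ZMod 1) = 1 from rfl, map_one, one_mul]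
    · have : Fact (1 < L) := ⟨by have := NeZero.ne L; omega⟩
      rw [MulChar.map_zero, zero_mul, map_zero]
  have h2 : (starRingEnd ℂ) (shadowNorm j M) =
      -(4 * Real.pi ^ 2 * (2 * Real.pi * Complex.I) ^ j / (j.factorial * (j + 1) *
        (M : ℂ) ^ (j + 2))) := by
    rw [shadowNorm, Nat.factorial_succ]
    simp only [map_div₀, map_pow, map_neg, map_mul, Complex.conj_I, Complex.conj_ofReal,
      Complex.conj_ofNat, map_natCast]
    push_cast
    rw [show -(2 * (Real.pi : ℂ) * -Complex.I) = 2 * Real.pi * Complex.I by ring, div_pow,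
      pow_add (2 * Real.pi * Complex.I) j 2]
    have h3 : (2 * Real.pi * Complex.I : ℂ) ^ 2 = -(4 * Real.pi ^ 2) := by
      rw [mul_pow, Complex.I_sq]
      ring
    rw [h3]
    field_simp
  rw [h1, h2, holNorm, coe_im]
  field_simp
  ring

end

/-! ### The harmonic Maass form -/

section
variable {L M : ℕ}

theorem isModular_maass [NeZero L] [NeZero M] (j : ℕ) {t : ℕ} (ht : 0 < t)
    {ψ : DirichletCharacter ℂ L} {ϱ : DirichletCharacter ℂ M}
    (hparity : ψ (-1) * ϱ (-1) = (-1) ^ j) (h : 1 ≤ j ∨ (j = 0 ∧ ¬ (ψ = 1 ∧ ϱ = 1))) :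
    IsModular (2 - ((j + 2 : ℕ) : ℤ)) (t * L * M) (star (prodChar t ψ ϱ))
      fun z => maass j t ψ ϱ z := by
  classical
  obtain ⟨T, hT, hmod⟩ := exists_latSum j ht h
  have hM : (M : ℂ) ≠ 0 := by exact_mod_cast NeZero.ne M
  have hcond : 1 ≤ j ∨ ψ ≠ 1 ∨ gaussC ϱ 0 = 0 := by
    rcases h with h | ⟨-, h⟩
    · exact Or.inl h
    · by_cases hψ : ψ = 1
      · exact Or.inr (Or.inr (by rw [gaussC_zero, if_neg fun h' => h ⟨hψ, h'⟩]))
      · exact Or.inr (Or.inl hψ)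
  have hval : ∀ z : ℍ, maass j t ψ ϱ z = (z.im : ℂ) ^ (j + 1) * T z / (2 * (j + 1)) := fun z => by
    rw [maass_eq_latValue j ht, ← latValue_eq j ht hparity hcond z (hT z)]
    field_simp
  intro γ hγ z
  simp only [hval]
  rw [hmod γ hγ z]
  have hden := ModularGroup.denom_apply γ z
  have hJ0 : (γ 1 0 : ℂ) * z + γ 1 1 ≠ 0 := by
    have h := denom_ne_zero γ z
    rwa [hden] at h
  have him := ModularGroup.im_smul_eq_div_normSq γ z
  rw [hden] at him
  set J : ℂ := (γ 1 0 : ℂ) * z + γ 1 1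
  have hJc : (starRingEnd ℂ) J ≠ 0 := (map_ne_zero _).mpr hJ0
  have hk : (((γ • z : ℍ).im : ℝ) : ℂ) ^ (j + 1) * phi j J⁻¹ =
      J ^ (2 - ((j + 2 : ℕ) : ℤ)) * (z.im : ℂ) ^ (j + 1) := by
    rw [him, Complex.ofReal_div, ← Complex.mul_conj, phi, map_inv₀, inv_inv, ← inv_pow, inv_inv,
      show 2 - ((j + 2 : ℕ) : ℤ) = -(j : ℤ) by push_cast; ring, zpow_neg, zpow_natCast, div_pow,
      mul_pow, pow_succ J j]
    field_simp
  linear_combination (star (prodChar t ψ ϱ) ((γ 1 1 : ℤ) : ZMod (t * L * M)) * T z /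
    (2 * (j + 1))) * hk

theorem analyticOnNhd_maass [NeZero L] [NeZero M] (j : ℕ) {t : ℕ} (ht : 0 < t)
    (ψ : DirichletCharacter ℂ L) (ϱ : DirichletCharacter ℂ M) :
    AnalyticOnNhd ℝ (maass j t ψ ϱ) {w : ℂ | 0 < w.im} :=
  (polyGrowth_mockCoeff j ht ψ ϱ).analyticOnNhd.add
    ((analyticOnNhd_const.mul (analyticOnNhd_im_pow (j + 1) _)).add
      (analyticOnNhd_const.mul (analyticOnNhd_nonhol j (polyGrowth_shadowCoeff j t ψ ϱ))))

theorem modGrowth_maass [NeZero L] [NeZero M] (j : ℕ) {t : ℕ} (ht : 0 < t)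
    (ψ : DirichletCharacter ℂ L) (ϱ : DirichletCharacter ℂ M) : ModGrowth (maass j t ψ ϱ) :=
  (polyGrowth_mockCoeff j ht ψ ϱ).modGrowth.add
    (((modGrowth_const _).mul (modGrowth_im_pow (j + 1))).add
      ((modGrowth_const _).mul (modGrowth_nonhol j (polyGrowth_shadowCoeff j t ψ ϱ))))

/-- The non-holomorphic sum yields the shadow without its constant term, and the y^{j+1} term
supplies exactly that constant. -/
theorem dzbar_maass [NeZero L] [NeZero M] (j : ℕ) {t : ℕ} (ht : 0 < t)
    (ψ : DirichletCharacter ℂ L) (ϱ : DirichletCharacter ℂ M) {w : ℂ} (hw : 0 < w.im) :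
    dzbar (maass j t ψ ϱ) w = Complex.I / 2 * (w.im : ℂ) ^ j *
      (starRingEnd ℂ) (qser (shadowCoeff j t ψ ϱ) w) := by
  have hj : (j + 1 : ℂ) ≠ 0 := by exact_mod_cast Nat.succ_ne_zero j
  have hp := polyGrowth_mockCoeff j ht ψ ϱ
  have hs := polyGrowth_shadowCoeff j t ψ ϱ
  have d1 := (hp.analyticOnNhd w hw).differentiableAt
  have d2 := (analyticOnNhd_im_pow (j + 1) Set.univ w trivial).differentiableAt
  have d3 := (analyticOnNhd_nonhol j hs w hw).differentiableAt
  have dc : ∀ c : ℂ, DifferentiableAt ℝ (fun _ : ℂ => c) w := fun c => differentiableAt_const c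
  have e : maass j t ψ ϱ = fun v => qser (mockCoeff (j + 2) t ψ ϱ) v +
    ((starRingEnd ℂ) (eisConst (j + 2) ψ ϱ) / (j + 1) * (v.im : ℂ) ^ (j + 1) +
      -1 * nonhol j (shadowCoeff j t ψ ϱ) v) := rfl
  rw [e, dzbar_add d1 (((dc _).fun_mul d2).fun_add ((dc _).fun_mul d3)),
    dzbar_add ((dc _).fun_mul d2) ((dc _).fun_mul d3), dzbar_mul (dc _) d2, dzbar_mul (dc _) d3,
    dzbar_const, dzbar_const, dzbar_of_hasDerivAt (hp.hasDerivAt hw), dzbar_im_pow,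
    dzbar_nonhol j hs hw]
  have h0 : shadowCoeff j t ψ ϱ 0 = eisConst (j + 2) ψ ϱ := by simp [shadowCoeff, withConst]
  rw [h0, map_sub, Nat.add_sub_cancel]
  push_cast
  field_simp
  ring

theorem isHarmonicMaass_maass [NeZero L] [NeZero M] (j : ℕ) {t : ℕ} (ht : 0 < t)
    {ψ : DirichletCharacter ℂ L} {ϱ : DirichletCharacter ℂ M}
    (hparity : ψ (-1) * ϱ (-1) = (-1) ^ j) (h : 1 ≤ j ∨ (j = 0 ∧ ¬ (ψ = 1 ∧ ϱ = 1))) :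
    IsHarmonicMaass (2 - ((j + 2 : ℕ) : ℤ)) (t * L * M) (star (prodChar t ψ ϱ))
        (fun z => maass j t ψ ϱ z) ∧
      xi (2 - ((j + 2 : ℕ) : ℤ)) (fun z => maass j t ψ ϱ z) = eisSeriesT (j + 2) t ψ ϱ := by
  have : NeZero t := ⟨ht.ne'⟩
  have : NeZero (t * L * M) := ⟨mul_ne_zero (mul_ne_zero ht.ne' (NeZero.ne L)) (NeZero.ne M)⟩
  have hs := polyGrowth_shadowCoeff j t ψ ϱ
  have hmod := isModular_maass j ht hparity h
  have htoC : ∀ w : ℂ, 0 < w.im → toC (fun z => maass j t ψ ϱ z) =ᶠ[nhds w] maass j t ψ ϱ :=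
    fun w hw => toC_eventuallyEq (fun _ => rfl) hw
  have han : AnalyticOnNhd ℝ (toC fun z => maass j t ψ ϱ z) {w : ℂ | 0 < w.im} := fun w hw =>
    (analyticOnNhd_maass j ht ψ ϱ w hw).congr (htoC w hw).symm
  have hdz : ∀ w : ℂ, 0 < w.im → dzbar (toC fun z => maass j t ψ ϱ z) w = Complex.I / 2 *
      (w.im : ℂ) ^ j * (starRingEnd ℂ) (qser (shadowCoeff j t ψ ϱ) w) := fun w hw => by
    rw [dzbar_congr (htoC w hw), dzbar_maass j ht ψ ϱ hw]
  have hxi : xi (2 - ((j + 2 : ℕ) : ℤ)) (fun z => maass j t ψ ϱ z) =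
      fun z : ℍ => qser (shadowCoeff j t ψ ϱ) z := funext fun z => xi_eq_of_dzbar j hdz z
  refine ⟨⟨han, hmod, hypLaplacian_eq_zero_of_dzbar j han hs.differentiableOn hdz,
    hmod.linearExpGrowthAtCusps (fun _ => rfl) (modGrowth_maass j ht ψ ϱ), ?_⟩, ?_⟩
  · rw [hxi, sub_sub_cancel]
    exact (isModular_of_dzbar j _ _ han hmod hdz).holomorphicAtCusps hs.differentiableOn
      hs.modGrowth
  · rw [hxi]
    exact funext fun z => (eisSeriesT_eq_qser j ht ψ ϱ z).symm

theorem hasSum_mockG [NeZero L] [NeZero M] (j : ℕ) {t : ℕ} (ht : 0 < t)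
    (ψ : DirichletCharacter ℂ L) (ϱ : DirichletCharacter ℂ M) (z : ℍ) :
    HasSum (fun n : ℕ => mockCoeff (j + 2) t ψ ϱ n * qpow n z) (mockG (j + 2) t ψ ϱ z) := by
  have h : Summable fun n : ℕ => mockCoeff (j + 2) t ψ ϱ n * qpow n z := by
    refine ((polyGrowth_mockCoeff j ht ψ ϱ).hasSum z.im_pos).summable.congr fun n => ?_
    rw [qpow, Int.cast_natCast]
  exact h.hasSum

theorem mockG_eq_qser [NeZero L] [NeZero M] (j t : ℕ) (ψ : DirichletCharacter ℂ L)
    (ϱ : DirichletCharacter ℂ M) (z : ℍ) :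
    mockG (j + 2) t ψ ϱ z = qser (mockCoeff (j + 2) t ψ ϱ) z := by
  simp only [mockG, qser, qpow, Int.cast_natCast]

theorem hasSum_mockG_sub_maass [NeZero L] [NeZero M] (j t : ℕ) (ψ : DirichletCharacter ℂ L)
    (ϱ : DirichletCharacter ℂ M) (z : ℍ) :
    HasSum (fun n : ℕ => star (shadowCoeff j t ψ ϱ n) * beta ((j + 2 : ℕ) : ℤ) n z.im *
      qpow (-n) z) (mockG (j + 2) t ψ ϱ z - maass j t ψ ϱ z) := by
  have h1 := hasSum_nonhol j (polyGrowth_shadowCoeff j t ψ ϱ) z.im_pos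
  -- The index 0 is absent from `nonhol`; its contribution comes from the explicit power of y, since
  -- β(0, y) = -y^{j+1} / (j + 1).
  have h2 := hasSum_ite_eq (0 : ℕ)
    (-((starRingEnd ℂ) (eisConst (j + 2) ψ ϱ) / (j + 1) * (z.im : ℂ) ^ (j + 1)))
  refine hasSum_of_eq (h2.add h1) (fun n => ?_) ?_
  · split_ifs with hn
    · subst hn
      have hk : ((j + 2 : ℕ) : ℤ) ≠ 1 := by omega
      have h0 : shadowCoeff j t ψ ϱ 0 = eisConst (j + 2) ψ ϱ := by simp [shadowCoeff, withConst]
      have hj : (1 - ((j + 2 : ℕ) : ℝ)) = -(j + 1) := by push_cast; ring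
      rw [beta, if_pos rfl, if_neg hk, h0, Int.cast_natCast, hj,
        show ((j + 2 : ℕ) : ℤ) - 1 = ((j + 1 : ℕ) : ℤ) by push_cast; ring, zpow_natCast]
      simp only [Nat.cast_zero, mul_zero, bexp_zero_left, qpow, RCLike.star_def]
      push_cast
      simp only [neg_zero, mul_zero, zero_mul, Complex.exp_zero, inv_neg]
      ring
    · rw [beta_eq_bexp j hn z.im_pos, zero_add, qpow]
      rfl
  · rw [mockG_eq_qser, maass, coe_im]
    ring

theorem isMockModularForm_mockG [NeZero L] [NeZero M] (j : ℕ) {t : ℕ} (ht : 0 < t)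
    {ψ : DirichletCharacter ℂ L} {ϱ : DirichletCharacter ℂ M}
    (hparity : ψ (-1) * ϱ (-1) = (-1) ^ j) (h : 1 ≤ j ∨ (j = 0 ∧ ¬ (ψ = 1 ∧ ϱ = 1))) :
    IsMockModularForm ((j + 2 : ℕ) : ℤ) (t * L * M) (star (prodChar t ψ ϱ))
      (mockG (j + 2) t ψ ϱ) (eisSeriesT (j + 2) t ψ ϱ) := by
  obtain ⟨h1, h2⟩ := isHarmonicMaass_maass j ht hparity h
  refine ⟨_, h1, h2, 0, fun n => if n < 0 then 0 else mockCoeff (j + 2) t ψ ϱ n.toNat,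
    shadowCoeff j t ψ ϱ, fun n hn => if_pos hn, fun z => ?_, hasSum_mockG_sub_maass j t ψ ϱ⟩
  refine (Nat.cast_injective.hasSum_iff (f := fun n : ℤ => (if n < 0 then 0 else
    mockCoeff (j + 2) t ψ ϱ n.toNat) * qpow n z) fun n hn => ?_).mp
      (hasSum_of_eq (hasSum_mockG j ht ψ ϱ z) (fun n => ?_) rfl)
  · have : n < 0 := by
      by_contra h0
      exact hn ⟨n.toNat, Int.toNat_of_nonneg (not_lt.mp h0)⟩
    rw [if_pos this, zero_mul]
  · simp

end

end MockEis

end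

theorem theorem1p1 (k L M t : ℕ) [NeZero L] [NeZero M] (ht : 1 ≤ t)
    (ψ : DirichletCharacter ℂ L) (ϱ : DirichletCharacter ℂ M)
    (hparity : ψ (-1) * ϱ (-1) = (-1) ^ k)
    (hk : 2 < k ∨ (k = 2 ∧ ¬ (ψ = 1 ∧ ϱ = 1))) :
    (∀ z : UpperHalfPlane,
      HasSum (fun n : ℕ => MockEis.mockCoeff k t ψ ϱ n * MockEis.qpow n z)
        (MockEis.mockG k t ψ ϱ z)) ∧
    MockEis.IsMockModularForm k (t * L * M) (star (MockEis.prodChar t ψ ϱ))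
      (MockEis.mockG k t ψ ϱ) (MockEis.eisSeriesT k t ψ ϱ) := by
  obtain ⟨j, rfl⟩ : ∃ j, k = j + 2 := ⟨k - 2, by omega⟩
  refine ⟨MockEis.hasSum_mockG j ht ψ ϱ, MockEis.isMockModularForm_mockG j ht ?_ ?_⟩
  -- The weights k and j = k - 2 have the same parity.
  · rw [hparity, pow_add]
    norm_num
  · rcases hk with hk | ⟨hk, h⟩
    · exact Or.inl (by omega)
    · exact Or.inr ⟨by omega, h⟩
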